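/- **Setting.** Let $M$ be a smooth (Hausdorff) $n$-dimensional manifold, $F$ a Finsler metric on $M$ (smooth and positive off the zero section, fibrewise positively homogeneous of degree $1$, with $F^2$ fibrewise strongly convex), and $\gamma_0\colon[0,1]\to M$ a nonconstant geodesic of $(M,F)$ whose end points are not conjugate along $\gamma_0$. Let $h$ be any Riemannian metric on $M$, with exponential map $\exp$, and let $E_1,\dots,E_n$ be smooth $h$-orthonormal vector fields along $\gamma_0$. Let $U\subset\mathbb R^n$ be the open Euclidean ball with centre $0$ and radius $\rho/2$, where $\rho$ is the infimum over $t\in[0,1]$ of the injectivity radii of $h$ at $\gamma_0(t)$ ($U=\mathbb R^n$ if $\rho=\infty$), and put $$\varphi(t,q)=\exp_{\gamma_0(t)}\Big(\sum_i q_iE_i(t)\Big),\qquad \tilde G(t,q,y)=F^2\big(\varphi(t,q),\mathrm d\varphi(t,q)[(1,y)]\big),\qquad (t,q,y)\in[0,1]\times U\times\mathbb R^n .$$ Let $U'$ be an open set with $0\in U'$, $\overline{U'}\subset U$, let $\alpha\colon\mathbb R^n\to\mathbb R$ be smooth with $\alpha=1$ on $U'$ and $\alpha=0$ outside $U$, and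 let $$\mathcal L(t,q,y)=\alpha(q)\tilde G(t,q,y)+(1-\alpha(q))|y|^2,\qquad \mathcal A_{\mathcal L}(x)=\frac12\int_0^1\mathcal L(s,x(s),\dot x(s))\,\mathrm ds,\quad x\in H:=H^1_0([0,1],\mathbb R^n),$$ and $c=\mathcal A_{\mathcal L}(0)$. Fix a scalar product on $H$ that induces its topology. Let $\nabla\mathcal A_{\mathcal L}$ be the gradient of $\mathcal A_{\mathcal L}$, and let $A$ be the operator on $H$ that represents the second Gateaux differential of $\mathcal A_{\mathcal L}$ at $0$, both with respect to this scalar product. Let $\mathcal U$ be an open neighbourhood of $0$ in $H$, let $\eta_0\colon H\to[0,1]$ be a smooth function with $\eta_0=1$ on $\mathcal U$, and let $$Y(x)=-\eta_0(x)Ax-(1-\eta_0(x))\nabla\mathcal A_{\mathcal L}(x),\qquad x\in H .$$ **Lemma.** Let $\mathcal V\subset\mathcal U$ be a closed neighbourhood of $0$. Then there are $\varepsilon>0$ and an open neighbourhood $O'\subset\mathcal V$ of $0$ in $H$ such that, for every $x\in O'$, the Cauchy problem $\dot\psi=Y(\psi)$, $\psi(0)=x$ has a maximal solution, and every maximal solution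 $\psi\colon(\omega^-,\omega^+)\to H$ of it satisfies one of the following: 1. $\omega^+=+\infty$ and $\psi(t)\in\mathcal V$ for all $t\ge 0$; 2. $\psi$ stays in $\mathcal V$ at least until $\mathcal A_{\mathcal L}$ becomes less than $c-\varepsilon$, that is, there is $T\in[0,\omega^+)$ with $\mathcal A_{\mathcal L}(\psi(T))<c-\varepsilon$ and $\psi(t)\in\mathcal V$ for all $t\in[0,T]$. -/

import Mathlib

open Set Filter Topology MeasureTheory Bundle
open scoped Manifold ContDiff NNReal ENNReal

noncomputable section

namespace FinslerFlow

/-- `ℝⁿ` with its Euclidean norm. -/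
abbrev Eucl (n : ℕ) : Type := EuclideanSpace ℝ (Fin n)

/-! ### Euler–Lagrange equation, geodesics, Jacobi fields, exponential map -/

section Geometry

variable {n : ℕ} {M : Type*} [TopologicalSpace M] [ChartedSpace (Eucl n) M]

/-- A Lagrangian on `TM` read in the chart at `p`, as a function of position and velocity. -/
def localLagrangian (L : TangentBundle (𝓡 n) M → ℝ) (p : M) (z : Eucl n × Eucl n) : ℝ :=
  L ⟨(extChartAt (𝓡 n) p).symm z.1,
    mfderiv 𝓘(ℝ, Eucl n) (𝓡 n) (extChartAt (𝓡 n) p).symm z.1 z.2⟩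

/-- The partial differential with respect to the velocity. -/
def momentum (L : TangentBundle (𝓡 n) M → ℝ) (p : M) (z : Eucl n × Eucl n) : Eucl n →L[ℝ] ℝ :=
  (fderiv ℝ (localLagrangian L p) z).comp (ContinuousLinearMap.inr ℝ (Eucl n) (Eucl n))

/-- The partial differential with respect to the position. -/
def force (L : TangentBundle (𝓡 n) M → ℝ) (p : M) (z : Eucl n × Eucl n) : Eucl n →L[ℝ] ℝ :=
  (fderiv ℝ (localLagrangian L p) z).comp (ContinuousLinearMap.inl ℝ (Eucl n) (Eucl n))

/-- The velocity of a curve defined on `[0,1]` (one-sided at the end points). -/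
def velocity (γ : ℝ → M) (t : ℝ) : TangentSpace (𝓡 n) (γ t) :=
  mfderivWithin 𝓘(ℝ, ℝ) (𝓡 n) γ (Icc 0 1) t (1 : ℝ)

/-- The curve `(u, u')` of positions and velocities in the chart at `p`. -/
def chartLift (p : M) (γ : ℝ → M) (t : ℝ) : Eucl n × Eucl n :=
  (extChartAt (𝓡 n) p (γ t),
    derivWithin (fun s => extChartAt (𝓡 n) p (γ s)) (Icc (0 : ℝ) 1) t)

/-- A smooth curve `γ : [0,1] → M` that solves, in all charts, the Euler–Lagrange equation
`d/dt (∂L/∂y (u, u')) = ∂L/∂q (u, u')`. For `L = F²` these are the (affinely parametrized) geodesics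
of the Finsler metric `F`, and for `L(v) = h(v,v)` those of the Riemannian metric `h`. -/
structure IsGeodesic (L : TangentBundle (𝓡 n) M → ℝ) (γ : ℝ → M) : Prop where
  smooth : ContMDiffOn 𝓘(ℝ, ℝ) (𝓡 n) ∞ γ (Icc 0 1)
  euler_lagrange : ∀ p : M, ∀ t ∈ Icc (0 : ℝ) 1, γ t ∈ (chartAt (Eucl n) p).source →
    HasDerivWithinAt (fun s => momentum L p (chartLift p γ s)) (force L p (chartLift p γ t))
      (Icc 0 1) t

/-- The components, in the chart at `p`, of a vector field along `γ`. -/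
def chartField (p : M) (γ : ℝ → M) (J : ∀ t : ℝ, TangentSpace (𝓡 n) (γ t)) (t : ℝ) : Eucl n :=
  mfderiv (𝓡 n) 𝓘(ℝ, Eucl n) (extChartAt (𝓡 n) p) (γ t) (J t)

/-- The pair `(ξ, ξ')` for the chart representative `ξ` of a vector field along `γ`. -/
def chartFieldLift (p : M) (γ : ℝ → M) (J : ∀ t : ℝ, TangentSpace (𝓡 n) (γ t)) (t : ℝ) :
    Eucl n × Eucl n :=
  (chartField p γ J t, derivWithin (chartField p γ J) (Icc (0 : ℝ) 1) t)

/-- Jacobi fields along `γ`: vector fields along `γ` that solve, in all charts, the linearization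
at `γ` of the Euler–Lagrange equation. -/
structure IsJacobiField [IsManifold (𝓡 n) ∞ M] (L : TangentBundle (𝓡 n) M → ℝ) (γ : ℝ → M)
    (J : ∀ t : ℝ, TangentSpace (𝓡 n) (γ t)) : Prop where
  regular : ContMDiffOn 𝓘(ℝ, ℝ) (𝓡 n).tangent 1
    (fun t => (⟨γ t, J t⟩ : TangentBundle (𝓡 n) M)) (Icc 0 1)
  jacobi : ∀ p : M, ∀ t ∈ Icc (0 : ℝ) 1, γ t ∈ (chartAt (Eucl n) p).source →
    HasDerivWithinAt
      (fun s => fderiv ℝ (momentum L p) (chartLift p γ s) (chartFieldLift p γ J s))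
      (fderiv ℝ (force L p) (chartLift p γ t) (chartFieldLift p γ J t))
      (Icc 0 1) t

/-- The end points of `γ` are conjugate along `γ`. -/
def ConjugateEndpoints [IsManifold (𝓡 n) ∞ M] (L : TangentBundle (𝓡 n) M → ℝ) (γ : ℝ → M) : Prop :=
  ∃ J : ∀ t : ℝ, TangentSpace (𝓡 n) (γ t), IsJacobiField L γ J ∧ J 0 = 0 ∧ J 1 = 0 ∧
    ∃ t ∈ Icc (0 : ℝ) 1, J t ≠ 0

variable (n M) in
/-- A Finsler metric: positive and smooth off the zero section, positively homogeneous of degree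
one, with `F²` fibrewise strongly convex (the Hessian of `F²` along the fibres is positive definite
off the zero section). -/
structure FinslerMetric [IsManifold (𝓡 n) ∞ M] where
  toFun : TangentBundle (𝓡 n) M → ℝ
  pos : ∀ (p : M) (v : TangentSpace (𝓡 n) p), v ≠ 0 → 0 < toFun ⟨p, v⟩
  homogeneous : ∀ (p : M) (v : TangentSpace (𝓡 n) p) (a : ℝ), 0 ≤ a →
    toFun ⟨p, a • v⟩ = a * toFun ⟨p, v⟩
  smooth : ContMDiffOn (𝓡 n).tangent 𝓘(ℝ, ℝ) ∞ toFun {v | v.snd ≠ 0}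
  convex : ∀ (p : M) (v w : TangentSpace (𝓡 n) p), v ≠ 0 → w ≠ 0 →
    0 < iteratedDeriv 2 (fun s : ℝ => toFun ⟨p, v + s • w⟩ ^ 2) 0

/-- The Lagrangian `F²`. -/
def FinslerMetric.sq [IsManifold (𝓡 n) ∞ M] (F : FinslerMetric n M) (v : TangentBundle (𝓡 n) M) :
    ℝ :=
  F.toFun v ^ 2

variable (n M) in
/-- Smooth Riemannian metrics on `M`. -/
abbrev RMetric [IsManifold (𝓡 n) ∞ M] : Type _ :=
  ContMDiffRiemannianMetric (𝓡 n) ∞ (Eucl n) (fun p : M => TangentSpace (𝓡 n) p)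

variable [IsManifold (𝓡 n) ∞ M]

/-- The quadratic Lagrangian `v ↦ h(v,v)`. -/
def metricSq (h : RMetric n M) (v : TangentBundle (𝓡 n) M) : ℝ :=
  h.inner v.proj v.snd v.snd

/-- There is an `h`-geodesic `[0,1] → M` with initial velocity `v` and end point `x`. -/
def IsExp (h : RMetric n M) (v : TangentBundle (𝓡 n) M) (x : M) : Prop :=
  ∃ σ : ℝ → M, IsGeodesic (metricSq h) σ ∧
    (⟨σ 0, velocity σ 0⟩ : TangentBundle (𝓡 n) M) = v ∧ σ 1 = x

/-- The domain of the exponential map of `h`. -/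
def expDomain (h : RMetric n M) : Set (TangentBundle (𝓡 n) M) := {v | ∃ x, IsExp h v x}

open Classical in
/-- The exponential map of `h` (with the base point as value outside its domain). -/
def expMap (h : RMetric n M) (v : TangentBundle (𝓡 n) M) : M :=
  if hv : ∃ x, IsExp h v x then hv.choose else v.proj

/-- `exp_p` is a diffeomorphism from the open `h`-ball of radius `r` in `T_pM` onto its image. The
first clause says that `exp` is defined and smooth around that ball in `TM`; as the domain of `exp`
is open and `exp` is smooth on it, this only means that the ball lies in the domain. -/
def IsNormalRadius (h : RMetric n M) (p : M) (r : ℝ≥0) : Prop :=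
  (∃ W : Set (TangentBundle (𝓡 n) M), IsOpen W ∧ W ⊆ expDomain h ∧
    (∀ v : TangentSpace (𝓡 n) p, h.inner p v v < (r : ℝ) ^ 2 → ⟨p, v⟩ ∈ W) ∧
    ContMDiffOn (𝓡 n).tangent (𝓡 n) ∞ (expMap h) W) ∧
  InjOn (fun v : Eucl n => expMap h ⟨p, v⟩) {v | h.inner p v v < (r : ℝ) ^ 2} ∧
  ∀ v : Eucl n, h.inner p v v < (r : ℝ) ^ 2 →
    Function.Injective
      (mfderiv 𝓘(ℝ, Eucl n) (𝓡 n) (fun w : Eucl n => expMap h ⟨p, w⟩) v)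

/-- The injectivity radius of `h` at `p` (possibly infinite). -/
def injRadius (h : RMetric n M) (p : M) : ℝ≥0∞ :=
  ⨆ (r : ℝ≥0) (_ : IsNormalRadius h p r), (r : ℝ≥0∞)

/-- The Euclidean ball of radius half the least injectivity radius at the points of `γ`. -/
def ballU (h : RMetric n M) (γ : ℝ → M) : Set (Eucl n) :=
  {q | ‖q‖ₑ < (⨅ t ∈ Icc (0 : ℝ) 1, injRadius h (γ t)) / 2}

/-- The map `φ(t,q) = exp_{γ(t)} (∑ qᵢ Eᵢ(t))`. -/
def normalMap (h : RMetric n M) (γ : ℝ → M) (e : Fin n → ∀ t : ℝ, TangentSpace (𝓡 n) (γ t))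
    (z : ℝ × Eucl n) : M :=
  expMap h ⟨γ z.1, ∑ i, z.2 i • e i z.1⟩

/-- The frame `E₁, …, Eₙ` along `γ` is smooth and `h`-orthonormal. -/
structure IsOrthonormalFrame (h : RMetric n M) (γ : ℝ → M)
    (e : Fin n → ∀ t : ℝ, TangentSpace (𝓡 n) (γ t)) : Prop where
  smooth : ∀ i, ContMDiffOn 𝓘(ℝ, ℝ) (𝓡 n).tangent ∞
    (fun t => (⟨γ t, e i t⟩ : TangentBundle (𝓡 n) M)) (Icc 0 1)
  orthonormal : ∀ t ∈ Icc (0 : ℝ) 1, ∀ i j,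
    h.inner (γ t) (e i t) (e j t) = if i = j then 1 else 0

/-- The Lagrangian `G̃(t,q,y) = F²(φ(t,q), dφ(t,q)[(1,y)])` on `[0,1] × U × ℝⁿ`. -/
def tildeG (F : FinslerMetric n M) (h : RMetric n M) (γ : ℝ → M)
    (e : Fin n → ∀ t : ℝ, TangentSpace (𝓡 n) (γ t)) (t : ℝ) (q y : Eucl n) : ℝ :=
  F.sq ⟨normalMap h γ e (t, q),
    mfderivWithin 𝓘(ℝ, ℝ × Eucl n) (𝓡 n) (normalMap h γ e) (Icc 0 1 ×ˢ ballU h γ) (t, q)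
      ((1, y) : ℝ × Eucl n)⟩

/-- The Lagrangian `𝓛 = α G̃ + (1 - α) |y|²`. -/
def lagr (F : FinslerMetric n M) (h : RMetric n M) (γ : ℝ → M)
    (e : Fin n → ∀ t : ℝ, TangentSpace (𝓡 n) (γ t)) (α : Eucl n → ℝ)
    (t : ℝ) (q y : Eucl n) : ℝ :=
  α q * tildeG F h γ e t q y + (1 - α q) * ‖y‖ ^ 2

end Geometry

/-! ### The space `H¹₀([0,1], ℝⁿ)` -/

/-- Lebesgue measure on `[0,1]`. -/
abbrev vol01 : Measure ℝ := volume.restrict (Icc 0 1)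

/-- `H¹₀([0,1], ℝⁿ)`, every curve `x` being represented by its derivative `x' ∈ L²`. A function
in `L²` is the derivative of such a curve if and only if its integral vanishes; the norm is the
`L²` norm of the derivative. See `mem_H10_iff` for the description through absolutely continuous
curves. -/
def H10 (n : ℕ) : Submodule ℝ (Lp (Eucl n) 2 vol01) where
  carrier := {v | ∫ t, v t ∂vol01 = 0}
  zero_mem' := by
    have : ∫ t, (0 : Lp (Eucl n) 2 vol01) t ∂vol01 = ∫ _, (0 : Eucl n) ∂vol01 :=
      integral_congr_ae (Lp.coeFn_zero _ _ _)
    simpa using this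
  add_mem' := by
    intro v w hv hw
    have hi : ∀ u : Lp (Eucl n) 2 vol01, Integrable u vol01 := fun u =>
      (Lp.memLp u).integrable (by norm_num)
    have h1 : ∫ t, (v + w) t ∂vol01 = ∫ t, (v t + w t) ∂vol01 :=
      integral_congr_ae (Lp.coeFn_add v w)
    rw [integral_add (hi v) (hi w)] at h1
    simp only [mem_ofPred_eq] at hv hw ⊢
    rw [h1, hv, hw, add_zero]
  smul_mem' := by
    intro a v hv
    have h1 : ∫ t, (a • v) t ∂vol01 = ∫ t, a • v t ∂vol01 :=
      integral_congr_ae (Lp.coeFn_smul a v)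
    rw [integral_smul] at h1
    simp only [mem_ofPred_eq] at hv ⊢
    rw [h1, hv, smul_zero]

/-- The derivative of an element of `H¹₀` (a representative of the class in `L²`). -/
def H10vel {n : ℕ} (x : H10 n) (t : ℝ) : Eucl n := (x : Lp (Eucl n) 2 vol01) t

/-- The values of an element of `H¹₀`. -/
def H10curve {n : ℕ} (x : H10 n) (t : ℝ) : Eucl n := ∫ s in (0 : ℝ)..t, H10vel x s

theorem intervalIntegrable_of_memLp {n : ℕ} {v : ℝ → Eucl n} (hv : MemLp v 2 vol01) :
    IntervalIntegrable v volume 0 1 := by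
  rw [intervalIntegrable_iff_integrableOn_Icc_of_le zero_le_one]
  exact hv.integrable (by norm_num)

theorem absolutelyContinuous_integral {n : ℕ} {v : ℝ → Eucl n}
    (hv : IntervalIntegrable v volume 0 1) :
    AbsolutelyContinuousOnInterval (fun t => ∫ s in (0 : ℝ)..t, v s) 0 1 := by
  have hn := hv.norm.absolutelyContinuousOnInterval_intervalIntegral
    (c := 0) (by simp)
  rw [absolutelyContinuousOnInterval_iff] at hn ⊢
  intro ε hε
  obtain ⟨δ, hδ, hd⟩ := hn ε hε
  refine ⟨δ, hδ, fun I hI hlt => lt_of_le_of_lt (Finset.sum_le_sum fun i hi => ?_) (hd I hI hlt)⟩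
  have hmem := hI.1 i hi
  have hint : ∀ c ∈ uIcc (0 : ℝ) 1, IntervalIntegrable v volume 0 c := fun c hc =>
    hv.mono_set (uIcc_subset_uIcc (by simp) hc)
  have h1 := hint _ hmem.1
  have h2 := hint _ hmem.2
  rw [dist_eq_norm, Real.dist_eq, intervalIntegral.integral_interval_sub_left h1 h2,
    intervalIntegral.integral_interval_sub_left h1.norm h2.norm]
  exact intervalIntegral.norm_integral_le_abs_integral_norm

/-- The curves given by `H10 n` are exactly the absolutely continuous curves on `[0,1]` with
derivative in `L²` that vanish at the end points. -/
theorem mem_H10_iff {n : ℕ} (x v : ℝ → Eucl n) :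
    (∃ ξ : H10 n, H10vel ξ =ᵐ[vol01] v ∧ ∀ t ∈ Icc (0 : ℝ) 1, H10curve ξ t = x t) ↔
      ∃ x' : ℝ → Eucl n, EqOn x x' (Icc 0 1) ∧ AbsolutelyContinuousOnInterval x' 0 1 ∧
        MemLp v 2 vol01 ∧ (∀ᵐ t ∂vol01, HasDerivAt x' (v t) t) ∧ x' 0 = 0 ∧ x' 1 = 0 := by
  have h01 : uIcc (0 : ℝ) 1 = Icc 0 1 := uIcc_of_le zero_le_one
  constructor
  · rintro ⟨ξ, hξ, hx⟩
    have hm : MemLp (H10vel ξ) 2 vol01 := Lp.memLp (ξ : Lp (Eucl n) 2 vol01)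
    have hi := intervalIntegrable_of_memLp hm
    refine ⟨H10curve ξ, fun t ht => (hx t ht).symm, absolutelyContinuous_integral hi,
      hm.ae_eq hξ, ?_, by simp [H10curve], ?_⟩
    · have h1 := hi.ae_hasDerivAt_integral
      rw [h01] at h1
      have h2 := (ae_restrict_iff' measurableSet_Icc).2 h1
      filter_upwards [h2, hξ] with t ht hξt
      rw [← hξt]
      exact ht 0 (by simp)
    · have := ξ.2
      change ∫ t, H10vel ξ t ∂vol01 = 0 at this
      rw [H10curve, intervalIntegral.integral_of_le zero_le_one, ← integral_Icc_eq_integral_Ioc]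
      exact this
  · rintro ⟨x', hxx, hac, hv, hd, h0, h1⟩
    have hi := intervalIntegrable_of_memLp hv
    have key : ∀ t ∈ Icc (0 : ℝ) 1, x' t = ∫ s in (0 : ℝ)..t, v s := by
      have hac' := hac.sub (absolutelyContinuous_integral hi)
      have hz : ∀ᵐ t, t ∈ uIcc (0 : ℝ) 1 →
          HasDerivAt (x' - fun t => ∫ s in (0 : ℝ)..t, v s) 0 t := by
        have hd' := (ae_restrict_iff' measurableSet_Icc).1 hd
        filter_upwards [hi.ae_hasDerivAt_integral, hd'] with t ht1 ht2 ht
        have := (ht2 (h01 ▸ ht)).sub (ht1 ht 0 (by simp))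
        simpa using this
      obtain ⟨C, hC⟩ := hac'.const_of_ae_hasDerivAt_zero hz
      have hC0 := hC 0 (by simp)
      simp only [Pi.sub_apply, h0, intervalIntegral.integral_same, sub_zero] at hC0
      intro t ht
      have := hC t (h01 ▸ ht)
      rw [← hC0] at this
      exact sub_eq_zero.1 this
    have hmem : hv.toLp v ∈ H10 n := by
      change ∫ t, hv.toLp v t ∂vol01 = 0
      rw [integral_congr_ae hv.coeFn_toLp, integral_Icc_eq_integral_Ioc,
        ← intervalIntegral.integral_of_le zero_le_one, ← key 1 (by simp), h1]
    refine ⟨⟨hv.toLp v, hmem⟩, hv.coeFn_toLp, fun t ht => ?_⟩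
    rw [hxx ht, key t ht, H10curve]
    refine intervalIntegral.integral_congr_ae ?_
    have h2 := (ae_restrict_iff' measurableSet_Icc).1 hv.coeFn_toLp
    filter_upwards [h2] with s hs hst
    refine hs ?_
    rw [uIoc_of_le ht.1] at hst
    exact ⟨hst.1.le, hst.2.trans ht.2⟩

/-! ### The action functional and the vector field -/

/-- The action `𝒜(x) = ½ ∫₀¹ L(s, x, x') ds`. -/
def action {n : ℕ} (L : ℝ → Eucl n → Eucl n → ℝ) (x : H10 n) : ℝ :=
  1 / 2 * ∫ s, L s (H10curve x s) (H10vel x s) ∂vol01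

section Hilbert

variable {H : Type*} [NormedAddCommGroup H] [NormedSpace ℝ H]

open Classical in
/-- The vector that represents a functional `f` with respect to the scalar product `b`. -/
def rieszRep (b : H →L[ℝ] H →L[ℝ] ℝ) (f : H → ℝ) : H :=
  if hf : ∃ z, ∀ y, b z y = f y then hf.choose else 0

/-- The gradient of `𝒜` with respect to the scalar product `b`. -/
def gradWrt (b : H →L[ℝ] H →L[ℝ] ℝ) (𝒜 : H → ℝ) (x : H) : H :=
  rieszRep b (fun y => fderiv ℝ 𝒜 x y)

/-- The second Gateaux differential of `𝒜` at `0`. -/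
def secondGateaux (𝒜 : H → ℝ) (ξ η : H) : ℝ :=
  deriv (fun s : ℝ => fderiv ℝ 𝒜 (s • ξ) η) 0

/-- The operator that represents the second Gateaux differential of `𝒜` at `0` with respect to
the scalar product `b`. -/
def hessOp (b : H →L[ℝ] H →L[ℝ] ℝ) (𝒜 : H → ℝ) (ξ : H) : H :=
  rieszRep b (secondGateaux 𝒜 ξ)

/-- The vector field `Y = -η A - (1 - η) ∇𝒜`. -/
def fieldY (b : H →L[ℝ] H →L[ℝ] ℝ) (𝒜 : H → ℝ) (η : H → ℝ) (x : H) : H :=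
  -(η x • hessOp b 𝒜 x) - (1 - η x) • gradWrt b 𝒜 x

/-- `ψ` solves `ψ' = Y(ψ)`, `ψ(0) = x` on the open interval `(a, b)` around `0`. -/
structure IsSolution (Y : H → H) (x : H) (a b : EReal) (ψ : ℝ → H) : Prop where
  neg : a < 0
  pos : 0 < b
  initial : ψ 0 = x
  ode : ∀ t : ℝ, a < t → t < b → HasDerivAt ψ (Y (ψ t)) t

/-- `ψ` is a solution with maximal interval of definition `(a, b)`. -/
structure IsMaximalSolution (Y : H → H) (x : H) (a b : EReal) (ψ : ℝ → H) : Prop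
    extends IsSolution Y x a b ψ where
  maximal : ∀ (a' b' : EReal) (χ : ℝ → H), IsSolution Y x a' b' χ → a' ≤ a → b ≤ b' →
    (∀ t : ℝ, a < t → t < b → χ t = ψ t) → a' = a ∧ b' = b

end Hilbert

end FinslerFlow

end

/-! Near `0` the field is linear: `η₀ = 1` on `𝓤`, so `Y = -A` there, where `A` represents the
second variation `B` of the action with respect to the scalar product `b`. As long as the explicit
flow `e^{-tA} x` stays in `𝓤`, every maximal solution is defined and coincides with it. Hence the
question concerns a linear flow and a quadratic form.

The form `B` satisfies a Gårding inequality `B(x,x) ≥ c‖x‖² - ‖Lx‖²` with `L` of finite rank.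
Consequently (`exists_isNegativeEigenfamily`) `H` splits `b`-orthogonally into the span of finitely
many eigenvectors with negative eigenvalues and a complement on which `B ≥ 0`. Along the flow the
`b`-norm of the component `Px` in the negative space does not decrease, and that of `x - Px` does
not increase. Take for `O'` the box `|Px|² < r²`, `|x - Px|² < q`. A trajectory either stays in the
closed box for all positive times, which is the first alternative, or reaches `|Px| = r` without
having left it. In the second case `𝒜(Px) ≤ 𝒜(0) - μr²/4`, by the expansion of `𝒜` at its critical
point `0`, uniform on the compact unit sphere of the negative space. Since `x - Px` is small,
replacing `Px` by `x` costs less than `μr²/8`. So `ε = μr²/8` works. This is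
`exists_flow_neighbourhood`; it uses that `𝒜` is `C^{1,1}` near `0` and that its differential has a
derivative at `0` along each line.

It remains to see that the action has these properties. A curve that is small in `H¹₀` stays in
`U'`, where the Lagrangian is `G̃`. Since `dφ(1,y) = dφ(0, y + w)` for a smooth drift `w(t,q)`,
`G̃(t,q,y) = N(t,q,y + w(t,q))` with `N` positively homogeneous of degree two in the velocity. `N`
is smooth only off the zero section, but homogeneity makes its differential Lipschitz up to it
(`IsHomogeneousLagrangian.lipschitz_fderiv`), and this gives the `C^{1,1}` action. The geodesic has
nonzero velocity, so `w(t,0) ≠ 0` and `G̃` is smooth near `(q,y) = (0,0)`; hence the second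
variation at `0` exists. Strong convexity of `F²` makes its velocity part elliptic, while position
terms are controlled by finitely many values of the curve (`exists_sampling`): this is the Gårding
inequality. Finally `0` is critical because the Euler–Lagrange equation is invariant under the
moving coordinates `φ`. -/

namespace FinslerFlow

/-! ### Maximal solutions and linear flows -/

section Flow

variable {H : Type*} [NormedAddCommGroup H] [NormedSpace ℝ H]

/-- Every solution of an autonomous Cauchy problem extends to a maximal one. -/
theorem IsSolution.exists_isMaximalSolution {Y : H → H} {x : H} {a₀ b₀ : EReal} {ψ₀ : ℝ → H}
    (h₀ : IsSolution Y x a₀ b₀ ψ₀) :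
    ∃ (a b : EReal) (ψ : ℝ → H), IsMaximalSolution Y x a b ψ := by
  -- Zorn's lemma for the extension of solutions. The values of a curve outside its interval are
  -- free, so `r` is only a preorder; the upper bound of a chain is the common continuation of its
  -- members.
  let S := {z : EReal × EReal × (ℝ → H) // IsSolution Y x z.1 z.2.1 z.2.2}
  let r : S → S → Prop := fun z w => w.1.1 ≤ z.1.1 ∧ z.1.2.1 ≤ w.1.2.1 ∧
    ∀ t : ℝ, z.1.1 < t → t < z.1.2.1 → w.1.2.2 t = z.1.2.2 t
  have hrefl : ∀ z, r z z := fun z => ⟨le_rfl, le_rfl, fun _ _ _ => rfl⟩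
  have htrans : ∀ {z w u : S}, r z w → r w u → r z u := fun h1 h2 =>
    ⟨h2.1.trans h1.1, h1.2.1.trans h2.2.1, fun t ht ht' =>
      (h2.2.2 t (h1.1.trans_lt ht) (ht'.trans_le h1.2.1)).trans (h1.2.2 t ht ht')⟩
  have : Nonempty S := ⟨⟨(a₀, b₀, ψ₀), h₀⟩⟩
  have hchain : ∀ c : Set S, IsChain r c → c.Nonempty → ∃ ub, ∀ a ∈ c, r a ub := by
    classical
    intro c hc ⟨z₀, hz₀⟩
    have : Std.Refl r := ⟨hrefl⟩
    have hcov : ∀ z ∈ c, ∀ w ∈ c, ∀ t : ℝ, z.1.1 < t → t < z.1.2.1 → w.1.1 < t → t < w.1.2.1 →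
        z.1.2.2 t = w.1.2.2 t := by
      intro z hz w hw t h1 h2 h3 h4
      rcases hc.total hz hw with h | h
      · exact (h.2.2 t h1 h2).symm
      · exact h.2.2 t h3 h4
    let χ : ℝ → H := fun t =>
      if h : ∃ z ∈ c, z.1.1 < (t : EReal) ∧ (t : EReal) < z.1.2.1 then h.choose.1.2.2 t else 0
    have hχ : ∀ z ∈ c, ∀ t : ℝ, z.1.1 < t → t < z.1.2.1 → χ t = z.1.2.2 t := by
      intro z hz t h1 h2
      have h : ∃ z ∈ c, z.1.1 < (t : EReal) ∧ (t : EReal) < z.1.2.1 := ⟨z, hz, h1, h2⟩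
      simp only [χ, dif_pos h]
      exact hcov _ h.choose_spec.1 _ hz t h.choose_spec.2.1 h.choose_spec.2.2 h1 h2
    have hle : ∀ z ∈ c, sInf ((fun z : S => z.1.1) '' c) ≤ z.1.1 := fun z hz =>
      sInf_le ⟨z, hz, rfl⟩
    have hge : ∀ z ∈ c, z.1.2.1 ≤ sSup ((fun z : S => z.1.2.1) '' c) := fun z hz =>
      le_sSup ⟨z, hz, rfl⟩
    refine ⟨⟨(sInf ((fun z : S => z.1.1) '' c), sSup ((fun z : S => z.1.2.1) '' c), χ), ?_⟩, ?_⟩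
    · refine ⟨(hle z₀ hz₀).trans_lt z₀.2.neg, z₀.2.pos.trans_le (hge z₀ hz₀), ?_, ?_⟩
      · change χ 0 = x
        rw [hχ z₀ hz₀ 0 (by simpa using z₀.2.neg) (by simpa using z₀.2.pos)]
        exact z₀.2.initial
      · intro t h1 h2
        obtain ⟨_, ⟨z, hz, rfl⟩, hz1⟩ := sInf_lt_iff.1 h1
        obtain ⟨_, ⟨w, hw, rfl⟩, hw1⟩ := lt_sSup_iff.1 h2
        have : ∃ u ∈ c, u.1.1 < (t : EReal) ∧ (t : EReal) < u.1.2.1 := by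
          rcases hc.total hz hw with h | h
          · exact ⟨w, hw, h.1.trans_lt hz1, hw1⟩
          · exact ⟨z, hz, hz1, hw1.trans_le h.2.1⟩
        obtain ⟨u, hu, hu1, hu2⟩ := this
        have hnhds : χ =ᶠ[𝓝 t] u.1.2.2 := by
          have e1 : ∀ᶠ s : ℝ in 𝓝 t, u.1.1 < (s : EReal) :=
            continuous_coe_real_ereal.continuousAt.eventually (lt_mem_nhds hu1)
          have e2 : ∀ᶠ s : ℝ in 𝓝 t, (s : EReal) < u.1.2.1 :=
            continuous_coe_real_ereal.continuousAt.eventually (gt_mem_nhds hu2)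
          filter_upwards [e1, e2] with s hs1 hs2 using hχ u hu s hs1 hs2
        have := (u.2.ode t hu1 hu2).congr_of_eventuallyEq hnhds
        rwa [← hχ u hu t hu1 hu2] at this
    · exact fun z hz => ⟨hle z hz, hge z hz, hχ z hz⟩
  obtain ⟨m, hm⟩ := exists_maximal_of_nonempty_chains_bounded hchain htrans
  refine ⟨m.1.1, m.1.2.1, m.1.2.2, m.2, fun a' b' χ h ha hb hχ => ?_⟩
  have := hm ⟨(a', b', χ), h⟩ ⟨ha, hb, hχ⟩
  exact ⟨le_antisymm ha this.1, le_antisymm this.2.1 hb⟩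

/-- The flow of the linear vector field `-A`. -/
noncomputable def linearFlow (A : H →L[ℝ] H) (x : H) (t : ℝ) : H := NormedSpace.exp (t • (-A)) x

theorem linearFlow_zero (A : H →L[ℝ] H) (x : H) : linearFlow A x 0 = x := by
  simp [linearFlow]

variable [CompleteSpace H]

theorem hasDerivAt_linearFlow (A : H →L[ℝ] H) (x : H) (t : ℝ) :
    HasDerivAt (linearFlow A x) (-A (linearFlow A x t)) t := by
  have h := hasDerivAt_exp_smul_const' (𝕂 := ℝ) (-A) t
  have := h.clm_apply (hasDerivAt_const t x)
  rw [map_zero, add_zero] at this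
  exact this

theorem continuous_linearFlow (A : H →L[ℝ] H) (x : H) : Continuous (linearFlow A x) :=
  continuous_iff_continuousAt.2 fun t => (hasDerivAt_linearFlow A x t).continuousAt

variable {Y : H → H} {A : H →L[ℝ] H} {𝓤 : Set H} {x : H}

/-- Local existence comes from the explicit exponential, so no regularity of the gradient part of
`Y` is needed. -/
theorem isSolution_linearFlow (h𝓤 : IsOpen 𝓤) (hY : ∀ z ∈ 𝓤, Y z = -A z) (hx : x ∈ 𝓤) :
    ∃ r : ℝ, 0 < r ∧ IsSolution Y x ((-r : ℝ) : EReal) (r : EReal) (linearFlow A x) := by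
  have h1 : linearFlow A x ⁻¹' 𝓤 ∈ 𝓝 (0 : ℝ) :=
    (continuous_linearFlow A x).continuousAt.preimage_mem_nhds
      (h𝓤.mem_nhds (by rwa [linearFlow_zero]))
  obtain ⟨r, hr, hball⟩ := Metric.mem_nhds_iff.1 h1
  refine ⟨r, hr, by exact_mod_cast neg_lt_zero.2 hr, by exact_mod_cast hr,
    linearFlow_zero A x, fun t h1 h2 => ?_⟩
  rw [hY _ (hball _)]
  · exact hasDerivAt_linearFlow A x t
  · rw [Metric.mem_ball, dist_zero_right, Real.norm_eq_abs, abs_lt]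
    exact ⟨by exact_mod_cast h1, by exact_mod_cast h2⟩

/-- The set of agreement is closed, contains `0`, and is open to the right: at a time of agreement
`ψ` lies in `𝓤`, so both curves solve the same Lipschitz equation nearby. Only the linear flow is
assumed to stay in `𝓤`. -/
theorem IsSolution.eqOn_linearFlow {a b : EReal} {ψ : ℝ → H} (hψ : IsSolution Y x a b ψ)
    (h𝓤 : IsOpen 𝓤) (hY : ∀ z ∈ 𝓤, Y z = -A z) {T : ℝ} (hTb : (T : EReal) < b)
    (hT : ∀ s ∈ Icc 0 T, linearFlow A x s ∈ 𝓤) : EqOn ψ (linearFlow A x) (Icc 0 T) := by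
  have hmem : ∀ s ∈ Icc 0 T, a < (s : EReal) ∧ (s : EReal) < b := fun s hs =>
    ⟨hψ.neg.trans_le (by exact_mod_cast hs.1),
      lt_of_le_of_lt (by exact_mod_cast hs.2) hTb⟩
  have hcont : ContinuousOn ψ (Icc 0 T) := fun s hs =>
    (hψ.ode s (hmem s hs).1 (hmem s hs).2).continuousAt.continuousWithinAt
  rcases lt_or_ge T 0 with hT0 | hT0
  · simp [Icc_eq_empty hT0.not_ge]
  have hsub : Icc 0 T ⊆ {s | ψ s = linearFlow A x s} := by
    refine IsClosed.Icc_subset_of_forall_mem_nhdsWithin ?_ ?_ ?_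
    · have := hcont.prodMk (continuous_linearFlow A x).continuousOn
      have := this.preimage_isClosed_of_isClosed isClosed_Icc isClosed_diagonal
      convert this using 1
      ext s
      simp [and_comm]
    · simp [hψ.initial, linearFlow_zero]
    · rintro s ⟨hs : ψ s = linearFlow A x s, hs1⟩
      have hs2 := hmem s (Ico_subset_Icc_self hs1)
      have hsU := hT s (Ico_subset_Icc_self hs1)
      have e1 : ∀ᶠ u : ℝ in 𝓝 s, a < (u : EReal) :=
        continuous_coe_real_ereal.continuousAt.eventually (lt_mem_nhds hs2.1)
      have e2 : ∀ᶠ u : ℝ in 𝓝 s, (u : EReal) < b :=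
        continuous_coe_real_ereal.continuousAt.eventually (gt_mem_nhds hs2.2)
      have e3 : ∀ᶠ u : ℝ in 𝓝 s, ψ u ∈ 𝓤 :=
        (hψ.ode s hs2.1 hs2.2).continuousAt.preimage_mem_nhds (h𝓤.mem_nhds (by rwa [hs]))
      have e4 : ∀ᶠ u : ℝ in 𝓝 s, HasDerivAt ψ (-A (ψ u)) u ∧ ψ u ∈ univ := by
        filter_upwards [e1, e2, e3] with u h1 h2 h3
        have h := hψ.ode u h1 h2
        rw [hY _ h3] at h
        exact ⟨h, mem_univ _⟩
      have h := ODE_solution_unique_of_eventually (v := fun _ z => -A z) (s := fun _ => univ)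
        (K := ‖-A‖₊) (Eventually.of_forall fun _ => ((-A).lipschitz).lipschitzOnWith) e4
        (Eventually.of_forall fun u => ⟨hasDerivAt_linearFlow A x u, mem_univ _⟩) hs
      exact mem_nhdsWithin_of_mem_nhds h
  exact fun s hs => hsub hs

/-- As long as the linear flow stays in a closed set inside the region where the field is linear,
a maximal solution is defined and coincides with it. -/
theorem IsMaximalSolution.eqOn_linearFlow {a b : EReal} {ψ : ℝ → H}
    (hψ : IsMaximalSolution Y x a b ψ)
    (h𝓤 : IsOpen 𝓤) (hY : ∀ z ∈ 𝓤, Y z = -A z) {T : ℝ}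
    (hT : ∀ s ∈ Icc 0 T, linearFlow A x s ∈ 𝓤) :
    (T : EReal) < b ∧ EqOn ψ (linearFlow A x) (Icc 0 T) := by
  classical
  suffices hb : (T : EReal) < b from ⟨hb, hψ.toIsSolution.eqOn_linearFlow h𝓤 hY hb hT⟩
  by_contra! hbT
  obtain ⟨β, rfl⟩ : ∃ β : ℝ, (β : EReal) = b := by
    have hne : b ≠ ⊤ := ne_top_of_le_ne_top (EReal.coe_ne_top T) hbT
    have hne' : b ≠ ⊥ := (bot_lt_of_lt hψ.pos).ne'
    exact ⟨b.toReal, EReal.coe_toReal hne hne'⟩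
  have hβ0 : 0 < β := by exact_mod_cast hψ.pos
  have hβT : β ≤ T := by exact_mod_cast hbT
  have heq : ∀ t ∈ Ico 0 β, ψ t = linearFlow A x t := fun t ht =>
    hψ.toIsSolution.eqOn_linearFlow h𝓤 hY (by exact_mod_cast ht.2)
      (fun s hs => hT s ⟨hs.1, hs.2.trans (ht.2.le.trans hβT)⟩) ⟨ht.1, le_rfl⟩
  have h1 : linearFlow A x ⁻¹' 𝓤 ∈ 𝓝 β :=
    (continuous_linearFlow A x).continuousAt.preimage_mem_nhds
      (h𝓤.mem_nhds (hT β ⟨hβ0.le, hβT⟩))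
  obtain ⟨r, hr, hball⟩ := Metric.mem_nhds_iff.1 h1
  -- If the interval ended at `β ≤ T`, following the linear flow beyond `β`, where it is still in
  -- `𝓤`, would prolong `ψ` to `β + r`.
  let χ : ℝ → H := fun t => if t < β then ψ t else linearFlow A x t
  have hχ1 : ∀ t, t < β → χ t = ψ t := fun t ht => if_pos ht
  have hχ2 : ∀ t, 0 ≤ t → χ t = linearFlow A x t := fun t ht => by
    by_cases h : t < β
    · rw [hχ1 t h, heq t ⟨ht, h⟩]
    · exact if_neg h
  have hsol : IsSolution Y x a ((β + r : ℝ) : EReal) χ := by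
    refine ⟨hψ.neg, by exact_mod_cast add_pos hβ0 hr, by rw [hχ1 0 hβ0, hψ.initial],
      fun t ht1 ht2 => ?_⟩
    by_cases h : t < β
    · rw [hχ1 t h]
      refine (hψ.ode t ht1 (by exact_mod_cast h)).congr_of_eventuallyEq ?_
      filter_upwards [gt_mem_nhds h] with s hs using hχ1 s hs
    · have ht0 : 0 < t := hβ0.trans_le (not_lt.1 h)
      have htr : t < β + r := by exact_mod_cast ht2
      rw [hχ2 t ht0.le, hY _ (hball _)]
      · refine (hasDerivAt_linearFlow A x t).congr_of_eventuallyEq ?_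
        filter_upwards [lt_mem_nhds ht0] with s hs using hχ2 s hs.le
      · rw [Metric.mem_ball, Real.dist_eq, abs_lt]
        constructor <;> linarith [not_lt.1 h]
  have := (hψ.maximal a _ χ hsol le_rfl (by exact_mod_cast (by linarith : β ≤ β + r))
    (fun t _ ht => hχ1 t (by exact_mod_cast ht))).2
  have : β + r = β := by exact_mod_cast this
  linarith

end Flow
/-! ### The negative eigenspaces of a form that satisfies a Gårding inequality -/

section Spectral

variable {H : Type*} [NormedAddCommGroup H] [NormedSpace ℝ H]

/-- `e` is a `b`-orthonormal family of eigenvectors of `B` with eigenvalues `-lam i < 0`. -/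
structure IsNegativeEigenfamily (b B : H →L[ℝ] H →L[ℝ] ℝ) {m : ℕ} (e : Fin m → H)
    (lam : Fin m → ℝ) : Prop where
  pos : ∀ i, 0 < lam i
  orthonormal : ∀ i j, b (e i) (e j) = if i = j then 1 else 0
  eigen : ∀ i y, B (e i) y = -lam i * b (e i) y

namespace IsNegativeEigenfamily

variable {b B : H →L[ℝ] H →L[ℝ] ℝ} {m : ℕ} {e : Fin m → H} {lam : Fin m → ℝ}

theorem inner_sum (h : IsNegativeEigenfamily b B e lam) (c : Fin m → ℝ) (i : Fin m) :
    b (e i) (∑ j, c j • e j) = c i := by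
  simp [map_sum, h.orthonormal]

theorem form_sum (h : IsNegativeEigenfamily b B e lam) (c : Fin m → ℝ) (y : H) :
    B (∑ j, c j • e j) y = -∑ j, lam j * c j * b (e j) y := by
  simp only [map_sum, map_smul, _root_.sum_apply, _root_.smul_apply,
    h.eigen, smul_eq_mul, ← Finset.sum_neg_distrib]
  exact Finset.sum_congr rfl fun i _ => by ring

theorem form_sum_sum (h : IsNegativeEigenfamily b B e lam) (c : Fin m → ℝ) :
    B (∑ j, c j • e j) (∑ j, c j • e j) = -∑ j, lam j * c j ^ 2 := by
  rw [h.form_sum]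
  simp only [h.inner_sum]
  simp only [pow_two, mul_assoc]

theorem scalar_sum_sum (h : IsNegativeEigenfamily b B e lam) (c : Fin m → ℝ) :
    b (∑ j, c j • e j) (∑ j, c j • e j) = ∑ j, c j ^ 2 := by
  simp only [map_sum, map_smul, _root_.sum_apply, _root_.smul_apply,
    smul_eq_mul, h.orthonormal]
  simp [pow_two]

/-- A form that is coercive on the kernel of an operator of finite rank has few negative
eigenvalues. -/
theorem card_le {G : Type*} [NormedAddCommGroup G] [NormedSpace ℝ G] [FiniteDimensional ℝ G]
    (h : IsNegativeEigenfamily b B e lam) (L : H →L[ℝ] G) {c : ℝ} (hc : 0 < c)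
    (hL : ∀ x, c * ‖x‖ ^ 2 - ‖L x‖ ^ 2 ≤ B x x) : m ≤ Module.finrank ℝ G := by
  -- `L` is injective on the span of the family: there `B` is a negative combination of squares,
  -- whereas `B ≥ c‖·‖²` on the kernel of `L`.
  let f : (Fin m → ℝ) →ₗ[ℝ] G := L.toLinearMap ∘ₗ Fintype.linearCombination ℝ e
  have hf : Function.Injective f := by
    rw [injective_iff_map_eq_zero]
    intro a ha
    have ha' : L (∑ j, a j • e j) = 0 := by simpa [f, Fintype.linearCombination_apply] using ha
    have h1 := hL (∑ j, a j • e j)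
    rw [ha', norm_zero, h.form_sum_sum] at h1
    have h2 : 0 ≤ c * ‖∑ j, a j • e j‖ ^ 2 := by positivity
    have h3 : ∀ j ∈ Finset.univ, 0 ≤ lam j * a j ^ 2 := fun j _ =>
      mul_nonneg (h.pos j).le (sq_nonneg _)
    have h4 : ∑ j, lam j * a j ^ 2 = 0 := by
      have := Finset.sum_nonneg h3
      linarith
    funext j
    have := (Finset.sum_eq_zero_iff_of_nonneg h3).1 h4 j (Finset.mem_univ j)
    simpa [(h.pos j).ne'] using this
  simpa using LinearMap.finrank_le_finrank_of_injective hf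

end IsNegativeEigenfamily

/-- Direct minimization of the Rayleigh quotient on the orthogonal of an eigenfamily. -/
theorem exists_negative_eigenvector [CompleteSpace H]
    {b B : H →L[ℝ] H →L[ℝ] ℝ} (hb_symm : ∀ x y, b x y = b y x)
    (hb : IsCoercive b) (hB_symm : ∀ x y, B x y = B y x)
    {G : Type*} [NormedAddCommGroup G] [NormedSpace ℝ G] [FiniteDimensional ℝ G]
    (L : H →L[ℝ] G) {c : ℝ} (hc : 0 < c) (hL : ∀ x, c * ‖x‖ ^ 2 - ‖L x‖ ^ 2 ≤ B x x)
    {m : ℕ} {e : Fin m → H} {lam : Fin m → ℝ} (he : IsNegativeEigenfamily b B e lam)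
    (hneg : ∃ x, (∀ i, b (e i) x = 0) ∧ B x x < 0) :
    ∃ (v : H) (μ : ℝ), 0 < μ ∧ b v v = 1 ∧ (∀ i, b (e i) v = 0) ∧ ∀ y, B v y = -μ * b v y := by
  obtain ⟨κ, hκ, hbκ⟩ := hb
  have hpos : ∀ x, x ≠ 0 → 0 < b x x := fun x hx =>
    lt_of_lt_of_le (by have := norm_pos_iff.2 hx; positivity) (hbκ x)
  have hnonneg : ∀ x, 0 ≤ b x x := fun x => le_trans (by positivity) (hbκ x)
  -- The values of the Rayleigh quotient `B/b` on the orthogonal of the family. The new eigenvalue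
  -- is its infimum `-μ`.
  let S : Set ℝ := {r | ∃ x, (∀ i, b (e i) x = 0) ∧ b x x = 1 ∧ B x x = r}
  have hnorm : ∀ x, b x x = 1 → ‖x‖ ^ 2 ≤ κ⁻¹ := by
    intro x hx
    have := hbκ x
    rw [hx] at this
    rw [← one_div, le_div_iff₀ hκ]
    nlinarith
  have hscale : ∀ x, (∀ i, b (e i) x = 0) → x ≠ 0 → B x x / b x x ∈ S := by
    intro x hx hx0
    have hp := hpos x hx0
    refine ⟨(Real.sqrt (b x x))⁻¹ • x, fun i => by simp [hx i], ?_, ?_⟩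
    · simp only [map_smul, _root_.smul_apply, smul_eq_mul]
      rw [← mul_assoc, ← mul_inv, Real.mul_self_sqrt hp.le, inv_mul_cancel₀ hp.ne']
    · simp only [map_smul, _root_.smul_apply, smul_eq_mul]
      rw [← mul_assoc, ← mul_inv, Real.mul_self_sqrt hp.le]
      field_simp
  have hSbdd : BddBelow S := by
    refine ⟨-(‖L‖ ^ 2 * κ⁻¹), ?_⟩
    rintro r ⟨x, -, hx1, rfl⟩
    have h1 := hL x
    have h2 : ‖L x‖ ^ 2 ≤ ‖L‖ ^ 2 * ‖x‖ ^ 2 := by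
      rw [← mul_pow]
      gcongr
      exact L.le_opNorm x
    have h3 : ‖L‖ ^ 2 * ‖x‖ ^ 2 ≤ ‖L‖ ^ 2 * κ⁻¹ := by gcongr; exact hnorm x hx1
    have h4 : 0 ≤ c * ‖x‖ ^ 2 := by positivity
    linarith
  obtain ⟨x₀, hx₀, hx₀neg⟩ := hneg
  have hx₀0 : x₀ ≠ 0 := by
    rintro rfl
    simp at hx₀neg
  have hSne : S.Nonempty := ⟨_, hscale x₀ hx₀ hx₀0⟩
  set μ := -sInf S with hμ
  have hμpos : 0 < μ := by
    have h1 := csInf_le hSbdd (hscale x₀ hx₀ hx₀0)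
    have h2 : B x₀ x₀ / b x₀ x₀ < 0 := div_neg_of_neg_of_pos hx₀neg (hpos x₀ hx₀0)
    linarith
  -- By the choice of `μ`, `Q` is nonnegative on the orthogonal of the family and tends to `0` along
  -- a minimizing sequence.
  let Q : H →L[ℝ] H →L[ℝ] ℝ := B + μ • b
  have hQ : ∀ x y, Q x y = B x y + μ * b x y := fun x y => rfl
  have hQsymm : ∀ x y, Q x y = Q y x := fun x y => by rw [hQ, hQ, hB_symm, hb_symm]
  have hQnonneg : ∀ x, (∀ i, b (e i) x = 0) → 0 ≤ Q x x := by
    intro x hx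
    rcases eq_or_ne x 0 with rfl | hx0
    · simp
    have h1 := csInf_le hSbdd (hscale x hx hx0)
    rw [le_div_iff₀ (hpos x hx0)] at h1
    rw [hQ]
    linarith
  obtain ⟨u, -, hu, huS⟩ := exists_seq_tendsto_sInf hSne hSbdd
  choose x hxe hx1 hxB using huS
  have hQx : Tendsto (fun k => Q (x k) (x k)) atTop (𝓝 0) := by
    have : (fun k => Q (x k) (x k)) = fun k => u k + μ := by
      funext k
      rw [hQ, hxB, hx1, mul_one]
    rw [this]
    simpa [hμ] using hu.add_const μ
  have hLbdd : ∀ k, L (x k) ∈ Metric.closedBall (0 : G) (‖L‖ * Real.sqrt κ⁻¹) := by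
    intro k
    rw [mem_closedBall_zero_iff]
    refine (L.le_opNorm _).trans ?_
    gcongr
    exact Real.le_sqrt_of_sq_le (hnorm _ (hx1 k))
  -- Compactness is available only for the images under `L`. With the parallelogram identity for `Q`
  -- it gives strong convergence: `c‖x - y‖² ≤ B(x - y, x - y) + ‖L(x - y)‖²`, where `B ≤ Q ≤
  -- 2Q(x,x) + 2Q(y,y)` is small.
  obtain ⟨g, -, φ, hφ, hg⟩ := (isCompact_closedBall (0 : G) _).tendsto_subseq hLbdd
  have hcauchy : CauchySeq (x ∘ φ) := by
    rw [Metric.cauchySeq_iff]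
    intro ε hε
    have hδ : 0 < c * ε ^ 2 / 6 := by positivity
    have hg' := hg.cauchySeq
    rw [Metric.cauchySeq_iff] at hg'
    obtain ⟨N₁, hN₁⟩ := hg' (Real.sqrt (c * ε ^ 2 / 6)) (Real.sqrt_pos.2 hδ)
    obtain ⟨N₂, hN₂⟩ := eventually_atTop.1
      ((hQx.comp hφ.tendsto_atTop).eventually (gt_mem_nhds hδ))
    refine ⟨max N₁ N₂, fun k hk l hl => ?_⟩
    have h1 := hN₁ k (le_of_max_le_left hk) l (le_of_max_le_left hl)
    have h2 : Q (x (φ k)) (x (φ k)) < c * ε ^ 2 / 6 := hN₂ k (le_of_max_le_right hk)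
    have h3 : Q (x (φ l)) (x (φ l)) < c * ε ^ 2 / 6 := hN₂ l (le_of_max_le_right hl)
    have h4 := hQnonneg (x (φ k) + x (φ l)) fun i => by simp [hxe]
    have h5 : Q (x (φ k) - x (φ l)) (x (φ k) - x (φ l)) + Q (x (φ k) + x (φ l))
        (x (φ k) + x (φ l)) = 2 * Q (x (φ k)) (x (φ k)) + 2 * Q (x (φ l)) (x (φ l)) := by
      simp only [map_add, map_sub, _root_.add_apply, _root_.sub_apply]
      ring
    have h6 := hL (x (φ k) - x (φ l))
    have h7 : ‖L (x (φ k) - x (φ l))‖ ^ 2 < c * ε ^ 2 / 6 := by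
      rw [map_sub, ← dist_eq_norm]
      exact (Real.lt_sqrt dist_nonneg).1 h1
    have h8 := hnonneg (x (φ k) - x (φ l))
    have h9 := hQ (x (φ k) - x (φ l)) (x (φ k) - x (φ l))
    have h10 : 0 ≤ μ * b (x (φ k) - x (φ l)) (x (φ k) - x (φ l)) := by positivity
    have h11 : c * ‖x (φ k) - x (φ l)‖ ^ 2 < c * ε ^ 2 := by linarith
    rw [Function.comp_apply, Function.comp_apply, dist_eq_norm]
    exact lt_of_pow_lt_pow_left₀ 2 hε.le (lt_of_mul_lt_mul_left h11 hc.le)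
  obtain ⟨v, hv⟩ := cauchySeq_tendsto_of_complete hcauchy
  have hve : ∀ i, b (e i) v = 0 := fun i => by
    have h1 := ((b (e i)).continuous.tendsto v).comp hv
    refine tendsto_nhds_unique h1 ?_
    simp [Function.comp_def, hxe]
  have hdiag : ∀ D : H →L[ℝ] H →L[ℝ] ℝ, Tendsto (fun k => D (x (φ k)) (x (φ k))) atTop
      (𝓝 (D v v)) := fun D => by
    have hc : Continuous fun z => D z z := D.continuous.clm_apply continuous_id
    exact (hc.tendsto v).comp hv
  have hv1 : b v v = 1 := by
    refine tendsto_nhds_unique (hdiag b) ?_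
    simp [hx1]
  have hQv : Q v v = 0 := tendsto_nhds_unique (hdiag Q) (hQx.comp hφ.tendsto_atTop)
  have hQW : ∀ y, (∀ i, b (e i) y = 0) → Q v y = 0 := by
    intro y hy
    by_contra hne
    have hexp : ∀ s : ℝ, 0 ≤ 2 * s * Q v y + s ^ 2 * Q y y := by
      intro s
      have h1 := hQnonneg (v + s • y) fun i => by simp [hve i, hy i]
      have h2 : Q (v + s • y) (v + s • y) = Q v v + 2 * s * Q v y + s ^ 2 * Q y y := by
        simp only [map_add, map_smul, _root_.add_apply,
          _root_.smul_apply, smul_eq_mul, hQsymm y v]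
        ring
      rw [h2, hQv] at h1
      linarith
    have hyy := hQnonneg y hy
    -- This `s` is nearly the minimizer of the quadratic polynomial; the summand `1` covers the case
    -- `Q y y = 0`.
    have h1 := hexp (-(Q v y) / (Q y y + 1))
    have h2 : 2 * (-(Q v y) / (Q y y + 1)) * Q v y + (-(Q v y) / (Q y y + 1)) ^ 2 * Q y y
        = -(Q v y ^ 2 * (Q y y + 2) / (Q y y + 1) ^ 2) := by
      field_simp
      ring
    rw [h2] at h1
    have : 0 < Q v y ^ 2 * (Q y y + 2) / (Q y y + 1) ^ 2 := by positivity
    linarith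
  refine ⟨v, μ, hμpos, hv1, hve, fun y => ?_⟩
  -- So far `Q v` vanishes on the orthogonal of the family; it also vanishes on the family, because
  -- its members are eigenvectors orthogonal to `v`.
  have hQe : ∀ i, Q v (e i) = 0 := fun i => by
    rw [hQ, hB_symm, he.eigen, hb_symm v, hve i]
    simp
  have hy' := hQW (y - ∑ j, b (e j) y • e j) fun i => by
    rw [map_sub, he.inner_sum, sub_self]
  rw [map_sub, map_sum] at hy'
  simp only [map_smul, hQe, smul_zero, Finset.sum_const_zero, sub_zero] at hy'
  rw [hQ] at hy'
  linarith

/-- A form that is coercive on the kernel of an operator of finite rank is nonnegative on the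
orthogonal of a finite family of eigenvectors with negative eigenvalues. -/
theorem exists_isNegativeEigenfamily [CompleteSpace H]
    {b B : H →L[ℝ] H →L[ℝ] ℝ} (hb_symm : ∀ x y, b x y = b y x)
    (hb : IsCoercive b) (hB_symm : ∀ x y, B x y = B y x)
    {G : Type*} [NormedAddCommGroup G] [NormedSpace ℝ G] [FiniteDimensional ℝ G]
    (L : H →L[ℝ] G) {c : ℝ} (hc : 0 < c) (hL : ∀ x, c * ‖x‖ ^ 2 - ‖L x‖ ^ 2 ≤ B x x) :
    ∃ (m : ℕ) (e : Fin m → H) (lam : Fin m → ℝ), IsNegativeEigenfamily b B e lam ∧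
      ∀ x, (∀ i, b (e i) x = 0) → 0 ≤ B x x := by
  -- Otherwise every eigenfamily could be enlarged, until its size exceeds the bound `dim G` of
  -- `card_le`.
  by_contra! hcon
  have key : ∀ m : ℕ, ∃ (e : Fin m → H) (lam : Fin m → ℝ), IsNegativeEigenfamily b B e lam := by
    intro m
    induction m with
    | zero => exact ⟨Fin.elim0, Fin.elim0, fun i => i.elim0, fun i => i.elim0, fun i => i.elim0⟩
    | succ k ih =>
      obtain ⟨e, lam, he⟩ := ih
      obtain ⟨v, μ, hμ, hv1, hve, hvB⟩ :=
        exists_negative_eigenvector hb_symm hb hB_symm L hc hL he (hcon k e lam he)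
      refine ⟨Fin.cons v e, Fin.cons μ lam, ?_, ?_, ?_⟩
      · refine Fin.cases ?_ ?_
        · simpa using hμ
        · simpa using he.pos
      · refine Fin.cases (Fin.cases ?_ ?_) (fun i => Fin.cases ?_ ?_)
        · simpa using hv1
        · intro j
          simp [hb_symm v, hve j, (Fin.succ_ne_zero j).symm]
        · simp [hve i]
        · intro j
          simp [he.orthonormal]
      · refine Fin.cases ?_ ?_
        · simpa using hvB
        · intro i y
          simpa using he.eigen i y
  obtain ⟨e, lam, he⟩ := key (Module.finrank ℝ G + 1)
  have := he.card_le L hc hL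
  omega

end Spectral
/-! ### The flow near a critical point with a Gårding inequality for the second variation -/

section CriticalPoint

/-! ### Second order expansion of a `C^{1,1}` functional at a critical point -/

section Expansion

variable {H : Type*} [NormedAddCommGroup H] [NormedSpace ℝ H]
  {𝒜 : H → ℝ} {D : H → H →L[ℝ] ℝ} {ρ C : ℝ}

/-- Mean value inequality: since `D 0 = 0`, the differential has norm at most `C * R` on the ball of
radius `R`. It allows passing from a point to a nearby one, with an error of second order in the
size of both. -/
theorem abs_sub_le_of_lipschitz_fderiv
    (hD : ∀ x ∈ Metric.ball (0 : H) ρ, HasFDerivAt 𝒜 (D x) x)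
    (hLip : ∀ x ∈ Metric.ball (0 : H) ρ, ∀ y ∈ Metric.ball (0 : H) ρ, ‖D x - D y‖ ≤ C * ‖x - y‖)
    (hD0 : D 0 = 0) (hC : 0 ≤ C) {R : ℝ} (hR : R < ρ) {x y : H} (hx : ‖x‖ ≤ R) (hy : ‖y‖ ≤ R) :
    |𝒜 x - 𝒜 y| ≤ C * R * ‖x - y‖ := by
  have hsub : ∀ z ∈ Metric.closedBall (0 : H) R, z ∈ Metric.ball (0 : H) ρ := fun z hz =>
    Metric.closedBall_subset_ball hR hz
  have hR0 : 0 ≤ R := (norm_nonneg x).trans hx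
  have h := (convex_closedBall (0 : H) R).norm_image_sub_le_of_norm_hasFDerivWithin_le
    (f := 𝒜) (f' := D) (C := C * R) (x := y) (y := x)
    (fun z hz => (hD z (hsub z hz)).hasFDerivWithinAt) (fun z hz => ?_)
    (mem_closedBall_zero_iff.2 hy) (mem_closedBall_zero_iff.2 hx)
  · simpa using h
  · have h1 := hLip z (hsub z hz) 0 (by simpa using hR0.trans_lt hR)
    rw [hD0, sub_zero, sub_zero] at h1
    exact h1.trans (mul_le_mul_of_nonneg_left (mem_closedBall_zero_iff.1 hz) hC)

/-- On the line through `ξ` the derivative is `s B(ξ,ξ) + o(s)`; the mean value inequality on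
`[-|s|, |s|]` integrates the remainder. The estimate is not uniform in `ξ`. -/
theorem eventually_abs_sub_le_sq {B : H →L[ℝ] H →L[ℝ] ℝ} (hρ : 0 < ρ)
    (hD : ∀ x ∈ Metric.ball (0 : H) ρ, HasFDerivAt 𝒜 (D x) x) (hD0 : D 0 = 0)
    (hDB : ∀ ξ η, HasDerivAt (fun s : ℝ => D (s • ξ) η) (B ξ η) 0) (ξ : H) {ε : ℝ} (hε : 0 < ε) :
    ∀ᶠ s : ℝ in 𝓝 0, |𝒜 (s • ξ) - 𝒜 0 - s ^ 2 / 2 * B ξ ξ| ≤ ε * s ^ 2 := by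
  have h1 := (hasDerivAt_iff_isLittleO.1 (hDB ξ ξ)).bound hε
  simp only [zero_smul, hD0, _root_.zero_apply, sub_zero, smul_eq_mul, Real.norm_eq_abs] at h1
  have h2 : ∀ᶠ s : ℝ in 𝓝 0, s • ξ ∈ Metric.ball (0 : H) ρ := by
    have : Tendsto (fun s : ℝ => s • ξ) (𝓝 0) (𝓝 ((0 : ℝ) • ξ)) :=
      (continuous_id.smul continuous_const).tendsto 0
    rw [zero_smul] at this
    exact this.eventually (Metric.ball_mem_nhds 0 hρ)
  obtain ⟨r, hr, hball⟩ := Metric.eventually_nhds_iff_ball.1 (h1.and h2)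
  refine Metric.eventually_nhds_iff_ball.2 ⟨r, hr, fun s hs => ?_⟩
  have hs' : |s| < r := by simpa using hs
  let f : ℝ → ℝ := fun u => 𝒜 (u • ξ) - u ^ 2 / 2 * B ξ ξ
  have hmem : ∀ u ∈ Icc (-|s|) |s|, u ∈ Metric.ball (0 : ℝ) r := fun u hu => by
    simpa using (abs_le.2 hu).trans_lt hs'
  have hf : ∀ u ∈ Icc (-|s|) |s|,
      HasDerivWithinAt f (D (u • ξ) ξ - u * B ξ ξ) (Icc (-|s|) |s|) u := by
    intro u hu
    have h3 := (hD _ (hball u (hmem u hu)).2).comp_hasDerivAt u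
      ((hasDerivAt_id u).smul_const ξ)
    have h4 := ((hasDerivAt_pow 2 u).div_const 2).mul_const (B ξ ξ)
    have h5 := h3.sub h4
    refine HasDerivAt.hasDerivWithinAt (HasDerivAt.congr_deriv h5 ?_)
    simp
  have h6 := (convex_Icc (-|s|) |s|).norm_image_sub_le_of_norm_hasDerivWithin_le
    (f := f) (C := ε * |s|) (x := 0) (y := s) hf (fun u hu => ?_)
    ⟨by simp, by simp⟩ ⟨neg_abs_le s, le_abs_self s⟩
  · simp only [f, zero_smul, sub_zero, Real.norm_eq_abs] at h6
    have h7 : ε * s ^ 2 = ε * |s| * |s| := by rw [mul_assoc, abs_mul_abs_self, pow_two]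
    rw [h7]
    convert h6 using 2
    ring
  · rw [Real.norm_eq_abs]
    exact (hball u (hmem u hu)).1.trans (mul_le_mul_of_nonneg_left (abs_le.2 hu) hε.le)

/-- On a compact set of directions where the second variation is negative, the functional decreases
quadratically. -/
theorem eventually_forall_le_sub_sq {B : H →L[ℝ] H →L[ℝ] ℝ} (hρ : 0 < ρ) (hC : 0 ≤ C)
    (hD : ∀ x ∈ Metric.ball (0 : H) ρ, HasFDerivAt 𝒜 (D x) x)
    (hLip : ∀ x ∈ Metric.ball (0 : H) ρ, ∀ y ∈ Metric.ball (0 : H) ρ, ‖D x - D y‖ ≤ C * ‖x - y‖)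
    (hD0 : D 0 = 0) (hDB : ∀ ξ η, HasDerivAt (fun s : ℝ => D (s • ξ) η) (B ξ η) 0)
    {K : Set H} (hK : IsCompact K) {μ : ℝ} (hμ : 0 < μ) (hKB : ∀ ξ ∈ K, B ξ ξ ≤ -μ) :
    ∀ᶠ s : ℝ in 𝓝 0, ∀ ξ ∈ K, 𝒜 (s • ξ) ≤ 𝒜 0 - μ / 4 * s ^ 2 := by
  refine hK.eventually_forall_of_forall_eventually fun ξ₀ hξ₀ => ?_
  have hN : 0 < ‖ξ₀‖ + 1 := by positivity
  -- The quadratic term gains `μ/2 * s ^ 2`. The expansion at `ξ₀` and the passage from `ξ₀` to a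
  -- nearby `ξ` cost `μ/8 * s ^ 2` each, which leaves `μ/4`. Compactness of `K` makes this uniform.
  have e1 : ∀ᶠ s : ℝ in 𝓝 0, |𝒜 (s • ξ₀) - 𝒜 0 - s ^ 2 / 2 * B ξ₀ ξ₀| ≤ μ / 8 * s ^ 2 :=
    eventually_abs_sub_le_sq hρ hD hD0 hDB ξ₀ (by positivity)
  have e2 : ∀ᶠ s : ℝ in 𝓝 0, |s| * (‖ξ₀‖ + 1) < ρ := by
    have hc : Continuous fun s : ℝ => |s| * (‖ξ₀‖ + 1) := by fun_prop
    exact hc.continuousAt.eventually (gt_mem_nhds (by simpa using hρ))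
  have e3 : ∀ᶠ ξ : H in 𝓝 ξ₀, C * (‖ξ₀‖ + 1) * ‖ξ - ξ₀‖ < μ / 8 := by
    have hc : Continuous fun ξ : H => C * (‖ξ₀‖ + 1) * ‖ξ - ξ₀‖ := by fun_prop
    exact hc.continuousAt.eventually (gt_mem_nhds (by simpa using hμ))
  have e4 : ∀ᶠ ξ : H in 𝓝 ξ₀, ‖ξ‖ < ‖ξ₀‖ + 1 :=
    continuous_norm.continuousAt.eventually (gt_mem_nhds (by simp))
  rw [nhds_prod_eq]
  filter_upwards [(e1.and e2).prod_mk (e3.and e4)] with ⟨s, ξ⟩ ⟨⟨h1, h2⟩, h3, h4⟩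
  have h5 := abs_sub_le_of_lipschitz_fderiv hD hLip hD0 hC h2 (x := s • ξ) (y := s • ξ₀)
    (by rw [norm_smul, Real.norm_eq_abs]; gcongr)
    (by rw [norm_smul, Real.norm_eq_abs]; gcongr; simp)
  rw [← smul_sub, norm_smul, Real.norm_eq_abs] at h5
  have h6 : C * (|s| * (‖ξ₀‖ + 1)) * (|s| * ‖ξ - ξ₀‖)
      = (C * (‖ξ₀‖ + 1) * ‖ξ - ξ₀‖) * s ^ 2 := by
    rw [← sq_abs s]
    ring
  rw [h6] at h5
  have h7 : (C * (‖ξ₀‖ + 1) * ‖ξ - ξ₀‖) * s ^ 2 ≤ μ / 8 * s ^ 2 := by gcongr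
  have h8 := mul_le_mul_of_nonneg_left (hKB ξ₀ hξ₀) (by positivity : 0 ≤ s ^ 2 / 2)
  have h9 := (abs_le.1 h1).2
  have h10 := (abs_le.1 h5).2
  simp only
  linarith

end Expansion


/-! ### The linear flow and the projection to the negative eigenspaces -/

variable {H : Type*} [NormedAddCommGroup H] [NormedSpace ℝ H]

/-- Makes the vector chosen in `rieszRep` unique. -/
theorem IsCoercive.eq_of_forall_eq {b : H →L[ℝ] H →L[ℝ] ℝ} (hb : IsCoercive b) {z z' : H}
    (h : ∀ y, b z y = b z' y) : z = z' := by
  obtain ⟨κ, hκ, hbκ⟩ := hb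
  have h1 := hbκ (z - z')
  have h0 : b (z - z') (z - z') = 0 := by
    rw [map_sub b, _root_.sub_apply, h, sub_self]
  rw [h0] at h1
  have h2 : ‖z - z'‖ * ‖z - z'‖ ≤ 0 := by
    by_contra! h3
    nlinarith
  have h3 : ‖z - z'‖ = 0 := by nlinarith [norm_nonneg (z - z')]
  exact sub_eq_zero.1 (norm_eq_zero.1 h3)

variable {b B : H →L[ℝ] H →L[ℝ] ℝ} {A : H →L[ℝ] H} {m : ℕ} {e : Fin m → H} {lam : Fin m → ℝ}

/-- The projection to the span of an eigenfamily. -/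
noncomputable def eigenProj (b : H →L[ℝ] H →L[ℝ] ℝ) (e : Fin m → H) : H →L[ℝ] H :=
  ∑ i, (b (e i)).smulRight (e i)

theorem eigenProj_apply (x : H) : eigenProj b e x = ∑ i, b (e i) x • e i := by
  simp [eigenProj]

theorem IsNegativeEigenfamily.scalar_proj_add (he : IsNegativeEigenfamily b B e lam)
    (hb_symm : ∀ x y, b x y = b y x) (x : H) :
    b x x = b (eigenProj b e x) (eigenProj b e x)
      + b (x - eigenProj b e x) (x - eigenProj b e x) := by
  have h1 : ∀ i, b (e i) (x - eigenProj b e x) = 0 := fun i => by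
    rw [map_sub, eigenProj_apply, he.inner_sum, sub_self]
  have h2 : b (eigenProj b e x) (x - eigenProj b e x) = 0 := by
    conv_lhs => rw [eigenProj_apply (b := b) (e := e) x, map_sum, _root_.sum_apply]
    rw [← eigenProj_apply (b := b) (e := e) x]
    refine Finset.sum_eq_zero fun i _ => ?_
    rw [map_smul, _root_.smul_apply, h1, smul_zero]
  have h3 : b x x = b (eigenProj b e x + (x - eigenProj b e x))
      (eigenProj b e x + (x - eigenProj b e x)) := by rw [add_sub_cancel]
  rw [h3, map_add b, _root_.add_apply, map_add, map_add, h2,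
    hb_symm (x - eigenProj b e x) (eigenProj b e x), h2]
  ring

variable [CompleteSpace H]

/-- Each coordinate `b (e i)` of the flow satisfies `c' = lam i * c` with `lam i > 0`, so its square
does not decrease. -/
theorem IsNegativeEigenfamily.monotone_proj (he : IsNegativeEigenfamily b B e lam)
    (hb_symm : ∀ x y, b x y = b y x) (hB_symm : ∀ x y, B x y = B y x)
    (hA : ∀ ξ η, b (A ξ) η = B ξ η) (x : H) :
    Monotone fun t => b (eigenProj b e (linearFlow A x t)) (eigenProj b e (linearFlow A x t)) := by
  simp only [eigenProj_apply, he.scalar_sum_sum]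
  have hd : ∀ i t, HasDerivAt (fun t => b (e i) (linearFlow A x t) ^ 2)
      (2 * (lam i * b (e i) (linearFlow A x t) ^ 2)) t := by
    intro i t
    have h1 := ((b (e i)).hasFDerivAt.comp_hasDerivAt t (hasDerivAt_linearFlow A x t)).pow 2
    have h2 : b (e i) (-A (linearFlow A x t)) = lam i * b (e i) (linearFlow A x t) := by
      rw [map_neg, hb_symm, hA, hB_symm, he.eigen]
      ring
    rw [h2] at h1
    refine HasDerivAt.congr_deriv h1 ?_
    simp only [Function.comp_apply]
    push_cast
    ring
  intro s t hst
  refine Finset.sum_le_sum fun i _ => ?_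
  refine monotone_of_deriv_nonneg (fun t => (hd i t).differentiableAt) (fun t => ?_) hst
  rw [(hd i t).deriv]
  have := he.pos i
  positivity

/-- The derivative of the squared `b`-norm of the complementary component is `-2B` evaluated on that
component, and `B ≥ 0` there. No decay is claimed. -/
theorem IsNegativeEigenfamily.antitone_compl (he : IsNegativeEigenfamily b B e lam)
    (hb_symm : ∀ x y, b x y = b y x)
    (hA : ∀ ξ η, b (A ξ) η = B ξ η)
    (hpos : ∀ x, (∀ i, b (e i) x = 0) → 0 ≤ B x x) (x : H) :
    Antitone fun t => b (linearFlow A x t - eigenProj b e (linearFlow A x t))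
      (linearFlow A x t - eigenProj b e (linearFlow A x t)) := by
  have hd : ∀ t, HasDerivAt (fun t => b (linearFlow A x t - eigenProj b e (linearFlow A x t))
      (linearFlow A x t - eigenProj b e (linearFlow A x t)))
      (-2 * B (linearFlow A x t - eigenProj b e (linearFlow A x t))
        (linearFlow A x t - eigenProj b e (linearFlow A x t))) t := by
    intro t
    set z := linearFlow A x t with hz
    have h1 := hasDerivAt_linearFlow A x t
    rw [← hz] at h1
    have h2 := h1.sub ((eigenProj b e).hasFDerivAt.comp_hasDerivAt t h1)
    have h3 := (b.hasFDerivAt.comp_hasDerivAt t h2).clm_apply h2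
    have hperp : ∀ i, b (e i) (z - eigenProj b e z) = 0 := fun i => by
      rw [map_sub, eigenProj_apply, he.inner_sum, sub_self]
    have h4 : ∀ y, b (eigenProj b e y) (z - eigenProj b e z) = 0 := fun y => by
      conv_lhs => rw [eigenProj_apply (b := b) (e := e) y, map_sum, _root_.sum_apply]
      refine Finset.sum_eq_zero fun i _ => ?_
      rw [map_smul, _root_.smul_apply, hperp, smul_zero]
    -- The span of the eigenvectors is orthogonal to the complement for `B` as well as for `b`, so
    -- the two components decouple.
    have h5 : ∀ y, B (eigenProj b e y) (z - eigenProj b e z) = 0 := fun y => by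
      conv_lhs => rw [eigenProj_apply (b := b) (e := e) y, he.form_sum]
      simp [hperp]
    have h6 : b (-A z - eigenProj b e (-A z)) (z - eigenProj b e z)
        = -B (z - eigenProj b e z) (z - eigenProj b e z) := by
      rw [map_sub b, _root_.sub_apply, h4, sub_zero, map_neg, _root_.neg_apply, hA, map_sub B,
        _root_.sub_apply, h5, sub_zero]
    refine HasDerivAt.congr_deriv h3 ?_
    simp only [Function.comp_apply, Pi.sub_apply, ← hz]
    rw [hb_symm (z - eigenProj b e z), h6]
    ring
  refine antitone_of_deriv_nonpos (fun t => (hd t).differentiableAt) fun t => ?_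
  rw [(hd t).deriv]
  have := hpos (linearFlow A x t - eigenProj b e (linearFlow A x t)) fun i => by
    rw [map_sub, eigenProj_apply, he.inner_sum, sub_self]
  linarith

/-! ### Conclusion of the abstract argument -/

section Hilbert

variable {H : Type*} [NormedAddCommGroup H] [InnerProductSpace ℝ H] [CompleteSpace H]

/-- The operator that represents a bounded form with respect to a scalar product. -/
theorem exists_hessOp_eq {b B : H →L[ℝ] H →L[ℝ] ℝ} (hb : IsCoercive b) {𝒜 : H → ℝ}
    (h𝒜 : ∀ ξ η, secondGateaux 𝒜 ξ η = B ξ η) :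
    ∃ A : H →L[ℝ] H, (∀ ξ η, b (A ξ) η = B ξ η) ∧ ∀ ξ, hessOp b 𝒜 ξ = A ξ := by
  -- Lax–Milgram: `b` is the Hilbert inner product composed with an invertible `T`, so the
  -- representing operator is `T⁻¹` after that of `B`.
  let T := hb.continuousLinearEquivOfBilin
  let A : H →L[ℝ] H := T.symm.toContinuousLinearMap.comp
    (InnerProductSpace.continuousLinearMapOfBilin B)
  have hA : ∀ ξ η, b (A ξ) η = B ξ η := fun ξ η => by
    have h1 := hb.continuousLinearEquivOfBilin_apply (A ξ) η
    rw [← h1]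
    have h2 : T (A ξ) = InnerProductSpace.continuousLinearMapOfBilin B ξ := by simp [A]
    change inner ℝ (T (A ξ)) η = _
    rw [h2, InnerProductSpace.continuousLinearMapOfBilin_apply]
  refine ⟨A, hA, fun ξ => ?_⟩
  have hex : ∃ z, ∀ y, b z y = secondGateaux 𝒜 ξ y :=
    ⟨A ξ, fun y => by rw [hA, h𝒜]⟩
  refine IsCoercive.eq_of_forall_eq hb fun y => ?_
  rw [hessOp, rieszRep, dif_pos hex, hex.choose_spec y, h𝒜, hA]

/-- The behaviour of the flow of `fieldY` near a critical point of a `C^{1,1}` functional whose second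
variation satisfies a Gårding inequality. -/
theorem exists_flow_neighbourhood {b B : H →L[ℝ] H →L[ℝ] ℝ} (hb_symm : ∀ x y, b x y = b y x)
    (hb : IsCoercive b) (hB_symm : ∀ x y, B x y = B y x)
    {G : Type*} [NormedAddCommGroup G] [NormedSpace ℝ G] [FiniteDimensional ℝ G]
    (L : H →L[ℝ] G) {c : ℝ} (hc : 0 < c) (hL : ∀ x, c * ‖x‖ ^ 2 - ‖L x‖ ^ 2 ≤ B x x)
    {𝒜 : H → ℝ} {D : H → H →L[ℝ] ℝ} {ρ C : ℝ} (hρ : 0 < ρ) (hC : 0 ≤ C)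
    (hD : ∀ x ∈ Metric.ball (0 : H) ρ, HasFDerivAt 𝒜 (D x) x)
    (hLip : ∀ x ∈ Metric.ball (0 : H) ρ, ∀ y ∈ Metric.ball (0 : H) ρ, ‖D x - D y‖ ≤ C * ‖x - y‖)
    (hD0 : D 0 = 0) (hDB : ∀ ξ η, HasDerivAt (fun s : ℝ => D (s • ξ) η) (B ξ η) 0)
    {𝓤 : Set H} (h𝓤 : IsOpen 𝓤) {η₀ : H → ℝ} (hη₀ : ∀ x ∈ 𝓤, η₀ x = 1)
    {𝓥 : Set H} (h𝓥nhds : 𝓥 ∈ 𝓝 (0 : H)) (h𝓥 : 𝓥 ⊆ 𝓤) :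
    ∃ ε : ℝ, 0 < ε ∧ ∃ O' : Set H, IsOpen O' ∧ (0 : H) ∈ O' ∧ O' ⊆ 𝓥 ∧
      ∀ x ∈ O',
        (∃ (ωminus ωplus : EReal) (ψ : ℝ → H),
          IsMaximalSolution (fieldY b 𝒜 η₀) x ωminus ωplus ψ) ∧
        ∀ (ωminus ωplus : EReal) (ψ : ℝ → H),
          IsMaximalSolution (fieldY b 𝒜 η₀) x ωminus ωplus ψ →
            (ωplus = ⊤ ∧ ∀ t : ℝ, 0 ≤ t → ψ t ∈ 𝓥) ∨
            (∃ T : ℝ, 0 ≤ T ∧ (T : EReal) < ωplus ∧ 𝒜 (ψ T) < 𝒜 0 - ε ∧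
              ∀ t ∈ Icc (0 : ℝ) T, ψ t ∈ 𝓥) := by
  have hsecond : ∀ ξ η, secondGateaux 𝒜 ξ η = B ξ η := by
    intro ξ η
    have h2 : ∀ᶠ s : ℝ in 𝓝 0, s • ξ ∈ Metric.ball (0 : H) ρ := by
      have : Tendsto (fun s : ℝ => s • ξ) (𝓝 0) (𝓝 ((0 : ℝ) • ξ)) :=
        (continuous_id.smul continuous_const).tendsto 0
      rw [zero_smul] at this
      exact this.eventually (Metric.ball_mem_nhds 0 hρ)
    refine ((hDB ξ η).congr_of_eventuallyEq ?_).deriv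
    filter_upwards [h2] with s hs
    rw [(hD _ hs).fderiv]
  obtain ⟨A, hA, hhess⟩ := exists_hessOp_eq hb hsecond
  have hY : ∀ z ∈ 𝓤, fieldY b 𝒜 η₀ z = -A z := fun z hz => by
    simp [fieldY, hη₀ z hz, hhess]
  obtain ⟨m, e, lam, he, hpos⟩ := exists_isNegativeEigenfamily hb_symm hb hB_symm L hc hL
  -- Without negative directions the sphere `K` below is empty, and the value `1` is arbitrary.
  obtain ⟨μ, hμ, hμlam⟩ : ∃ μ : ℝ, 0 < μ ∧ ∀ i, μ ≤ lam i := by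
    rcases isEmpty_or_nonempty (Fin m) with hm | hm
    · exact ⟨1, one_pos, fun i => (hm.false i).elim⟩
    · obtain ⟨i, hi⟩ := Finite.exists_min lam
      exact ⟨lam i, he.pos i, hi⟩
  obtain ⟨κ, hκ, hbκ⟩ := id hb
  have hnorm : ∀ x : H, ∀ r : ℝ, 0 ≤ r → b x x ≤ κ * r ^ 2 → ‖x‖ ≤ r := by
    intro x r hr hx
    have h1 := (hbκ x).trans hx
    rw [mul_assoc, ← pow_two] at h1
    exact le_of_sq_le_sq (le_of_mul_le_mul_left h1 hκ) hr
  let P := eigenProj b e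
  let K : Set H := {x | ∃ a : Fin m → ℝ, ∑ i, a i ^ 2 = 1 ∧ ∑ i, a i • e i = x}
  have hK : IsCompact K := by
    have h1 : IsCompact {a : Fin m → ℝ | ∑ i, a i ^ 2 = 1} := by
      refine Metric.isCompact_of_isClosed_isBounded
        (isClosed_eq (by fun_prop) continuous_const) ?_
      refine (Metric.isBounded_closedBall (x := (0 : Fin m → ℝ)) (r := 1)).subset ?_
      intro a ha
      rw [mem_closedBall_zero_iff, pi_norm_le_iff_of_nonneg zero_le_one]
      intro i
      have h2 : a i ^ 2 ≤ ∑ i, a i ^ 2 :=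
        Finset.single_le_sum (f := fun i => a i ^ 2) (fun j _ => sq_nonneg _) (Finset.mem_univ i)
      rw [ha] at h2
      rw [Real.norm_eq_abs]
      exact (sq_le_one_iff_abs_le_one _).1 h2
    exact h1.image (f := fun a : Fin m → ℝ => ∑ i, a i • e i) (by fun_prop)
  have hKB : ∀ ξ ∈ K, B ξ ξ ≤ -μ := by
    rintro ξ ⟨a, ha, rfl⟩
    rw [he.form_sum_sum, neg_le_neg_iff]
    calc μ = ∑ i, μ * a i ^ 2 := by rw [← Finset.mul_sum, ha, mul_one]
      _ ≤ ∑ i, lam i * a i ^ 2 := by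
          refine Finset.sum_le_sum fun i _ => ?_
          gcongr
          exact hμlam i
  obtain ⟨r₁, hr₁, hr₁s⟩ := Metric.eventually_nhds_iff_ball.1
    (eventually_forall_le_sub_sq hρ hC hD hLip hD0 hDB hK hμ hKB)
  obtain ⟨r₂, hr₂, hr₂V⟩ := Metric.mem_nhds_iff.1 h𝓥nhds
  -- In the ball of radius `R` the Lipschitz bound on the differential holds, and the ball lies in
  -- `𝓥`.
  let R := min ρ r₂ / 2
  have hR : 0 < R := by positivity
  have hRρ : R < ρ := by
    have := min_le_left ρ r₂
    simp only [R]; linarith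
  have hRr : R < r₂ := by
    have := min_le_right ρ r₂
    simp only [R]; linarith
  -- Both `r ^ 2` and `q` are at most `κ * R ^ 2 / 2`; by Pythagoras and coercivity the box then
  -- lies in the ball of radius `R`. The bound `r < r₁` gives the quadratic decrease on the sphere
  -- of radius `r`.
  obtain ⟨r, hr, hrr₁, hrR⟩ : ∃ r : ℝ, 0 < r ∧ r < r₁ ∧ r ^ 2 ≤ κ * R ^ 2 / 2 := by
    refine ⟨min (r₁ / 2) (Real.sqrt (κ * R ^ 2 / 2)), by positivity, ?_, ?_⟩
    · exact (min_le_left _ _).trans_lt (by linarith)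
    · calc _ ≤ Real.sqrt (κ * R ^ 2 / 2) ^ 2 := by gcongr; exact min_le_right _ _
        _ = _ := Real.sq_sqrt (by positivity)
  -- Replacing a point by its projection at distance at most `d` must cost less than half of the
  -- gain `μ / 4 * r ^ 2`. The `1` in the denominator covers `C = 0`.
  obtain ⟨d, hd, hdC⟩ : ∃ d : ℝ, 0 < d ∧ C * R * d < μ / 8 * r ^ 2 := by
    refine ⟨μ / 8 * r ^ 2 / (C * R + 1), by positivity, ?_⟩
    rw [mul_div_assoc', div_lt_iff₀ (by positivity)]
    have : 0 < μ / 8 * r ^ 2 := by positivity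
    nlinarith
  let q := min (κ * d ^ 2) (κ * R ^ 2 / 2)
  have hq : 0 < q := by positivity
  have hKV : ∀ x, b (P x) (P x) ≤ r ^ 2 → b (x - P x) (x - P x) ≤ q → ‖x‖ ≤ R := by
    intro x h1 h2
    refine hnorm x R hR.le ?_
    rw [he.scalar_proj_add hb_symm x]
    have := h2.trans (min_le_right _ _)
    linarith
  have hPcont : Continuous fun x => b (P x) (P x) :=
    (b.continuous.comp P.continuous).clm_apply P.continuous
  have hQcont : Continuous fun x => b (x - P x) (x - P x) :=
    (b.continuous.comp (continuous_id.sub P.continuous)).clm_apply (continuous_id.sub P.continuous)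
  have hV : ∀ x : H, ‖x‖ ≤ R → x ∈ 𝓥 := fun x hx =>
    hr₂V (mem_ball_zero_iff.2 (hx.trans_lt hRr))
  refine ⟨μ / 8 * r ^ 2, by positivity,
    {x | b (P x) (P x) < r ^ 2 ∧ b (x - P x) (x - P x) < q},
    (isOpen_lt hPcont continuous_const).inter (isOpen_lt hQcont continuous_const),
    ⟨by simpa using by positivity, by simpa using hq⟩,
    fun x hx => hV x (hKV x hx.1.le hx.2.le), fun x hx => ⟨?_, ?_⟩⟩
  · obtain ⟨s, -, hs⟩ := isSolution_linearFlow (Y := fieldY b 𝒜 η₀) (A := A) h𝓤 hY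
      (h𝓥 (hV x (hKV x hx.1.le hx.2.le)))
    exact hs.exists_isMaximalSolution
  intro a τ ψ hψ
  let Ψ := linearFlow A x
  have hΨq : ∀ t, 0 ≤ t → b (Ψ t - P (Ψ t)) (Ψ t - P (Ψ t)) ≤ q := by
    intro t ht
    have h1 := he.antitone_compl hb_symm hA hpos x ht
    simp only [linearFlow_zero] at h1
    exact h1.trans hx.2.le
  have hmono := he.monotone_proj hb_symm hB_symm hA x
  -- The complementary component never grows, so the box can be left only through the negative
  -- directions.
  by_cases hstay : ∀ t, 0 ≤ t → b (P (Ψ t)) (P (Ψ t)) ≤ r ^ 2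
  · left
    have hin : ∀ t, 0 ≤ t → Ψ t ∈ 𝓥 := fun t ht => hV _ (hKV _ (hstay t ht) (hΨq t ht))
    have hT : ∀ T : ℝ, (T : EReal) < τ ∧ EqOn ψ Ψ (Icc 0 T) := fun T =>
      hψ.eqOn_linearFlow h𝓤 hY fun s hs => h𝓥 (hin s hs.1)
    refine ⟨?_, fun t ht => ?_⟩
    · exact (EReal.eq_top_iff_forall_lt τ).2 fun T => (hT T).1
    · rw [(hT t).2 ⟨ht, le_rfl⟩]
      exact hin t ht
  · right
    push Not at hstay
    obtain ⟨t₁, ht₁, hlt⟩ := hstay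
    have hcont : Continuous fun t => b (P (Ψ t)) (P (Ψ t)) :=
      hPcont.comp (continuous_linearFlow A x)
    -- Any time at which the negative component has size exactly `r` will do: by monotonicity it was
    -- not larger before.
    obtain ⟨T, hT, hTr⟩ := intermediate_value_Icc ht₁ hcont.continuousOn
      (show r ^ 2 ∈ Icc (b (P (Ψ 0)) (P (Ψ 0))) (b (P (Ψ t₁)) (P (Ψ t₁))) from
        ⟨by simpa only [Ψ, linearFlow_zero] using hx.1.le, hlt.le⟩)
    simp only at hTr
    have hnR : ∀ s ∈ Icc 0 T, ‖Ψ s‖ ≤ R := fun s hs =>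
      hKV _ ((hmono hs.2).trans hTr.le) (hΨq s hs.1)
    obtain ⟨hTτ, heq⟩ := hψ.eqOn_linearFlow h𝓤 hY fun s hs => h𝓥 (hV _ (hnR s hs))
    refine ⟨T, hT.1, hTτ, ?_, fun t ht => ?_⟩
    · rw [heq ⟨hT.1, le_rfl⟩]
      change 𝒜 (Ψ T) < _
      have hPK : r⁻¹ • P (Ψ T) ∈ K := by
        refine ⟨fun i => r⁻¹ * b (e i) (Ψ T), ?_, ?_⟩
        · have h1 : ∑ i, b (e i) (Ψ T) ^ 2 = r ^ 2 := by
            rw [← hTr, ← he.scalar_sum_sum, ← eigenProj_apply]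
          simp only [mul_pow]
          rw [← Finset.mul_sum, h1, inv_pow, inv_mul_cancel₀ (by positivity)]
        · simp only [P, eigenProj_apply, Finset.smul_sum, smul_smul]
      have h1 := hr₁s r (by simpa [abs_of_pos hr] using hrr₁) _ hPK
      rw [smul_smul, mul_inv_cancel₀ hr.ne', one_smul] at h1
      have hPn : ‖P (Ψ T)‖ ≤ R := hnorm _ R hR.le (by rw [hTr]; nlinarith [sq_nonneg R])
      have h2 := abs_sub_le_of_lipschitz_fderiv hD hLip hD0 hC hRρ (hnR T ⟨hT.1, le_rfl⟩) hPn
      have h3 : ‖Ψ T - P (Ψ T)‖ ≤ d :=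
        hnorm _ d hd.le ((hΨq T hT.1).trans (min_le_left _ _))
      have h4 : C * R * ‖Ψ T - P (Ψ T)‖ ≤ C * R * d := by gcongr
      have h5 := (abs_le.1 h2).2
      linarith
    · rw [heq ht]
      exact hV _ (hnR t ht)

end Hilbert

end CriticalPoint
/-! ### Fibrewise homogeneous Lagrangians -/

/-! ### Partial derivatives of functions smooth on `[0,1] × Ω` -/

section PartialDerivative

variable {Z V : Type*} [NormedAddCommGroup Z] [NormedSpace ℝ Z]
  [NormedAddCommGroup V] [NormedSpace ℝ V] {f : ℝ → Z → V} {Ω : Set Z}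

/-- At `t = 0` and `t = 1` the product is not a neighbourhood, but the slice `{t} × Ω` is open in
the space variable; so the restriction of the one-sided differential is a genuine one. -/
theorem hasFDerivAt_of_contDiffOn_Icc_prod (hΩ : IsOpen Ω)
    (hf : ContDiffOn ℝ ∞ (fun p : ℝ × Z => f p.1 p.2) (Icc 0 1 ×ˢ Ω)) {t : ℝ}
    (ht : t ∈ Icc (0 : ℝ) 1) {z : Z} (hz : z ∈ Ω) :
    HasFDerivAt (f t) ((fderivWithin ℝ (fun p : ℝ × Z => f p.1 p.2) (Icc 0 1 ×ˢ Ω) (t, z)).comp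
      (ContinuousLinearMap.inr ℝ ℝ Z)) z := by
  have h1 := (hf.differentiableOn (by simp) (t, z) ⟨ht, hz⟩).hasFDerivWithinAt
  have h2 : HasFDerivWithinAt (fun z : Z => (t, z)) (ContinuousLinearMap.inr ℝ ℝ Z) Ω z :=
    (hasFDerivAt_prodMk_right t z).hasFDerivWithinAt
  exact (h1.comp z h2 fun z hz => ⟨ht, hz⟩).hasFDerivAt (hΩ.mem_nhds hz)

theorem contDiffOn_fderiv_Icc_prod (hΩ : IsOpen Ω)
    (hf : ContDiffOn ℝ ∞ (fun p : ℝ × Z => f p.1 p.2) (Icc 0 1 ×ˢ Ω)) :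
    ContDiffOn ℝ ∞ (fun p : ℝ × Z => fderiv ℝ (f p.1) p.2) (Icc 0 1 ×ˢ Ω) := by
  have hu : UniqueDiffOn ℝ ((Icc (0 : ℝ) 1) ×ˢ Ω) :=
    (uniqueDiffOn_Icc zero_lt_one).prod hΩ.uniqueDiffOn
  have h1 := (hf.fderivWithin (m := ∞) hu (by simp)).clm_comp
    (contDiffOn_const (c := ContinuousLinearMap.inr ℝ ℝ Z))
  exact h1.congr fun p hp => (hasFDerivAt_of_contDiffOn_Icc_prod hΩ hf hp.1 hp.2).fderiv

end PartialDerivative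

variable {E : Type*} [NormedAddCommGroup E] [NormedSpace ℝ E]

/-- A Lagrangian on a domain `U`, smooth off the zero section and positively homogeneous of degree
two in the velocities. -/
structure IsHomogeneousLagrangian (N : ℝ → E × E → ℝ) (U : Set E) : Prop where
  smooth : ContDiffOn ℝ ∞ (fun p : ℝ × (E × E) => N p.1 p.2) (Icc 0 1 ×ˢ (U ×ˢ {0}ᶜ))
  homogeneous : ∀ t ∈ Icc (0 : ℝ) 1, ∀ q ∈ U, ∀ (v : E) (a : ℝ), 0 ≤ a →
    N t (q, a • v) = a ^ 2 * N t (q, v)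

/-- Multiplication of the velocities by a factor. -/
noncomputable def scaleVel (E : Type*) [NormedAddCommGroup E] [NormedSpace ℝ E] (a : ℝ) :
    E × E →L[ℝ] E × E :=
  (ContinuousLinearMap.id ℝ E).prodMap (a • ContinuousLinearMap.id ℝ E)

@[simp]
theorem scaleVel_apply (a : ℝ) (z : E × E) : scaleVel E a z = (z.1, a • z.2) := rfl

namespace IsHomogeneousLagrangian

variable {N : ℝ → E × E → ℝ} {U : Set E}

/-- Off the zero section continuity is inherited, and on it the bound squeezes `f` to `0`. It serves
for a homogeneous Lagrangian and for its differential. -/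
theorem continuousOn_of_bound {E V : Type*} [NormedAddCommGroup E]
    [NormedAddCommGroup V] {U : Set E} {f : ℝ → E × E → V}
    (hf : ContinuousOn (fun p : ℝ × (E × E) => f p.1 p.2) (Icc 0 1 ×ˢ (U ×ˢ {0}ᶜ))) {R C : ℝ}
    (hR : Metric.closedBall (0 : E) R ⊆ U)
    (hbound : ∀ t ∈ Icc (0 : ℝ) 1, ∀ q ∈ Metric.ball (0 : E) R, ∀ v : E, ‖v‖ ≤ 1 →
      ‖f t (q, v)‖ ≤ C * ‖v‖) :
    ContinuousOn (fun p : ℝ × (E × E) => f p.1 p.2)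
      (Icc 0 1 ×ˢ (Metric.ball (0 : E) R ×ˢ univ)) := by
  rintro ⟨t, q, v⟩ ⟨ht, hq, -⟩
  rcases eq_or_ne v 0 with rfl | hv
  · have h0 : f t (q, 0) = 0 := by
      have := hbound t ht q hq 0 (by simp)
      simpa using this
    have hlim : Tendsto (fun p : ℝ × (E × E) => C * ‖p.2.2‖)
        (𝓝[Icc 0 1 ×ˢ (Metric.ball (0 : E) R ×ˢ univ)] (t, (q, 0))) (𝓝 0) := by
      have : Continuous fun p : ℝ × (E × E) => C * ‖p.2.2‖ := by fun_prop
      simpa using (this.tendsto (t, (q, (0 : E)))).mono_left nhdsWithin_le_nhds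
    rw [ContinuousWithinAt]
    simp only [h0]
    refine squeeze_zero_norm' ?_ hlim
    have h1 : ∀ᶠ p : ℝ × (E × E) in 𝓝 (t, (q, (0 : E))), ‖p.2.2‖ < 1 := by
      have : Continuous fun p : ℝ × (E × E) => ‖p.2.2‖ := by fun_prop
      exact this.continuousAt.eventually (gt_mem_nhds (by simp))
    filter_upwards [mem_nhdsWithin_of_mem_nhds h1, self_mem_nhdsWithin] with p hp hp'
    exact hbound p.1 hp'.1 p.2.1 hp'.2.1 p.2.2 hp.le
  · have h1 := hf (t, (q, v)) ⟨ht, hR (Metric.ball_subset_closedBall hq), hv⟩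
    refine h1.mono_of_mem_nhdsWithin ?_
    have h2 : {p : ℝ × (E × E) | p.2.2 ≠ 0} ∈ 𝓝 (t, (q, v)) :=
      (isOpen_ne_fun (by fun_prop) continuous_const).mem_nhds hv
    filter_upwards [mem_nhdsWithin_of_mem_nhds h2, self_mem_nhdsWithin] with p hp hp'
    exact ⟨hp'.1, hR (Metric.ball_subset_closedBall hp'.2.1), hp⟩

theorem isOpen_domain {E : Type*} [NormedAddCommGroup E] {U : Set E} (hU : IsOpen U) : IsOpen (U ×ˢ ({0}ᶜ : Set E)) :=
  hU.prod isOpen_compl_singleton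

theorem hasFDerivAt (h : IsHomogeneousLagrangian N U) (hU : IsOpen U) {t : ℝ}
    (ht : t ∈ Icc (0 : ℝ) 1) {z : E × E} (hz : z ∈ U ×ˢ ({0}ᶜ : Set E)) :
    HasFDerivAt (N t) (fderiv ℝ (N t) z) z :=
  (hasFDerivAt_of_contDiffOn_Icc_prod (isOpen_domain hU) h.smooth ht hz).differentiableAt.hasFDerivAt

theorem hasFDerivAt_fderiv (h : IsHomogeneousLagrangian N U) (hU : IsOpen U) {t : ℝ}
    (ht : t ∈ Icc (0 : ℝ) 1) {z : E × E} (hz : z ∈ U ×ˢ ({0}ᶜ : Set E)) :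
    HasFDerivAt (fderiv ℝ (N t)) (fderiv ℝ (fderiv ℝ (N t)) z) z :=
  (hasFDerivAt_of_contDiffOn_Icc_prod (f := fun t => fderiv ℝ (N t)) (isOpen_domain hU)
    (contDiffOn_fderiv_Icc_prod (isOpen_domain hU) h.smooth) ht hz).differentiableAt.hasFDerivAt

/-- Differentiation of the homogeneity identity. As `scaleVel` leaves positions fixed, this encodes
at once degree two for the position derivative and degree one for the velocity derivative. -/
theorem fderiv_scale (h : IsHomogeneousLagrangian N U) (hU : IsOpen U) {t : ℝ}
    (ht : t ∈ Icc (0 : ℝ) 1) {z : E × E} (hz : z ∈ U ×ˢ ({0}ᶜ : Set E)) {a : ℝ} (ha : 0 < a) :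
    (fderiv ℝ (N t) (scaleVel E a z)).comp (scaleVel E a) = a ^ 2 • fderiv ℝ (N t) z := by
  have hz' : scaleVel E a z ∈ U ×ˢ ({0}ᶜ : Set E) := by
    have h2 := hz.2
    exact ⟨hz.1, by simpa [ha.ne'] using h2⟩
  have h1 := (h.hasFDerivAt hU ht hz').comp z (scaleVel E a).hasFDerivAt
  have h2 : N t ∘ scaleVel E a =ᶠ[𝓝 z] fun z => a ^ 2 * N t z := by
    filter_upwards [(isOpen_domain hU).mem_nhds hz] with z hz
    exact h.homogeneous t ht z.1 hz.1 z.2 a ha.le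
  have h3 := (h.hasFDerivAt hU ht hz).const_mul (a ^ 2)
  exact (h1.congr_of_eventuallyEq h2.symm).unique h3

theorem fderiv_fderiv_scale (h : IsHomogeneousLagrangian N U) (hU : IsOpen U) {t : ℝ}
    (ht : t ∈ Icc (0 : ℝ) 1) {z : E × E} (hz : z ∈ U ×ˢ ({0}ᶜ : Set E)) {a : ℝ} (ha : 0 < a)
    (c c' : E × E) :
    fderiv ℝ (fderiv ℝ (N t)) (scaleVel E a z) (scaleVel E a c) (scaleVel E a c')
      = a ^ 2 * fderiv ℝ (fderiv ℝ (N t)) z c c' := by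
  have hz' : scaleVel E a z ∈ U ×ˢ ({0}ᶜ : Set E) := by
    have h2 := hz.2
    exact ⟨hz.1, by simpa [ha.ne'] using h2⟩
  have h1 := ((h.hasFDerivAt_fderiv hU ht hz').comp z (scaleVel E a).hasFDerivAt).clm_apply
    (hasFDerivAt_const (scaleVel E a c') z)
  have h2 : (fun z => fderiv ℝ (N t) (scaleVel E a z) (scaleVel E a c')) =ᶠ[𝓝 z]
      fun z => a ^ 2 * fderiv ℝ (N t) z c' := by
    filter_upwards [(isOpen_domain hU).mem_nhds hz] with z hz
    have := DFunLike.congr_fun (h.fderiv_scale hU ht hz ha) c'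
    simpa using this
  have h3 := (((h.hasFDerivAt_fderiv hU ht hz).clm_apply
    (hasFDerivAt_const c' z))).const_mul (a ^ 2)
  have h4 := DFunLike.congr_fun ((h1.congr_of_eventuallyEq h2.symm).unique h3) c
  simpa using h4

theorem apply_zero (h : IsHomogeneousLagrangian N U) {t : ℝ} (ht : t ∈ Icc (0 : ℝ) 1) {q : E}
    (hq : q ∈ U) : N t (q, 0) = 0 := by
  have := h.homogeneous t ht q hq 0 0 le_rfl
  simpa using this

variable [FiniteDimensional ℝ E]

/-- The bounds of a homogeneous Lagrangian and its first two derivatives for velocities in the unit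
ball. -/
theorem exists_bound (h : IsHomogeneousLagrangian N U) (hU : IsOpen U) {R : ℝ}
    (hR : Metric.closedBall (0 : E) R ⊆ U) :
    ∃ C : ℝ, 0 ≤ C ∧ ∀ t ∈ Icc (0 : ℝ) 1, ∀ q ∈ Metric.closedBall (0 : E) R, ∀ v : E, v ≠ 0 →
      ‖v‖ ≤ 1 → |N t (q, v)| ≤ C * ‖v‖ ^ 2 ∧ ‖fderiv ℝ (N t) (q, v)‖ ≤ C * ‖v‖ ∧
        ‖fderiv ℝ (fderiv ℝ (N t)) (q, v)‖ ≤ C := by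
  have : ProperSpace E := FiniteDimensional.proper_real E
  -- The derivatives are bounded over the compact set of unit velocities; a velocity of norm `a ≤ 1`
  -- is reached by scaling.
  let K : Set (ℝ × (E × E)) := Icc 0 1 ×ˢ (Metric.closedBall 0 R ×ˢ Metric.sphere 0 1)
  have hK : IsCompact K :=
    isCompact_Icc.prod ((isCompact_closedBall 0 R).prod (isCompact_sphere 0 1))
  have hsub : K ⊆ Icc 0 1 ×ˢ (U ×ˢ {0}ᶜ) := by
    rintro ⟨t, q, v⟩ ⟨ht, hq, hv⟩
    refine ⟨ht, hR hq, fun hv0 => ?_⟩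
    have h1 : v = 0 := hv0
    rw [h1] at hv
    simp at hv
  have hΩ := isOpen_domain (E := E) hU
  have h1 := contDiffOn_fderiv_Icc_prod hΩ h.smooth
  have h2 := contDiffOn_fderiv_Icc_prod (f := fun t => fderiv ℝ (N t)) hΩ h1
  obtain ⟨C₀, hC₀⟩ := hK.exists_bound_of_continuousOn (h.smooth.continuousOn.mono hsub)
  obtain ⟨C₁, hC₁⟩ := hK.exists_bound_of_continuousOn (h1.continuousOn.mono hsub)
  obtain ⟨C₂, hC₂⟩ := hK.exists_bound_of_continuousOn (h2.continuousOn.mono hsub)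
  let C := max (max C₀ C₁) (max C₂ 0)
  have hCnn : 0 ≤ C := le_max_of_le_right (le_max_right _ _)
  refine ⟨C, hCnn, fun t ht q hq v hv hv1 => ?_⟩
  set a := ‖v‖ with ha
  have hapos : 0 < a := norm_pos_iff.2 hv
  set u := a⁻¹ • v with hu
  have hvu : v = a • u := by rw [hu, smul_smul, mul_inv_cancel₀ hapos.ne', one_smul]
  have hun : ‖u‖ = 1 := by
    rw [hu, norm_smul, norm_inv, norm_norm, inv_mul_cancel₀ hapos.ne']
  have hmemK : (t, (q, u)) ∈ K := ⟨ht, hq, by simp [hun]⟩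
  have hz : (q, u) ∈ U ×ˢ ({0}ᶜ : Set E) := (hsub hmemK).2
  have hqv : (q, v) = scaleVel E a (q, u) := by simp [← hvu]
  -- Each derivative slot loses at most a factor `a⁻¹` under the scaling. With the factor `a ^ 2`
  -- from homogeneity, the differential keeps one power of `a` and the second differential none.
  have hscale : ∀ c : E × E, ∃ c' : E × E, c = scaleVel E a c' ∧ a * ‖c'‖ ≤ ‖c‖ := by
    intro c
    refine ⟨(c.1, a⁻¹ • c.2), ?_, ?_⟩
    · simp [smul_smul, mul_inv_cancel₀ hapos.ne']
    · have h3 : a * ‖a⁻¹ • c.2‖ = ‖c.2‖ := by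
        rw [norm_smul, norm_inv, norm_norm, ← mul_assoc, mul_inv_cancel₀ hapos.ne', one_mul]
      rw [Prod.norm_def, mul_max_of_nonneg _ _ hapos.le, h3]
      refine max_le ?_ (norm_snd_le c)
      exact (mul_le_of_le_one_left (norm_nonneg _) hv1).trans (norm_fst_le c)
  refine ⟨?_, ?_, ?_⟩
  · rw [hvu, h.homogeneous t ht q (hR hq) u a hapos.le, abs_mul, abs_of_nonneg (by positivity),
      mul_comm]
    gcongr
    exact (hC₀ _ hmemK).trans (le_max_of_le_left (le_max_left _ _))
  · refine ContinuousLinearMap.opNorm_le_bound _ (by positivity) fun c => ?_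
    obtain ⟨c', rfl, hc'⟩ := hscale c
    rw [hqv]
    have h3 := DFunLike.congr_fun (h.fderiv_scale hU ht hz hapos) c'
    rw [ContinuousLinearMap.comp_apply] at h3
    rw [h3, _root_.smul_apply, norm_smul, Real.norm_of_nonneg (by positivity)]
    have h4 : ‖fderiv ℝ (N t) (q, u) c'‖ ≤ C * ‖c'‖ :=
      (ContinuousLinearMap.le_opNorm _ _).trans (by
        gcongr
        exact (hC₁ _ hmemK).trans (le_max_of_le_left (le_max_right _ _)))
    calc a ^ 2 * ‖fderiv ℝ (N t) (q, u) c'‖ ≤ a ^ 2 * (C * ‖c'‖) := by gcongr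
      _ = C * a * (a * ‖c'‖) := by ring
      _ ≤ _ := by gcongr
  · refine ContinuousLinearMap.opNorm_le_bound₂ _ hCnn fun c d => ?_
    obtain ⟨c', rfl, hc'⟩ := hscale c
    obtain ⟨d', rfl, hd'⟩ := hscale d
    rw [hqv, h.fderiv_fderiv_scale hU ht hz hapos, norm_mul, Real.norm_of_nonneg (by positivity)]
    have h4 : ‖fderiv ℝ (fderiv ℝ (N t)) (q, u) c' d'‖ ≤ C * ‖c'‖ * ‖d'‖ :=
      (ContinuousLinearMap.le_opNorm₂ _ _ _).trans (by
        gcongr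
        exact (hC₂ _ hmemK).trans (le_max_of_le_right (le_max_left _ _)))
    calc a ^ 2 * ‖fderiv ℝ (fderiv ℝ (N t)) (q, u) c' d'‖ ≤ a ^ 2 * (C * ‖c'‖ * ‖d'‖) := by gcongr
      _ = C * (a * ‖c'‖) * (a * ‖d'‖) := by ring
      _ ≤ _ := by gcongr

/-- A homogeneous Lagrangian is differentiable on the zero section, and its differential vanishes
there. -/
theorem hasFDerivAt_zero (h : IsHomogeneousLagrangian N U) (hU : IsOpen U) {R : ℝ}
    (hR : Metric.closedBall (0 : E) R ⊆ U) {t : ℝ} (ht : t ∈ Icc (0 : ℝ) 1) {q : E}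
    (hq : q ∈ Metric.ball (0 : E) R) : HasFDerivAt (N t) (0 : E × E →L[ℝ] ℝ) (q, 0) := by
  obtain ⟨C, hC, hbound⟩ := h.exists_bound hU hR
  have hO : IsOpen (Metric.ball (0 : E) R ×ˢ Metric.ball (0 : E) 1) :=
    Metric.isOpen_ball.prod Metric.isOpen_ball
  have hle : ∀ᶠ z : E × E in 𝓝 (q, 0), ‖N t z‖ ≤ C * ‖z - (q, 0)‖ ^ 2 := by
    filter_upwards [hO.mem_nhds (show (q, (0 : E)) ∈ _ from ⟨hq, by simp⟩)] with z hz
    have hzn : ‖z.2‖ ≤ ‖z - (q, 0)‖ := by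
      simpa only [Prod.snd_sub, sub_zero] using norm_snd_le (z - (q, (0 : E)))
    rcases eq_or_ne z.2 0 with h0 | h0
    · have : N t z = 0 := by
        have := h.apply_zero ht (hR (Metric.ball_subset_closedBall hz.1))
        rwa [← h0] at this
      rw [this, norm_zero]
      positivity
    · have h1 := (hbound t ht z.1 (Metric.ball_subset_closedBall hz.1) z.2 h0
        (by simpa using (mem_ball_zero_iff.1 hz.2).le)).1
      refine h1.trans ?_
      gcongr
  rw [hasFDerivAt_iff_isLittleO]
  have h0 : N t (q, 0) = 0 := h.apply_zero ht (hR (Metric.ball_subset_closedBall hq))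
  simp only [h0, sub_zero, _root_.zero_apply]
  refine (Asymptotics.IsBigO.of_bound C (hle.mono fun z hz => ?_)).trans_isLittleO
    (g := fun z : E × E => ‖z - (q, 0)‖ ^ 2) ?_
  · simpa using hz
  · have h1 : Tendsto (fun z : E × E => z - (q, 0)) (𝓝 (q, 0)) (𝓝 0) := by
      have : Continuous fun z : E × E => z - (q, 0) := by fun_prop
      simpa using this.tendsto (q, 0)
    exact (Asymptotics.isLittleO_norm_pow_id (E' := E × E) one_lt_two).comp_tendsto h1

theorem differentiableAt (h : IsHomogeneousLagrangian N U) (hU : IsOpen U) {R : ℝ}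
    (hR : Metric.closedBall (0 : E) R ⊆ U) {t : ℝ} (ht : t ∈ Icc (0 : ℝ) 1) {q : E}
    (hq : q ∈ Metric.ball (0 : E) R) (v : E) : DifferentiableAt ℝ (N t) (q, v) := by
  rcases eq_or_ne v 0 with rfl | hv
  · exact (h.hasFDerivAt_zero hU hR ht hq).differentiableAt
  · exact (h.hasFDerivAt hU ht (z := (q, v))
      ⟨hR (Metric.ball_subset_closedBall hq), hv⟩).differentiableAt

/-- The second differential is bounded off the zero section. If the segment of velocities misses
`0`, the mean value inequality applies. If it meets `0`, both velocities have norm at most `‖v -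
v'‖`, and the linear bound on the differential suffices. -/
theorem lipschitz_fderiv_unit (h : IsHomogeneousLagrangian N U) (hU : IsOpen U) {R : ℝ}
    (hR : Metric.closedBall (0 : E) R ⊆ U) :
    ∃ C : ℝ, 0 ≤ C ∧ ∀ t ∈ Icc (0 : ℝ) 1, ∀ q ∈ Metric.ball (0 : E) R,
      ∀ q' ∈ Metric.ball (0 : E) R, ∀ v v' : E, ‖v‖ ≤ 1 → ‖v'‖ ≤ 1 →
      ‖fderiv ℝ (N t) (q, v) - fderiv ℝ (N t) (q', v')‖ ≤ C * ‖(q, v) - (q', v')‖ := by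
  obtain ⟨C, hC, hbound⟩ := h.exists_bound hU hR
  refine ⟨2 * C, by positivity, fun t ht q hq q' hq' v v' hv hv' => ?_⟩
  have hD : ∀ q ∈ Metric.ball (0 : E) R, ∀ v : E, ‖v‖ ≤ 1 →
      ‖fderiv ℝ (N t) (q, v)‖ ≤ C * ‖v‖ := by
    intro q hq v hv
    rcases eq_or_ne v 0 with rfl | h0
    · simp [(h.hasFDerivAt_zero hU hR ht hq).fderiv]
    · exact (hbound t ht q (Metric.ball_subset_closedBall hq) v h0 hv).2.1
  by_cases h0 : (0 : E) ∈ segment ℝ v v'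
  · obtain ⟨a, b, ha, hb, hab, habv⟩ := h0
    have h1 : v = b • (v - v') :=
      calc v = (a + b) • v - (a • v + b • v') := by rw [hab, habv, one_smul, sub_zero]
        _ = b • (v - v') := by module
    have h2 : v' = (-a) • (v - v') :=
      calc v' = (a + b) • v' - (a • v + b • v') := by rw [hab, habv, one_smul, sub_zero]
        _ = (-a) • (v - v') := by module
    have h3 : ‖v‖ ≤ ‖v - v'‖ := by
      conv_lhs => rw [h1]
      rw [norm_smul, Real.norm_of_nonneg hb]
      exact mul_le_of_le_one_left (norm_nonneg _) (by linarith)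
    have h4 : ‖v'‖ ≤ ‖v - v'‖ := by
      conv_lhs => rw [h2]
      rw [norm_smul, norm_neg, Real.norm_of_nonneg ha]
      exact mul_le_of_le_one_left (norm_nonneg _) (by linarith)
    have h5 : ‖v - v'‖ ≤ ‖(q, v) - (q', v')‖ := norm_snd_le ((q, v) - (q', v'))
    calc _ ≤ ‖fderiv ℝ (N t) (q, v)‖ + ‖fderiv ℝ (N t) (q', v')‖ := norm_sub_le _ _
      _ ≤ C * ‖v‖ + C * ‖v'‖ := add_le_add (hD q hq v hv) (hD q' hq' v' hv')
      _ ≤ C * ‖(q, v) - (q', v')‖ + C * ‖(q, v) - (q', v')‖ := by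
          gcongr
          · exact h3.trans h5
          · exact h4.trans h5
      _ = _ := by ring
  · have hmem : ∀ z ∈ segment ℝ (q', v') (q, v), z.1 ∈ Metric.ball (0 : E) R ∧ z.2 ≠ 0 ∧
        ‖z.2‖ ≤ 1 := by
      rintro z ⟨a, b, ha, hb, hab, rfl⟩
      refine ⟨convex_ball (0 : E) R hq' hq ha hb hab, fun h1 => h0 ?_, ?_⟩
      · rw [segment_symm]
        exact ⟨a, b, ha, hb, hab, h1⟩
      · have := convex_closedBall (0 : E) 1 (mem_closedBall_zero_iff.2 hv')
          (mem_closedBall_zero_iff.2 hv) ha hb hab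
        simpa using this
    have h1 := (convex_segment (𝕜 := ℝ) (q', v') (q, v)).norm_image_sub_le_of_norm_hasFDerivWithin_le
      (f := fderiv ℝ (N t)) (f' := fderiv ℝ (fderiv ℝ (N t))) (C := C)
      (fun z hz => (h.hasFDerivAt_fderiv hU ht
        ⟨hR (Metric.ball_subset_closedBall (hmem z hz).1), (hmem z hz).2.1⟩).hasFDerivWithinAt)
      (fun z hz => (hbound t ht z.1 (Metric.ball_subset_closedBall (hmem z hz).1) z.2
        (hmem z hz).2.1 (hmem z hz).2.2).2.2)
      (left_mem_segment ℝ _ _) (right_mem_segment ℝ _ _)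
    refine h1.trans ?_
    gcongr
    linarith

theorem fderiv_scale_apply (h : IsHomogeneousLagrangian N U) (hU : IsOpen U) {R : ℝ}
    (hR : Metric.closedBall (0 : E) R ⊆ U) {t : ℝ} (ht : t ∈ Icc (0 : ℝ) 1) {q : E}
    (hq : q ∈ Metric.ball (0 : E) R) (v : E) {a : ℝ} (ha : 0 < a) (c : E × E) :
    fderiv ℝ (N t) (q, v) c
      = a ^ 2 * fderiv ℝ (N t) (q, a⁻¹ • v) (c.1, a⁻¹ • c.2) := by
  rcases eq_or_ne v 0 with rfl | hv
  · simp [(h.hasFDerivAt_zero hU hR ht hq).fderiv]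
  · have h1 := DFunLike.congr_fun (h.fderiv_scale hU ht (z := (q, a⁻¹ • v))
      ⟨hR (Metric.ball_subset_closedBall hq), by simpa [ha.ne'] using hv⟩ ha) (c.1, a⁻¹ • c.2)
    simpa [smul_smul, mul_inv_cancel₀ ha.ne'] using h1

/-- The weighted Lipschitz estimate for the differential of a homogeneous Lagrangian. -/
theorem lipschitz_fderiv (h : IsHomogeneousLagrangian N U) (hU : IsOpen U) {R : ℝ}
    (hR : Metric.closedBall (0 : E) R ⊆ U) :
    ∃ C : ℝ, 0 ≤ C ∧ ∀ t ∈ Icc (0 : ℝ) 1, ∀ q ∈ Metric.ball (0 : E) R,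
      ∀ q' ∈ Metric.ball (0 : E) R, ∀ (v v' : E) (m : ℝ), 0 < m → ‖v‖ ≤ m → ‖v'‖ ≤ m →
      ∀ c : E × E, |fderiv ℝ (N t) (q, v) c - fderiv ℝ (N t) (q', v') c| ≤
        C * (m * ‖q - q'‖ + ‖v - v'‖) * (m * ‖c.1‖ + ‖c.2‖) := by
  obtain ⟨C, hC, hlip⟩ := h.lipschitz_fderiv_unit hU hR
  refine ⟨C, hC, fun t ht q hq q' hq' v v' m hm hv hv' c => ?_⟩
  have hunit : ∀ v : E, ‖v‖ ≤ m → ‖m⁻¹ • v‖ ≤ 1 := fun v hv => by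
    rw [norm_smul, norm_inv, Real.norm_of_nonneg hm.le, inv_mul_le_iff₀ hm, mul_one]
    exact hv
  -- After scaling the velocities by `m⁻¹` into the unit ball, position increments carry the weight
  -- `m` and velocity increments the weight `1`.
  rw [h.fderiv_scale_apply hU hR ht hq v hm c, h.fderiv_scale_apply hU hR ht hq' v' hm c,
    ← mul_sub, abs_mul, abs_of_nonneg (by positivity), ← _root_.sub_apply]
  have h1 := ContinuousLinearMap.le_opNorm (fderiv ℝ (N t) (q, m⁻¹ • v)
    - fderiv ℝ (N t) (q', m⁻¹ • v')) (c.1, m⁻¹ • c.2)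
  rw [Real.norm_eq_abs] at h1
  have h2 := hlip t ht q hq q' hq' _ _ (hunit v hv) (hunit v' hv')
  have h3 : ∀ x y : E, m * ‖(x, m⁻¹ • y)‖ ≤ m * ‖x‖ + ‖y‖ := by
    intro x y
    have h4 : m * ‖m⁻¹ • y‖ = ‖y‖ := by
      rw [norm_smul, norm_inv, Real.norm_of_nonneg hm.le, ← mul_assoc, mul_inv_cancel₀ hm.ne',
        one_mul]
    rw [Prod.norm_def, mul_max_of_nonneg _ _ hm.le, h4]
    exact max_le (le_add_of_nonneg_right (norm_nonneg _)) (le_add_of_nonneg_left (by positivity))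
  have h5 : (q, m⁻¹ • v) - (q', m⁻¹ • v') = (q - q', m⁻¹ • (v - v')) := by
    simp [smul_sub]
  rw [h5] at h2
  calc _ ≤ m ^ 2 * ((C * ‖(q - q', m⁻¹ • (v - v'))‖) * ‖(c.1, m⁻¹ • c.2)‖) := by
        gcongr
        exact h1.trans (by gcongr)
    _ = C * (m * ‖(q - q', m⁻¹ • (v - v'))‖) * (m * ‖(c.1, m⁻¹ • c.2)‖) := by ring
    _ ≤ _ := by
        gcongr
        · exact h3 _ _
        · exact h3 _ _

theorem continuousOn (h : IsHomogeneousLagrangian N U) (hU : IsOpen U) {R : ℝ}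
    (hR : Metric.closedBall (0 : E) R ⊆ U) :
    ContinuousOn (fun p : ℝ × (E × E) => N p.1 p.2)
      (Icc 0 1 ×ˢ (Metric.ball (0 : E) R ×ˢ univ)) := by
  obtain ⟨C, hC, hbound⟩ := h.exists_bound hU hR
  refine continuousOn_of_bound h.smooth.continuousOn hR (C := C) fun t ht q hq v hv => ?_
  rcases eq_or_ne v 0 with rfl | h0
  · simp [h.apply_zero ht (hR (Metric.ball_subset_closedBall hq))]
  · refine (hbound t ht q (Metric.ball_subset_closedBall hq) v h0 hv).1.trans ?_
    gcongr
    exact pow_le_of_le_one (norm_nonneg _) hv two_ne_zero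

theorem continuousOn_fderiv (h : IsHomogeneousLagrangian N U) (hU : IsOpen U) {R : ℝ}
    (hR : Metric.closedBall (0 : E) R ⊆ U) :
    ContinuousOn (fun p : ℝ × (E × E) => fderiv ℝ (N p.1) p.2)
      (Icc 0 1 ×ˢ (Metric.ball (0 : E) R ×ˢ univ)) := by
  obtain ⟨C, hC, hbound⟩ := h.exists_bound hU hR
  refine continuousOn_of_bound (f := fun t => fderiv ℝ (N t))
    (contDiffOn_fderiv_Icc_prod (isOpen_domain hU) h.smooth).continuousOn hR (C := C)
    fun t ht q hq v hv => ?_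
  rcases eq_or_ne v 0 with rfl | h0
  · simp [(h.hasFDerivAt_zero hU hR ht hq).fderiv]
  · exact (hbound t ht q (Metric.ball_subset_closedBall hq) v h0 hv).2.1

end IsHomogeneousLagrangian

/-! ### Lagrangians of quadratic growth -/

section Quadratic

variable {E : Type*} [NormedAddCommGroup E] [NormedSpace ℝ E]

/-- A Lagrangian `G(t,(q,y))`, for `t ∈ [0,1]` and `‖q‖ < r`, whose differential satisfies the
weighted Lipschitz estimates that make the action of class `C^{1,1}` on `H¹`, and which is smooth
near the zero section. -/
structure IsQuadraticLagrangian (G : ℝ → E × E → ℝ) (r C : ℝ) : Prop where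
  r_pos : 0 < r
  C_nonneg : 0 ≤ C
  differentiableAt : ∀ t ∈ Icc (0 : ℝ) 1, ∀ z : E × E, ‖z.1‖ < r → DifferentiableAt ℝ (G t) z
  lipschitz : ∀ t ∈ Icc (0 : ℝ) 1, ∀ z z' : E × E, ‖z.1‖ < r → ‖z'.1‖ < r → ∀ c : E × E,
    |fderiv ℝ (G t) z c - fderiv ℝ (G t) z' c| ≤
      C * ((1 + ‖z.2‖ + ‖z'.2‖) * ‖z.1 - z'.1‖ + ‖z.2 - z'.2‖) *
        ((1 + ‖z.2‖ + ‖z'.2‖) * ‖c.1‖ + ‖c.2‖)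
  continuousOn : ContinuousOn (fun p : ℝ × (E × E) => G p.1 p.2)
    (Icc 0 1 ×ˢ (Metric.ball (0 : E) r ×ˢ univ))
  continuousOn_fderiv : ContinuousOn (fun p : ℝ × (E × E) => fderiv ℝ (G p.1) p.2)
    (Icc 0 1 ×ˢ (Metric.ball (0 : E) r ×ˢ univ))
  smooth : ContDiffOn ℝ ∞ (fun p : ℝ × (E × E) => G p.1 p.2)
    (Icc 0 1 ×ˢ (Metric.ball (0 : E) r ×ˢ Metric.ball (0 : E) r))

variable [FiniteDimensional ℝ E]

theorem exists_bound_drift {w : ℝ → E → E} {U : Set E} (hU : IsOpen U)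
    (hw : ContDiffOn ℝ ∞ (fun p : ℝ × E => w p.1 p.2) (Icc 0 1 ×ˢ U)) {R : ℝ}
    (hR : Metric.closedBall (0 : E) R ⊆ U) :
    ∃ C : ℝ, 0 ≤ C ∧ ∀ t ∈ Icc (0 : ℝ) 1, ∀ q ∈ Metric.ball (0 : E) R,
      ‖w t q‖ ≤ C ∧ ‖fderiv ℝ (w t) q‖ ≤ C ∧ ∀ q' ∈ Metric.ball (0 : E) R,
        ‖w t q - w t q'‖ ≤ C * ‖q - q'‖ ∧
        ‖fderiv ℝ (w t) q - fderiv ℝ (w t) q'‖ ≤ C * ‖q - q'‖ := by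
  have : ProperSpace E := FiniteDimensional.proper_real E
  have hK : IsCompact (Icc (0 : ℝ) 1 ×ˢ Metric.closedBall (0 : E) R) :=
    isCompact_Icc.prod (isCompact_closedBall 0 R)
  have hsub : Icc (0 : ℝ) 1 ×ˢ Metric.closedBall (0 : E) R ⊆ Icc 0 1 ×ˢ U :=
    prod_mono le_rfl hR
  have h1 := contDiffOn_fderiv_Icc_prod hU hw
  have h2 := contDiffOn_fderiv_Icc_prod (f := fun t => fderiv ℝ (w t)) hU h1
  obtain ⟨C₀, hC₀⟩ := hK.exists_bound_of_continuousOn (hw.continuousOn.mono hsub)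
  obtain ⟨C₁, hC₁⟩ := hK.exists_bound_of_continuousOn (h1.continuousOn.mono hsub)
  obtain ⟨C₂, hC₂⟩ := hK.exists_bound_of_continuousOn (h2.continuousOn.mono hsub)
  let C := max (max C₀ C₁) (max C₂ 0)
  have hCnn : 0 ≤ C := le_max_of_le_right (le_max_right _ _)
  have hC0 : C₀ ≤ C := le_max_of_le_left (le_max_left _ _)
  have hC1 : C₁ ≤ C := le_max_of_le_left (le_max_right _ _)
  have hC2 : C₂ ≤ C := le_max_of_le_right (le_max_left _ _)
  have hin : ∀ q ∈ Metric.ball (0 : E) R, q ∈ Metric.closedBall (0 : E) R := fun q hq =>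
    Metric.ball_subset_closedBall hq
  refine ⟨C, hCnn, fun t ht q hq => ⟨(hC₀ (t, q) ⟨ht, hin q hq⟩).trans hC0,
    (hC₁ (t, q) ⟨ht, hin q hq⟩).trans hC1, fun q' hq' => ⟨?_, ?_⟩⟩⟩
  · exact (convex_ball (0 : E) R).norm_image_sub_le_of_norm_hasFDerivWithin_le
      (f := w t) (f' := fderiv ℝ (w t)) (C := C)
      (fun z hz => (hasFDerivAt_of_contDiffOn_Icc_prod hU hw ht
        (hR (hin z hz))).differentiableAt.hasFDerivAt.hasFDerivWithinAt)
      (fun z hz => (hC₁ (t, z) ⟨ht, hin z hz⟩).trans hC1) hq' hq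
  · exact (convex_ball (0 : E) R).norm_image_sub_le_of_norm_hasFDerivWithin_le
      (f := fderiv ℝ (w t)) (f' := fderiv ℝ (fderiv ℝ (w t))) (C := C)
      (fun z hz => (hasFDerivAt_of_contDiffOn_Icc_prod (f := fun t => fderiv ℝ (w t)) hU h1 ht
        (hR (hin z hz))).differentiableAt.hasFDerivAt.hasFDerivWithinAt)
      (fun z hz => (hC₂ (t, z) ⟨ht, hin z hz⟩).trans hC2) hq' hq

/-- By compactness of `[0,1]` a drift that does not vanish at `q = 0` keeps `y + w t q` off the zero
section for all small `q` and `y`. This is where the shifted Lagrangian is smooth. -/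
theorem exists_radius_ne_zero {E : Type*} [NormedAddCommGroup E] {w : ℝ → E → E} {U : Set E} (hU : IsOpen U) (h0 : (0 : E) ∈ U)
    (hw : ContinuousOn (fun p : ℝ × E => w p.1 p.2) (Icc 0 1 ×ˢ U))
    (hw0 : ∀ t ∈ Icc (0 : ℝ) 1, w t 0 ≠ 0) :
    ∃ r : ℝ, 0 < r ∧ ∀ t ∈ Icc (0 : ℝ) 1, ∀ q y : E, ‖q‖ < r → ‖y‖ < r → y + w t q ≠ 0 := by
  have h1 : ∀ᶠ z : E × E in 𝓝 0, ∀ t ∈ Icc (0 : ℝ) 1, t ∈ Icc (0 : ℝ) 1 → z.1 ∈ U →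
      z.2 + w t z.1 ≠ 0 := by
    refine isCompact_Icc.eventually_forall_of_forall_eventually fun t ht => ?_
    have hc : ContinuousWithinAt (fun p : (E × E) × ℝ => p.1.2 + w p.2 p.1.1)
        {p | p.2 ∈ Icc (0 : ℝ) 1 ∧ p.1.1 ∈ U} ((0 : E × E), t) := by
      refine ContinuousWithinAt.add (by fun_prop) ?_
      have h2 := hw (t, 0) ⟨ht, h0⟩
      refine ContinuousWithinAt.comp (f := fun p : (E × E) × ℝ => (p.2, p.1.1))
        (t := Icc (0 : ℝ) 1 ×ˢ U) (g := fun p : ℝ × E => w p.1 p.2) h2 (by fun_prop) ?_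
      exact fun p hp => hp
    have h3 := hc.eventually_ne (by simpa using hw0 t ht)
    rw [eventually_nhdsWithin_iff] at h3
    filter_upwards [h3] with p hp h4 h5 using hp ⟨h4, h5⟩
  have h2 : ∀ᶠ z : E × E in 𝓝 0, z.1 ∈ U :=
    continuous_fst.continuousAt.preimage_mem_nhds (hU.mem_nhds h0)
  obtain ⟨r, hr, hball⟩ := Metric.eventually_nhds_iff_ball.1 (h1.and h2)
  refine ⟨r, hr, fun t ht q y hq hy => ?_⟩
  have hmem : (q, y) ∈ Metric.ball (0 : E × E) r := by
    simpa [Prod.norm_def] using And.intro hq hy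
  exact (hball _ hmem).1 t ht ht (hball _ hmem).2

/-- A fibrewise homogeneous Lagrangian in moving coordinates with nowhere vanishing drift. -/
theorem IsHomogeneousLagrangian.exists_isQuadraticLagrangian {N : ℝ → E × E → ℝ} {U : Set E}
    (h : IsHomogeneousLagrangian N U) (hU : IsOpen U) (h0 : (0 : E) ∈ U) {w : ℝ → E → E}
    (hw : ContDiffOn ℝ ∞ (fun p : ℝ × E => w p.1 p.2) (Icc 0 1 ×ˢ U))
    (hw0 : ∀ t ∈ Icc (0 : ℝ) 1, w t 0 ≠ 0) {G : ℝ → E × E → ℝ}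
    (hG : ∀ t ∈ Icc (0 : ℝ) 1, ∀ z : E × E, z.1 ∈ U → G t z = N t (z.1, z.2 + w t z.1)) :
    ∃ r C : ℝ, Metric.ball (0 : E) r ⊆ U ∧ IsQuadraticLagrangian G r C := by
  obtain ⟨r₁, hr₁, hne⟩ := exists_radius_ne_zero hU h0 hw.continuousOn hw0
  obtain ⟨R, hR, hRU⟩ := Metric.nhds_basis_closedBall.mem_iff.1 (hU.mem_nhds h0)
  obtain ⟨C₁, hC₁, hN⟩ := h.lipschitz_fderiv hU hRU
  obtain ⟨C₂, hC₂, hwb⟩ := exists_bound_drift hU hw hRU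
  have hin : ∀ q : E, ‖q‖ < R → q ∈ U := fun q hq => hRU (by simpa using hq.le)
  have hO : IsOpen {z : E × E | z.1 ∈ U} := hU.preimage continuous_fst
  have hDG : ∀ t ∈ Icc (0 : ℝ) 1, ∀ z : E × E, ‖z.1‖ < R →
      HasFDerivAt (G t) ((fderiv ℝ (N t) (z.1, z.2 + w t z.1)).comp
        ((ContinuousLinearMap.fst ℝ E E).prod (ContinuousLinearMap.snd ℝ E E +
          (fderiv ℝ (w t) z.1).comp (ContinuousLinearMap.fst ℝ E E)))) z := by
    intro t ht z hz
    have h1 : HasFDerivAt (fun z : E × E => w t z.1)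
        ((fderiv ℝ (w t) z.1).comp (ContinuousLinearMap.fst ℝ E E)) z :=
      ((hasFDerivAt_of_contDiffOn_Icc_prod hU hw ht
        (hin _ hz)).differentiableAt.hasFDerivAt).comp z hasFDerivAt_fst
    have h2 := (hasFDerivAt_fst (𝕜 := ℝ) (p := z)).prodMk
      ((hasFDerivAt_snd (𝕜 := ℝ) (p := z)).add h1)
    have h3 := (h.differentiableAt hU hRU ht (by simpa using hz) (z.2 + w t z.1)).hasFDerivAt.comp
      z h2
    refine h3.congr_of_eventuallyEq ?_
    filter_upwards [hO.mem_nhds (hin _ hz)] with z' hz' using hG t ht z' hz'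
  have hshear : ContDiffOn ℝ ∞
      (fun p : ℝ × (E × E) => (p.1, (p.2.1, p.2.2 + w p.1 p.2.1)))
      (Icc (0 : ℝ) 1 ×ˢ (U ×ˢ (univ : Set E))) := by
    refine contDiffOn_fst.prodMk (ContDiffOn.prodMk (by fun_prop) (ContDiffOn.add (by fun_prop) ?_))
    exact hw.comp (f := fun p : ℝ × (E × E) => (p.1, p.2.1)) (by fun_prop) fun p hp =>
      ⟨hp.1, hp.2.1⟩
  -- Two terms are each bounded by `C₁` times the weights, and each of the two weights costs a
  -- factor `2 * C₂ + 1`.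
  refine ⟨min r₁ R, 2 * C₁ * (2 * C₂ + 1) ^ 2, ?_, ?_⟩
  · intro q hq
    exact hin q ((mem_ball_zero_iff.1 hq).trans_le (min_le_right _ _))
  have hlt : ∀ {q : E}, ‖q‖ < min r₁ R → ‖q‖ < R := fun hq => hq.trans_le (min_le_right _ _)
  have hsub : (Icc (0 : ℝ) 1 ×ˢ (Metric.ball (0 : E) (min r₁ R) ×ˢ univ) : Set (ℝ × (E × E))) ⊆
      Icc (0 : ℝ) 1 ×ˢ (U ×ˢ (univ : Set E)) := fun p hp =>
    ⟨hp.1, hin _ (hlt (mem_ball_zero_iff.1 hp.2.1)), trivial⟩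
  have hmaps : MapsTo (fun p : ℝ × (E × E) => (p.1, (p.2.1, p.2.2 + w p.1 p.2.1)))
      (Icc (0 : ℝ) 1 ×ˢ (Metric.ball (0 : E) (min r₁ R) ×ˢ univ))
      (Icc 0 1 ×ˢ (Metric.ball (0 : E) R ×ˢ univ)) := fun p hp =>
    ⟨hp.1, by simpa using hlt (mem_ball_zero_iff.1 hp.2.1), trivial⟩
  refine ⟨by positivity, by positivity, fun t ht z hz => (hDG t ht z (hlt hz)).differentiableAt,
    ?_, ?_, ?_, ?_⟩
  · intro t ht z z' hz hz' c
    rw [(hDG t ht z (hlt hz)).fderiv, (hDG t ht z' (hlt hz')).fderiv]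
    have hb : z.1 ∈ Metric.ball (0 : E) R := by simpa using hlt hz
    have hb' : z'.1 ∈ Metric.ball (0 : E) R := by simpa using hlt hz'
    obtain ⟨hw1, hw2, hw3⟩ := hwb t ht z.1 hb
    obtain ⟨hw1', hw2', -⟩ := hwb t ht z'.1 hb'
    obtain ⟨hw4, hw5⟩ := hw3 z'.1 hb'
    simp only [ContinuousLinearMap.comp_apply, ContinuousLinearMap.prod_apply, _root_.add_apply,
      ContinuousLinearMap.coe_fst', ContinuousLinearMap.coe_snd']
    set Y := 1 + ‖z.2‖ + ‖z'.2‖ with hY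
    set k := 2 * C₂ + 1 with hk
    set v := z.2 + w t z.1
    set v' := z'.2 + w t z'.1
    set a := c.2 + fderiv ℝ (w t) z.1 c.1
    set a' := c.2 + fderiv ℝ (w t) z'.1 c.1
    have hY1 : 1 ≤ Y := by rw [hY]; linarith [norm_nonneg z.2, norm_nonneg z'.2]
    -- A common bound for both shifted velocities, since the drift has norm at most `C₂` and `Y ≥
    -- 1`.
    set m := (C₂ + 1) * Y with hm
    have hmpos : 0 < m := by positivity
    have hYC : C₂ ≤ C₂ * Y := le_mul_of_one_le_right hC₂ hY1
    have hv : ‖v‖ ≤ m := (norm_add_le _ _).trans (by rw [hm]; linarith [norm_nonneg z'.2])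
    have hv' : ‖v'‖ ≤ m := (norm_add_le _ _).trans (by rw [hm]; linarith [norm_nonneg z.2])
    have hvv : ‖v - v'‖ ≤ ‖z.2 - z'.2‖ + C₂ * ‖z.1 - z'.1‖ := by
      have : v - v' = (z.2 - z'.2) + (w t z.1 - w t z'.1) := by simp only [v, v']; abel
      rw [this]
      exact (norm_add_le _ _).trans (by gcongr)
    have ha : ‖a‖ ≤ ‖c.2‖ + C₂ * ‖c.1‖ :=
      (norm_add_le _ _).trans (by gcongr; exact ContinuousLinearMap.le_of_opNorm_le _ hw2 _)
    have haa : ‖a - a'‖ ≤ C₂ * ‖z.1 - z'.1‖ * ‖c.1‖ := by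
      have : a - a' = (fderiv ℝ (w t) z.1 - fderiv ℝ (w t) z'.1) c.1 := by
        simp only [a, a', _root_.sub_apply]; abel
      rw [this]
      exact ContinuousLinearMap.le_of_opNorm_le _ hw5 _
    have e1 := hN t ht z.1 hb z'.1 hb' v v' m hmpos hv hv' (c.1, a)
    -- Comparison with the velocity `0`, where the differential vanishes, bounds the effect of the
    -- vertical vector `a - a'` by `C₁ * ‖v'‖ * ‖a - a'‖`.
    have e2 := hN t ht z'.1 hb' z'.1 hb' v' 0 m hmpos hv' (by simpa using hmpos.le) (0, a - a')
    simp only [(h.hasFDerivAt_zero hU hRU ht hb').fderiv, sub_self, norm_zero, mul_zero, zero_add,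
      sub_zero, _root_.zero_apply] at e2
    have hsplit : fderiv ℝ (N t) (z.1, v) (c.1, a) - fderiv ℝ (N t) (z'.1, v') (c.1, a')
        = (fderiv ℝ (N t) (z.1, v) (c.1, a) - fderiv ℝ (N t) (z'.1, v') (c.1, a))
          + fderiv ℝ (N t) (z'.1, v') (0, a - a') := by
      have : ((0 : E), a - a') = (c.1, a) - (c.1, a') := by simp
      rw [this, map_sub]
      abel
    rw [hsplit]
    have hk1 : 1 ≤ k := by rw [hk]; linarith
    have f1 : m * ‖z.1 - z'.1‖ + ‖v - v'‖ ≤ k * (Y * ‖z.1 - z'.1‖ + ‖z.2 - z'.2‖) := by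
      have g1 : C₂ * ‖z.1 - z'.1‖ ≤ C₂ * Y * ‖z.1 - z'.1‖ := by gcongr
      have g2 : ‖z.2 - z'.2‖ ≤ k * ‖z.2 - z'.2‖ := le_mul_of_one_le_left (norm_nonneg _) hk1
      have g3 : k * (Y * ‖z.1 - z'.1‖) = m * ‖z.1 - z'.1‖ + C₂ * Y * ‖z.1 - z'.1‖ := by
        rw [hk, hm]; ring
      rw [mul_add, g3]
      linarith
    have f2 : m * ‖c.1‖ + ‖a‖ ≤ k * (Y * ‖c.1‖ + ‖c.2‖) := by
      have g1 : C₂ * ‖c.1‖ ≤ C₂ * Y * ‖c.1‖ := by gcongr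
      have g2 : ‖c.2‖ ≤ k * ‖c.2‖ := le_mul_of_one_le_left (norm_nonneg _) hk1
      have g3 : k * (Y * ‖c.1‖) = m * ‖c.1‖ + C₂ * Y * ‖c.1‖ := by
        rw [hk, hm]; ring
      rw [mul_add, g3]
      linarith
    have f3 : ‖v'‖ * ‖a - a'‖ ≤ (k * (Y * ‖z.1 - z'.1‖ + ‖z.2 - z'.2‖)) *
        (k * (Y * ‖c.1‖ + ‖c.2‖)) := by
      have g0 : m ≤ k * Y := by rw [hm, hk]; gcongr; linarith
      have g1 : C₂ ≤ k * Y := by nlinarith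
      have g2 : (0 : ℝ) ≤ ‖z.2 - z'.2‖ := norm_nonneg _
      have g3 : (0 : ℝ) ≤ ‖c.2‖ := norm_nonneg _
      calc ‖v'‖ * ‖a - a'‖ ≤ (k * Y) * ((k * Y) * ‖z.1 - z'.1‖ * ‖c.1‖) := by
            refine mul_le_mul (hv'.trans g0) (haa.trans ?_) (norm_nonneg _) (by positivity)
            gcongr
        _ = (k * (Y * ‖z.1 - z'.1‖)) * (k * (Y * ‖c.1‖)) := by ring
        _ ≤ _ := by
            gcongr
            · linarith
            · linarith
    calc _ ≤ _ := abs_add_le _ _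
      _ ≤ C₁ * (m * ‖z.1 - z'.1‖ + ‖v - v'‖) * (m * ‖c.1‖ + ‖a‖) + C₁ * ‖v'‖ * ‖a - a'‖ :=
          add_le_add e1 e2
      _ ≤ C₁ * (k * (Y * ‖z.1 - z'.1‖ + ‖z.2 - z'.2‖)) * (k * (Y * ‖c.1‖ + ‖c.2‖)) +
          C₁ * ((k * (Y * ‖z.1 - z'.1‖ + ‖z.2 - z'.2‖)) * (k * (Y * ‖c.1‖ + ‖c.2‖))) := by
          rw [mul_assoc C₁ ‖v'‖]
          gcongr
      _ = _ := by ring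
  · refine ((h.continuousOn hU hRU).comp (hshear.continuousOn.mono hsub) hmaps).congr fun p hp => ?_
    exact hG p.1 hp.1 p.2 (hsub hp).2.1
  · have h1 := (h.continuousOn_fderiv hU hRU).comp (hshear.continuousOn.mono hsub) hmaps
    have h2 : ContinuousOn (fun p : ℝ × (E × E) => fderiv ℝ (w p.1) p.2.1)
        (Icc (0 : ℝ) 1 ×ˢ (Metric.ball (0 : E) (min r₁ R) ×ˢ univ)) :=
      (contDiffOn_fderiv_Icc_prod hU hw).continuousOn.comp
        (f := fun p : ℝ × (E × E) => (p.1, p.2.1)) (by fun_prop) fun p hp => ⟨hp.1, (hsub hp).2.1⟩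
    have h3 : ContinuousOn (fun p : ℝ × (E × E) => (ContinuousLinearMap.fst ℝ E E).prod
        (ContinuousLinearMap.snd ℝ E E + (fderiv ℝ (w p.1) p.2.1).comp
          (ContinuousLinearMap.fst ℝ E E)))
        (Icc (0 : ℝ) 1 ×ˢ (Metric.ball (0 : E) (min r₁ R) ×ˢ univ)) := by
      refine ((continuousOn_const (c := ContinuousLinearMap.id ℝ (E × E))).add
        ((continuousOn_const (c := ContinuousLinearMap.inr ℝ E E)).clm_comp
          (h2.clm_comp (continuousOn_const (c := ContinuousLinearMap.fst ℝ E E))))).congr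
          fun p _ => ?_
      ext c <;> simp
    exact (h1.clm_comp h3).congr fun p hp =>
      (hDG p.1 hp.1 p.2 (hlt (mem_ball_zero_iff.1 hp.2.1))).fderiv
  · refine (h.smooth.comp (hshear.mono fun p hp => ?_) fun p hp => ?_).congr fun p hp => ?_
    · exact hsub ⟨hp.1, hp.2.1, trivial⟩
    · refine ⟨hp.1, (hsub ⟨hp.1, hp.2.1, trivial⟩).2.1, ?_⟩
      exact hne p.1 hp.1 p.2.1 p.2.2
        ((mem_ball_zero_iff.1 hp.2.1).trans_le (min_le_left _ _))
        ((mem_ball_zero_iff.1 hp.2.2).trans_le (min_le_left _ _))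
    · exact hG p.1 hp.1 p.2 (hsub ⟨hp.1, hp.2.1, trivial⟩).2.1

end Quadratic

/-! ### Curves in `H¹₀` -/

section Curves

variable {n : ℕ}

theorem memLp_H10vel (x : H10 n) : MemLp (H10vel x) 2 vol01 :=
  Lp.memLp (x : Lp (Eucl n) 2 vol01)

theorem integrable_H10vel (x : H10 n) : Integrable (H10vel x) vol01 :=
  (memLp_H10vel x).integrable (by norm_num)

theorem H10vel_add (x y : H10 n) : H10vel (x + y) =ᵐ[vol01] fun t => H10vel x t + H10vel y t :=
  Lp.coeFn_add (x : Lp (Eucl n) 2 vol01) (y : Lp (Eucl n) 2 vol01)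

theorem H10vel_sub (x y : H10 n) : H10vel (x - y) =ᵐ[vol01] fun t => H10vel x t - H10vel y t :=
  Lp.coeFn_sub (x : Lp (Eucl n) 2 vol01) (y : Lp (Eucl n) 2 vol01)

theorem H10vel_smul (a : ℝ) (x : H10 n) : H10vel (a • x) =ᵐ[vol01] fun t => a • H10vel x t :=
  Lp.coeFn_smul a (x : Lp (Eucl n) 2 vol01)

theorem H10vel_zero : H10vel (0 : H10 n) =ᵐ[vol01] fun _ => 0 :=
  Lp.coeFn_zero (Eucl n) 2 vol01

theorem integral_norm_sq_H10vel (x : H10 n) : ∫ t, ‖H10vel x t‖ ^ 2 ∂vol01 = ‖x‖ ^ 2 := by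
  have h1 : ‖x‖ ^ 2 = inner ℝ (x : Lp (Eucl n) 2 vol01) (x : Lp (Eucl n) 2 vol01) := by
    rw [real_inner_self_eq_norm_sq]
    rfl
  rw [h1, L2.inner_def]
  refine integral_congr_ae (Eventually.of_forall fun t => ?_)
  simp [H10vel]

theorem integrable_norm_sq_H10vel (x : H10 n) :
    Integrable (fun t => ‖H10vel x t‖ ^ 2) vol01 :=
  (memLp_H10vel x).integrable_norm_pow two_ne_zero

theorem H10curve_eq_setIntegral (x : H10 n) {t : ℝ} (ht : t ∈ Icc (0 : ℝ) 1) :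
    H10curve x t = ∫ s in Icc 0 t, H10vel x s ∂vol01 := by
  rw [H10curve, intervalIntegral.integral_of_le ht.1, ← integral_Icc_eq_integral_Ioc,
    Measure.restrict_restrict measurableSet_Icc, Icc_inter_Icc, max_self, min_eq_left ht.2]

theorem H10curve_add (x y : H10 n) {t : ℝ} (ht : t ∈ Icc (0 : ℝ) 1) :
    H10curve (x + y) t = H10curve x t + H10curve y t := by
  rw [H10curve_eq_setIntegral _ ht, H10curve_eq_setIntegral _ ht, H10curve_eq_setIntegral _ ht,
    ← integral_add (integrable_H10vel x).integrableOn (integrable_H10vel y).integrableOn]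
  exact integral_congr_ae (ae_restrict_of_ae (H10vel_add x y))

theorem H10curve_smul (a : ℝ) (x : H10 n) {t : ℝ} (ht : t ∈ Icc (0 : ℝ) 1) :
    H10curve (a • x) t = a • H10curve x t := by
  rw [H10curve_eq_setIntegral _ ht, H10curve_eq_setIntegral _ ht, ← integral_smul]
  exact integral_congr_ae (ae_restrict_of_ae (H10vel_smul a x))

theorem H10curve_sub (x y : H10 n) {t : ℝ} (ht : t ∈ Icc (0 : ℝ) 1) :
    H10curve (x - y) t = H10curve x t - H10curve y t := by
  have h := H10curve_add (x - y) y ht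
  rw [sub_add_cancel] at h
  rw [h, add_sub_cancel_right]

theorem H10curve_zero {t : ℝ} (ht : t ∈ Icc (0 : ℝ) 1) : H10curve (0 : H10 n) t = 0 := by
  have := H10curve_smul 0 (0 : H10 n) ht
  simpa using this

theorem H10curve_start (x : H10 n) : H10curve x 0 = 0 := by
  simp [H10curve]

theorem H10curve_end (x : H10 n) : H10curve x 1 = 0 := by
  rw [H10curve_eq_setIntegral _ ⟨zero_le_one, le_rfl⟩,
    Measure.restrict_restrict measurableSet_Icc, inter_self]
  exact x.2

/-- The Cauchy–Schwarz inequality. -/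
theorem integral_mul_le_mul {f g : ℝ → ℝ} (hf : MemLp f 2 vol01) (hg : MemLp g 2 vol01) {a b : ℝ}
    (ha : 0 ≤ a) (hb : 0 ≤ b) (hfa : ∫ t, f t ^ 2 ∂vol01 ≤ a ^ 2)
    (hgb : ∫ t, g t ^ 2 ∂vol01 ≤ b ^ 2) : ∫ t, f t * g t ∂vol01 ≤ a * b := by
  have key : ∀ {f : ℝ → ℝ} (hf : MemLp f 2 vol01) {a : ℝ}, 0 ≤ a →
      ∫ t, f t ^ 2 ∂vol01 ≤ a ^ 2 → ‖hf.toLp f‖ ≤ a := by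
    intro f hf a ha hfa
    refine le_of_sq_le_sq ?_ ha
    rw [← real_inner_self_eq_norm_sq, L2.inner_def]
    refine le_trans (le_of_eq (integral_congr_ae ?_)) hfa
    filter_upwards [hf.coeFn_toLp] with t ht
    rw [ht]
    simp [pow_two]
  have h1 := real_inner_le_norm (hf.toLp f) (hg.toLp g)
  rw [L2.inner_def] at h1
  have h2 : ∫ t, inner ℝ (hf.toLp f t) (hg.toLp g t) ∂vol01 = ∫ t, f t * g t ∂vol01 := by
    refine integral_congr_ae ?_
    filter_upwards [hf.coeFn_toLp, hg.coeFn_toLp] with t h3 h4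
    rw [h3, h4]
    simp [mul_comm]
  rw [h2] at h1
  exact h1.trans (mul_le_mul (key hf ha hfa) (key hg hb hgb) (norm_nonneg _) ha)

/-- Cauchy–Schwarz against the indicator of `[s,t]`. This Hölder estimate yields both the embedding
in the supremum norm and the sampling inequality. -/
theorem norm_H10curve_sub_le (x : H10 n) {s t : ℝ} (hs : 0 ≤ s) (hst : s ≤ t) (ht : t ≤ 1) :
    ‖H10curve x t - H10curve x s‖ ≤ Real.sqrt (t - s) * ‖x‖ := by
  have hinteg : IntervalIntegrable (H10vel x) volume 0 1 := intervalIntegrable_of_memLp (memLp_H10vel x)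
  have hi : ∀ c ∈ Icc (0 : ℝ) 1, IntervalIntegrable (H10vel x) volume 0 c := fun c hc =>
    hinteg.mono_set (uIcc_subset_uIcc (by simp) (by rw [uIcc_of_le zero_le_one]; exact hc))
  rw [H10curve, H10curve, intervalIntegral.integral_interval_sub_left
    (hi t ⟨hs.trans hst, ht⟩) (hi s ⟨hs, hst.trans ht⟩),
    intervalIntegral.integral_of_le hst, ← integral_Icc_eq_integral_Ioc]
  refine (norm_integral_le_integral_norm _).trans ?_
  have hsub : Icc s t ⊆ Icc (0 : ℝ) 1 := Icc_subset_Icc hs ht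
  have h1 : ∫ u in Icc s t, ‖H10vel x u‖ = ∫ u, (Icc s t).indicator 1 u * ‖H10vel x u‖ ∂vol01 := by
    have h2 : ∀ u, (Icc s t).indicator (1 : ℝ → ℝ) u * ‖H10vel x u‖
        = (Icc s t).indicator (fun u => ‖H10vel x u‖) u := fun u => by
      by_cases hu : u ∈ Icc s t <;> simp [hu]
    simp only [h2]
    rw [integral_indicator measurableSet_Icc, Measure.restrict_restrict measurableSet_Icc,
      inter_eq_left.2 hsub]
  rw [h1]
  refine integral_mul_le_mul ?_ (memLp_H10vel x).norm (Real.sqrt_nonneg _) (norm_nonneg _) ?_ ?_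
  · exact (memLp_const (1 : ℝ)).indicator measurableSet_Icc
  · have h2 : ∀ u, (Icc s t).indicator (1 : ℝ → ℝ) u ^ 2 = (Icc s t).indicator 1 u := fun u => by
      by_cases hu : u ∈ Icc s t <;> simp [hu]
    simp only [h2]
    rw [integral_indicator measurableSet_Icc, Measure.restrict_restrict measurableSet_Icc,
      inter_eq_left.2 hsub, Real.sq_sqrt (by linarith)]
    simp [hst]
  · rw [integral_norm_sq_H10vel]

theorem norm_H10curve_le (x : H10 n) {t : ℝ} (ht : t ∈ Icc (0 : ℝ) 1) : ‖H10curve x t‖ ≤ ‖x‖ := by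
  have h1 := norm_H10curve_sub_le x le_rfl ht.1 ht.2
  rw [H10curve_start, sub_zero, sub_zero] at h1
  refine h1.trans (mul_le_of_le_one_left (norm_nonneg _) ?_)
  exact Real.sqrt_le_one.2 ht.2

theorem continuousOn_H10curve (x : H10 n) : ContinuousOn (H10curve x) (Icc 0 1) := by
  have := (absolutelyContinuous_integral (intervalIntegrable_of_memLp (memLp_H10vel x))).continuousOn
  rwa [uIcc_of_le zero_le_one] at this

/-- The integral is continuous on `L²([0,1])`, so the condition of mean zero is closed. -/
instance : CompleteSpace (H10 n) := by
  have h : IsClosed (H10 n : Set (Lp (Eucl n) 2 vol01)) := by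
    have h1 : Continuous fun v : Lp (Eucl n) 2 vol01 => ∫ t, v t ∂vol01 := by
      refine LipschitzWith.continuous (K := 1) (LipschitzWith.of_dist_le_mul fun v w => ?_)
      have hi : ∀ u : Lp (Eucl n) 2 vol01, Integrable u vol01 := fun u =>
        (Lp.memLp u).integrable (by norm_num)
      rw [dist_eq_norm, ← integral_sub (hi v) (hi w), dist_eq_norm, NNReal.coe_one, one_mul]
      have h2 : ∫ t, (v t - w t) ∂vol01 = ∫ t, (v - w) t ∂vol01 :=
        integral_congr_ae (Lp.coeFn_sub v w).symm
      rw [h2]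
      refine (norm_integral_le_integral_norm _).trans ?_
      have h3 := integral_mul_le_mul (Lp.memLp (v - w)).norm (memLp_const (1 : ℝ))
        (norm_nonneg (v - w)) zero_le_one ?_ (by simp)
      · simpa using h3
      · rw [← real_inner_self_eq_norm_sq (v - w), L2.inner_def]
        simp
    exact isClosed_eq h1 continuous_const
  exact h.completeSpace_coe

/-- The evaluation of curves at a time in `[0,1]`. -/
noncomputable def H10eval (t : ℝ) (ht : t ∈ Icc (0 : ℝ) 1) : H10 n →L[ℝ] Eucl n :=
  LinearMap.mkContinuous
    { toFun := fun x => H10curve x t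
      map_add' := fun x y => H10curve_add x y ht
      map_smul' := fun a x => H10curve_smul a x ht } 1
    fun x => by simpa using norm_H10curve_le x ht

@[simp]
theorem H10eval_apply {t : ℝ} (ht : t ∈ Icc (0 : ℝ) 1) (x : H10 n) :
    H10eval t ht x = H10curve x t := rfl

/-- Curves are controlled in the supremum norm by finitely many values up to a small error. -/
theorem exists_sampling (n : ℕ) {k : ℕ} (hk : 0 < k) :
    ∃ L : H10 n →L[ℝ] (Fin k → Eucl n), ∀ x, ∀ t ∈ Icc (0 : ℝ) 1,
      ‖H10curve x t‖ ^ 2 ≤ 2 * ‖L x‖ ^ 2 + 2 / k * ‖x‖ ^ 2 := by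
  have hk' : (0 : ℝ) < k := by exact_mod_cast hk
  have hgrid : ∀ i : Fin k, ((i : ℕ) : ℝ) / k ∈ Icc (0 : ℝ) 1 := fun i =>
    ⟨by positivity, (div_le_one hk').2 (by exact_mod_cast i.2.le)⟩
  let L : H10 n →L[ℝ] (Fin k → Eucl n) :=
    ContinuousLinearMap.pi fun i : Fin k => H10eval (((i : ℕ) : ℝ) / k) (hgrid i)
  refine ⟨L, fun x t ht => ?_⟩
  -- The grid point just to the left of `t`. The grid ends at `(k - 1) / k`, so `t = 1` is treated
  -- apart.
  obtain ⟨i, hi1, hi2⟩ : ∃ i : Fin k, ((i : ℕ) : ℝ) / k ≤ t ∧ t - ((i : ℕ) : ℝ) / k ≤ 1 / k := by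
    rcases eq_or_lt_of_le ht.2 with rfl | ht1
    · refine ⟨⟨k - 1, by omega⟩, (hgrid _).2, ?_⟩
      have : ((k - 1 : ℕ) : ℝ) = k - 1 := by
        rw [Nat.cast_sub hk]; simp
      simp only [this]
      rw [sub_div, div_self hk'.ne']
      linarith
    · have h1 : ⌊t * k⌋₊ < k := by
        rw [Nat.floor_lt (by have := ht.1; positivity)]
        nlinarith
      refine ⟨⟨⌊t * k⌋₊, h1⟩, ?_, ?_⟩
      · rw [div_le_iff₀ hk']
        exact Nat.floor_le (by have := ht.1; positivity)
      · have h2 := Nat.lt_floor_add_one (t * k)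
        rw [sub_le_iff_le_add, ← add_div, le_div_iff₀ hk']
        simp only
        linarith
  have h1 := norm_H10curve_sub_le x (hgrid i).1 hi1 ht.2
  have h2 : ‖H10curve x (((i : ℕ) : ℝ) / k)‖ ≤ ‖L x‖ := norm_le_pi_norm (L x) i
  have h3 : ‖H10curve x t‖ ≤ ‖H10curve x (((i : ℕ) : ℝ) / k)‖
      + Real.sqrt (t - ((i : ℕ) : ℝ) / k) * ‖x‖ := by
    have := norm_le_insert' (H10curve x t) (H10curve x (((i : ℕ) : ℝ) / k))
    linarith
  set A := ‖L x‖
  set S := Real.sqrt (t - ((i : ℕ) : ℝ) / k) * ‖x‖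
  have hS : S ^ 2 ≤ 1 / k * ‖x‖ ^ 2 := by
    simp only [S]
    rw [mul_pow, Real.sq_sqrt (by linarith)]
    gcongr
  calc ‖H10curve x t‖ ^ 2 ≤ (A + S) ^ 2 := by gcongr; linarith
    _ ≤ 2 * A ^ 2 + 2 * S ^ 2 := by nlinarith [sq_nonneg (A - S)]
    _ ≤ 2 * A ^ 2 + 2 * (1 / k * ‖x‖ ^ 2) := by gcongr
    _ = _ := by ring

end Curves

/-! ### The action of a Lagrangian of quadratic growth -/

section L2Bounds

/-- `f` is in `L²([0,1])` with norm at most `a`. -/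
structure HasL2Bound (f : ℝ → ℝ) (a : ℝ) : Prop where
  memLp : MemLp f 2 vol01
  nonneg : 0 ≤ a
  integral_le : ∫ t, f t ^ 2 ∂vol01 ≤ a ^ 2

namespace HasL2Bound

variable {f g : ℝ → ℝ} {a b : ℝ}

theorem integrable_mul (hf : HasL2Bound f a) (hg : HasL2Bound g b) :
    Integrable (fun t => f t * g t) vol01 :=
  hf.memLp.integrable_mul hg.memLp

theorem integral_mul_le (hf : HasL2Bound f a) (hg : HasL2Bound g b) :
    ∫ t, f t * g t ∂vol01 ≤ a * b :=
  integral_mul_le_mul hf.memLp hg.memLp hf.nonneg hg.nonneg hf.integral_le hg.integral_le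

theorem integrable (hf : HasL2Bound f a) : Integrable f vol01 :=
  hf.memLp.integrable (by norm_num)

theorem add (hf : HasL2Bound f a) (hg : HasL2Bound g b) :
    HasL2Bound (fun t => f t + g t) (a + b) := by
  refine ⟨hf.memLp.add hg.memLp, add_nonneg hf.nonneg hg.nonneg, ?_⟩
  have h1 : ∀ t, (f t + g t) ^ 2 = f t ^ 2 + 2 * (f t * g t) + g t ^ 2 := fun t => by ring
  simp only [h1]
  have hf2 : Integrable (fun t => f t ^ 2) vol01 := hf.memLp.integrable_sq
  have hg2 : Integrable (fun t => g t ^ 2) vol01 := hg.memLp.integrable_sq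
  have hfg := (hf.integrable_mul hg).const_mul 2
  have hsum : Integrable (fun t => f t ^ 2 + 2 * (f t * g t)) vol01 := hf2.add hfg
  rw [integral_add hsum hg2, integral_add hf2 hfg, integral_const_mul]
  have := hf.integral_mul_le hg
  have h2 := hf.integral_le
  have h3 := hg.integral_le
  nlinarith

theorem const_mul (hf : HasL2Bound f a) {c : ℝ} (hc : 0 ≤ c) :
    HasL2Bound (fun t => c * f t) (c * a) := by
  refine ⟨hf.memLp.const_mul c, mul_nonneg hc hf.nonneg, ?_⟩
  simp only [mul_pow]
  rw [integral_const_mul]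
  gcongr
  exact hf.integral_le

theorem mul_const (hf : HasL2Bound f a) {c : ℝ} (hc : 0 ≤ c) :
    HasL2Bound (fun t => f t * c) (a * c) := by
  simpa only [mul_comm] using hf.const_mul hc

theorem mono (hf : HasL2Bound f a) (hab : a ≤ b) : HasL2Bound f b :=
  ⟨hf.memLp, hf.nonneg.trans hab, hf.integral_le.trans (by have := hf.nonneg; gcongr)⟩

theorem one : HasL2Bound (fun _ => 1) 1 :=
  ⟨memLp_const 1, zero_le_one, by simp⟩

theorem vel {n : ℕ} (x : H10 n) : HasL2Bound (fun t => ‖H10vel x t‖) ‖x‖ :=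
  ⟨(memLp_H10vel x).norm, norm_nonneg x, (integral_norm_sq_H10vel x).le⟩

end HasL2Bound

end L2Bounds

/-! ### Positions and velocities of curves, and measurability -/

section Pairs

variable {n : ℕ}

/-- Position and velocity of a curve. -/
noncomputable def H10pair (x : H10 n) (t : ℝ) : Eucl n × Eucl n := (H10curve x t, H10vel x t)

theorem ae_mem_Icc : ∀ᵐ t ∂vol01, t ∈ Icc (0 : ℝ) 1 := ae_restrict_mem measurableSet_Icc

theorem H10pair_add (x y : H10 n) :
    ∀ᵐ t ∂vol01, H10pair (x + y) t = H10pair x t + H10pair y t := by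
  filter_upwards [ae_mem_Icc, H10vel_add x y] with t ht h
  simp [H10pair, H10curve_add x y ht, h]

theorem H10pair_smul (a : ℝ) (x : H10 n) :
    ∀ᵐ t ∂vol01, H10pair (a • x) t = a • H10pair x t := by
  filter_upwards [ae_mem_Icc, H10vel_smul a x] with t ht h
  simp [H10pair, H10curve_smul a x ht, h]

theorem H10pair_zero : ∀ᵐ t ∂vol01, H10pair (0 : H10 n) t = 0 := by
  filter_upwards [ae_mem_Icc, H10vel_zero (n := n)] with t ht h
  simp [H10pair, H10curve_zero ht, h]

theorem aestronglyMeasurable_H10pair (x : H10 n) : AEStronglyMeasurable (H10pair x) vol01 :=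
  ((continuousOn_H10curve x).aestronglyMeasurable measurableSet_Icc).prodMk
    (memLp_H10vel x).aestronglyMeasurable

theorem norm_H10pair_le (x : H10 n) {t : ℝ} (ht : t ∈ Icc (0 : ℝ) 1) :
    ‖H10pair x t‖ ≤ ‖x‖ + ‖H10vel x t‖ := by
  refine max_le ?_ ?_
  · exact (norm_H10curve_le x ht).trans (le_add_of_nonneg_right (norm_nonneg _))
  · exact le_add_of_nonneg_left (norm_nonneg _)

theorem HasL2Bound.pair (x : H10 n) :
    HasL2Bound (fun t => ‖x‖ + ‖H10vel x t‖) (2 * ‖x‖) := by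
  have := (HasL2Bound.one.const_mul (norm_nonneg x)).add (HasL2Bound.vel x)
  simpa [two_mul] using this

/-- Superposition with a function that is continuous on a measurable set. -/
theorem aestronglyMeasurable_comp_of_continuousOn {X : Type*} [TopologicalSpace X]
    [MeasurableSpace X] [BorelSpace X] [TopologicalSpace.PseudoMetrizableSpace X] {f : X → ℝ}
    {S : Set X} (hS : MeasurableSet S) (hf : ContinuousOn f S) {g : ℝ → X}
    (hg : AEStronglyMeasurable g vol01) (hgS : ∀ᵐ t ∂vol01, g t ∈ S) :
    AEStronglyMeasurable (fun t => f (g t)) vol01 := by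
  classical
  have h1 : Measurable (S.piecewise f 0) := hf.measurable_piecewise continuousOn_const hS
  have h2 := (h1.comp_aemeasurable hg.aemeasurable).aestronglyMeasurable
  refine h2.congr ?_
  filter_upwards [hgS] with t ht
  exact Set.piecewise_eq_of_mem S f 0 ht

end Pairs

/-! ### The first variation of the action -/

namespace IsQuadraticLagrangian

variable {n : ℕ} {G : ℝ → Eucl n × Eucl n → ℝ} {r C : ℝ}

theorem aestronglyMeasurable (hG : IsQuadraticLagrangian G r C) {z : ℝ → Eucl n × Eucl n}
    (hz : AEStronglyMeasurable z vol01) (hzr : ∀ᵐ t ∂vol01, ‖(z t).1‖ < r) :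
    AEStronglyMeasurable (fun t => G t (z t)) vol01 := by
  refine aestronglyMeasurable_comp_of_continuousOn (X := ℝ × (Eucl n × Eucl n))
    (f := fun p => G p.1 p.2) (g := fun t => (t, z t)) ?_ hG.continuousOn
    (aestronglyMeasurable_id.prodMk hz) ?_
  · exact measurableSet_Icc.prod (measurableSet_ball.prod MeasurableSet.univ)
  · filter_upwards [ae_mem_Icc, hzr] with t ht h
    exact ⟨ht, mem_ball_zero_iff.2 h, trivial⟩

theorem aestronglyMeasurable_fderiv (hG : IsQuadraticLagrangian G r C)
    {z c : ℝ → Eucl n × Eucl n} (hz : AEStronglyMeasurable z vol01)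
    (hc : AEStronglyMeasurable c vol01) (hzr : ∀ᵐ t ∂vol01, ‖(z t).1‖ < r) :
    AEStronglyMeasurable (fun t => fderiv ℝ (G t) (z t) (c t)) vol01 := by
  refine aestronglyMeasurable_comp_of_continuousOn
    (X := (ℝ × (Eucl n × Eucl n)) × (Eucl n × Eucl n))
    (f := fun p => fderiv ℝ (G p.1.1) p.1.2 p.2) (g := fun t => ((t, z t), c t))
    (S := (Icc 0 1 ×ˢ (Metric.ball (0 : Eucl n) r ×ˢ univ)) ×ˢ univ) ?_ ?_
    ((aestronglyMeasurable_id.prodMk hz).prodMk hc) ?_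
  · exact (measurableSet_Icc.prod (measurableSet_ball.prod MeasurableSet.univ)).prod
      MeasurableSet.univ
  · exact (hG.continuousOn_fderiv.comp continuousOn_fst fun p hp => hp.1).clm_apply continuousOn_snd
  · filter_upwards [ae_mem_Icc, hzr] with t ht h
    exact ⟨⟨ht, mem_ball_zero_iff.2 h, trivial⟩, trivial⟩

theorem ae_norm_curve_lt {x : H10 n} (hx : ‖x‖ < r) : ∀ᵐ t ∂vol01, ‖(H10pair x t).1‖ < r := by
  filter_upwards [ae_mem_Icc] with t ht
  exact (norm_H10curve_le x ht).trans_lt hx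

/-- The weights, which contain velocities, multiply position differences only, and these are bounded
in the supremum norm by the `H¹` norm. So the right-hand side is a product of two `L²` functions,
ready for Cauchy–Schwarz. -/
theorem ae_abs_fderiv_sub_le (hG : IsQuadraticLagrangian G r C) {x y : H10 n} (hx : ‖x‖ < r)
    (hy : ‖y‖ < r) (η : H10 n) :
    ∀ᵐ t ∂vol01, |fderiv ℝ (G t) (H10pair x t) (H10pair η t)
        - fderiv ℝ (G t) (H10pair y t) (H10pair η t)| ≤
      C * (((1 + ‖H10vel x t‖ + ‖H10vel y t‖) * ‖x - y‖ + ‖H10vel (x - y) t‖) *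
        ((1 + ‖H10vel x t‖ + ‖H10vel y t‖) * ‖η‖ + ‖H10vel η t‖)) := by
  filter_upwards [ae_mem_Icc, H10vel_sub x y, ae_norm_curve_lt hx, ae_norm_curve_lt hy]
    with t ht hv hxt hyt
  have h1 := hG.lipschitz t ht (H10pair x t) (H10pair y t) hxt hyt (H10pair η t)
  have h2 : ‖(H10pair x t).1 - (H10pair y t).1‖ ≤ ‖x - y‖ := by
    simp only [H10pair]
    rw [← H10curve_sub x y ht]
    exact norm_H10curve_le _ ht
  have h3 : ‖(H10pair η t).1‖ ≤ ‖η‖ := norm_H10curve_le η ht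
  have hC := hG.C_nonneg
  rw [hv, ← mul_assoc]
  refine h1.trans ?_
  simp only [H10pair] at h2 h3 ⊢
  gcongr

/-- The constant is `(1 + 1 + 1) + 1`, by the triangle inequality in `L²`. -/
theorem hasL2Bound_weight (x y : H10 n) (hx : ‖x‖ ≤ 1) (hy : ‖y‖ ≤ 1) (δ : H10 n) :
    HasL2Bound (fun t => (1 + ‖H10vel x t‖ + ‖H10vel y t‖) * ‖δ‖ + ‖H10vel δ t‖) (4 * ‖δ‖) := by
  have h1 := (((HasL2Bound.one.add (HasL2Bound.vel x)).add (HasL2Bound.vel y)).mul_const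
    (norm_nonneg δ)).add (HasL2Bound.vel δ)
  refine h1.mono ?_
  nlinarith [norm_nonneg δ]

theorem exists_bound_fderiv_zero (hG : IsQuadraticLagrangian G r C) :
    ∃ C₀ : ℝ, 0 ≤ C₀ ∧ ∀ t ∈ Icc (0 : ℝ) 1, |G t 0| ≤ C₀ ∧ ‖fderiv ℝ (G t) 0‖ ≤ C₀ := by
  have hK : IsCompact (Icc (0 : ℝ) 1 ×ˢ {(0 : Eucl n × Eucl n)}) :=
    isCompact_Icc.prod isCompact_singleton
  have hsub : Icc (0 : ℝ) 1 ×ˢ {(0 : Eucl n × Eucl n)} ⊆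
      Icc 0 1 ×ˢ (Metric.ball (0 : Eucl n) r ×ˢ univ) := by
    rintro ⟨t, z⟩ ⟨ht, hz⟩
    have hz0 : z = 0 := hz
    subst hz0
    exact ⟨ht, by simpa using hG.r_pos, trivial⟩
  obtain ⟨C₀, hC₀⟩ := hK.exists_bound_of_continuousOn (hG.continuousOn.mono hsub)
  obtain ⟨C₁, hC₁⟩ := hK.exists_bound_of_continuousOn (hG.continuousOn_fderiv.mono hsub)
  refine ⟨max C₀ C₁, ?_, fun t ht => ⟨(hC₀ (t, 0) ⟨ht, rfl⟩).trans (le_max_left _ _),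
    (hC₁ (t, 0) ⟨ht, rfl⟩).trans (le_max_right _ _)⟩⟩
  exact ((norm_nonneg _).trans (hC₀ (0, 0) ⟨by simp, rfl⟩)).trans (le_max_left _ _)

/-- Comparison with the zero curve, along which the differential of `G t` is bounded uniformly in
`t`. -/
theorem integrable_fderiv (hG : IsQuadraticLagrangian G r C) {x : H10 n} (hx : ‖x‖ < r)
    (hx1 : ‖x‖ ≤ 1) (η : H10 n) :
    Integrable (fun t => fderiv ℝ (G t) (H10pair x t) (H10pair η t)) vol01 := by
  obtain ⟨C₀, hC₀, hb⟩ := hG.exists_bound_fderiv_zero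
  have h0 : ‖(0 : H10 n)‖ ≤ 1 := by simp
  have hw1 := hasL2Bound_weight x 0 hx1 h0 (x - 0)
  have hw2 := hasL2Bound_weight x 0 hx1 h0 η
  have hI : Integrable (fun t => C₀ * (‖η‖ + ‖H10vel η t‖)) vol01 :=
    (HasL2Bound.pair η).integrable.const_mul C₀
  refine (hI.add ((hw1.integrable_mul hw2).const_mul C)).mono'
    (hG.aestronglyMeasurable_fderiv (aestronglyMeasurable_H10pair x)
      (aestronglyMeasurable_H10pair η) (ae_norm_curve_lt hx)) ?_
  filter_upwards [ae_mem_Icc, hG.ae_abs_fderiv_sub_le (y := 0) hx (by simpa using hG.r_pos) η,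
    H10pair_zero (n := n)] with t ht h1 h2
  rw [h2] at h1
  have h3 : |fderiv ℝ (G t) 0 (H10pair η t)| ≤ C₀ * (‖η‖ + ‖H10vel η t‖) :=
    (ContinuousLinearMap.le_of_opNorm_le _ (hb t ht).2 _).trans (by gcongr; exact norm_H10pair_le η ht)
  rw [Real.norm_eq_abs, Pi.add_apply]
  have h4 := abs_sub_abs_le_abs_sub (fderiv ℝ (G t) (H10pair x t) (H10pair η t))
    (fderiv ℝ (G t) 0 (H10pair η t))
  linarith

/-- The differential of the action. -/
theorem exists_differential (hG : IsQuadraticLagrangian G r C) (x : H10 n) (hx : ‖x‖ < r)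
    (hx1 : ‖x‖ ≤ 1) : ∃ D : H10 n →L[ℝ] ℝ, ∀ η,
      D η = 1 / 2 * ∫ t, fderiv ℝ (G t) (H10pair x t) (H10pair η t) ∂vol01 := by
  obtain ⟨C₀, hC₀, hb⟩ := hG.exists_bound_fderiv_zero
  have h0 : ‖(0 : H10 n)‖ ≤ 1 := by simp
  let D₀ : H10 n →ₗ[ℝ] ℝ :=
    { toFun := fun η => 1 / 2 * ∫ t, fderiv ℝ (G t) (H10pair x t) (H10pair η t) ∂vol01
      map_add' := fun η θ => by
        rw [← mul_add, ← integral_add (hG.integrable_fderiv hx hx1 η)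
          (hG.integrable_fderiv hx hx1 θ)]
        congr 1
        refine integral_congr_ae ?_
        filter_upwards [H10pair_add η θ] with t ht
        rw [ht, map_add]
      map_smul' := fun a η => by
        have : ∫ t, fderiv ℝ (G t) (H10pair x t) (H10pair (a • η) t) ∂vol01
            = a * ∫ t, fderiv ℝ (G t) (H10pair x t) (H10pair η t) ∂vol01 := by
          rw [← integral_const_mul]
          refine integral_congr_ae ?_
          filter_upwards [H10pair_smul a η] with t ht
          rw [ht, map_smul, smul_eq_mul]
        rw [this, RingHom.id_apply, smul_eq_mul]
        ring }
  refine ⟨D₀.mkContinuous (2 * C₀ + C * (4 * ‖x - 0‖) * 4) fun η => ?_, fun η => rfl⟩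
  have hw1 := hasL2Bound_weight x 0 hx1 h0 (x - 0)
  have hw2 := hasL2Bound_weight x 0 hx1 h0 η
  have hI : Integrable (fun t => C₀ * (‖η‖ + ‖H10vel η t‖)) vol01 :=
    (HasL2Bound.pair η).integrable.const_mul C₀
  have hle : ‖∫ t, fderiv ℝ (G t) (H10pair x t) (H10pair η t) ∂vol01‖ ≤
      (2 * C₀ + C * (4 * ‖x - 0‖) * 4) * ‖η‖ := by
    refine (norm_integral_le_of_norm_le (hI.add ((hw1.integrable_mul hw2).const_mul C)) ?_).trans ?_
    · filter_upwards [ae_mem_Icc, hG.ae_abs_fderiv_sub_le (y := 0) hx (by simpa using hG.r_pos) η,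
        H10pair_zero (n := n)] with t ht h1 h2
      rw [h2] at h1
      have h3 : |fderiv ℝ (G t) 0 (H10pair η t)| ≤ C₀ * (‖η‖ + ‖H10vel η t‖) :=
        (ContinuousLinearMap.le_of_opNorm_le _ (hb t ht).2 _).trans
          (by gcongr; exact norm_H10pair_le η ht)
      rw [Real.norm_eq_abs, Pi.add_apply]
      have h4 := abs_sub_abs_le_abs_sub (fderiv ℝ (G t) (H10pair x t) (H10pair η t))
        (fderiv ℝ (G t) 0 (H10pair η t))
      linarith
    · simp only [Pi.add_apply]
      rw [integral_add hI ((hw1.integrable_mul hw2).const_mul C), integral_const_mul,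
        integral_const_mul]
      have h5 := hw1.integral_mul_le hw2
      have h6 := HasL2Bound.one.integral_mul_le (HasL2Bound.pair η)
      simp only [one_mul] at h6
      calc _ ≤ C₀ * (2 * ‖η‖) + C * (4 * ‖x - 0‖ * (4 * ‖η‖)) := by
            have := hG.C_nonneg
            gcongr
        _ = _ := by ring
  change ‖1 / 2 * ∫ t, fderiv ℝ (G t) (H10pair x t) (H10pair η t) ∂vol01‖ ≤ _
  rw [norm_mul]
  have : ‖(1 / 2 : ℝ)‖ ≤ 1 := by norm_num
  exact (mul_le_of_le_one_left (norm_nonneg _) this).trans hle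

/-- Two weights of `L²` norm at most `4 * ‖x - y‖` and `4 * ‖η‖` account for the constant `16`. -/
theorem norm_differential_sub_le (hG : IsQuadraticLagrangian G r C) {x y : H10 n} (hx : ‖x‖ < r)
    (hx1 : ‖x‖ ≤ 1) (hy : ‖y‖ < r) (hy1 : ‖y‖ ≤ 1) {D D' : H10 n →L[ℝ] ℝ}
    (hD : ∀ η, D η = 1 / 2 * ∫ t, fderiv ℝ (G t) (H10pair x t) (H10pair η t) ∂vol01)
    (hD' : ∀ η, D' η = 1 / 2 * ∫ t, fderiv ℝ (G t) (H10pair y t) (H10pair η t) ∂vol01) :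
    ‖D - D'‖ ≤ 16 * C * ‖x - y‖ := by
  have hC := hG.C_nonneg
  refine ContinuousLinearMap.opNorm_le_bound _ (by positivity) fun η => ?_
  rw [_root_.sub_apply, hD, hD', ← mul_sub, ← integral_sub (hG.integrable_fderiv hx hx1 η)
    (hG.integrable_fderiv hy hy1 η), norm_mul]
  have : ‖(1 / 2 : ℝ)‖ ≤ 1 := by norm_num
  refine (mul_le_of_le_one_left (norm_nonneg _) this).trans ?_
  have hw1 := hasL2Bound_weight x y hx1 hy1 (x - y)
  have hw2 := hasL2Bound_weight x y hx1 hy1 η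
  refine (norm_integral_le_of_norm_le ((hw1.integrable_mul hw2).const_mul C)
    (hG.ae_abs_fderiv_sub_le hx hy η)).trans ?_
  rw [integral_const_mul]
  calc _ ≤ C * (4 * ‖x - y‖ * (4 * ‖η‖)) := by
        gcongr
        exact hw1.integral_mul_le hw2
    _ = _ := by ring

end IsQuadraticLagrangian


section Generic

variable {Z : Type*} [NormedAddCommGroup Z] [NormedSpace ℝ Z]

theorem exists_norm_le_of_continuousOn_Icc {V : Type*} [NormedAddCommGroup V] {f : ℝ → V}
    (hf : ContinuousOn f (Icc 0 1)) : ∃ K : ℝ, 0 ≤ K ∧ ∀ t ∈ Icc (0 : ℝ) 1, ‖f t‖ ≤ K := by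
  obtain ⟨K, hK⟩ := isCompact_Icc.exists_bound_of_continuousOn hf
  exact ⟨K, (norm_nonneg _).trans (hK 0 (by simp)), hK⟩

theorem norm_apply_apply_le {A : Z →L[ℝ] Z →L[ℝ] ℝ} {K a a' : ℝ} (hA : ‖A‖ ≤ K) {c c' : Z}
    (hc : ‖c‖ ≤ a) (hc' : ‖c'‖ ≤ a') : ‖A c c'‖ ≤ K * (a * a') := by
  refine (A.le_opNorm₂ c c').trans ?_
  have hK0 : 0 ≤ K := (norm_nonneg A).trans hA
  have ha : 0 ≤ a := (norm_nonneg _).trans hc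
  rw [← mul_assoc]
  gcongr

theorem hasDerivAt_apply_smul {f : Z → Z →L[ℝ] ℝ} {f' : Z →L[ℝ] Z →L[ℝ] ℝ}
    (hf : HasFDerivAt f f' 0) (z c : Z) : HasDerivAt (fun s : ℝ => f (s • z) c) (f' z c) 0 := by
  have h1 : HasDerivAt (fun s : ℝ => s • z) z 0 := by
    simpa using (hasDerivAt_id (0 : ℝ)).smul_const z
  have h2 : HasFDerivAt (fun z => f z c) (f'.flip c) 0 := by
    have := hf.clm_apply (hasFDerivAt_const c (0 : Z))
    simpa using this
  exact h2.comp_hasDerivAt_of_eq 0 h1 (by simp)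

end Generic

/-! ### Fréchet differentiability and the second variation of the action -/

namespace IsQuadraticLagrangian

variable {n : ℕ} {G : ℝ → Eucl n × Eucl n → ℝ} {r C : ℝ}

/-- Mean value inequality for `s ↦ G t (z + s • ζ) - s * dG(z) ζ` on `[0,1]`; for `s ≤ 1` the
velocities in the weight are at most `‖z.2‖ + ‖ζ.2‖`. -/
theorem abs_taylor_le (hG : IsQuadraticLagrangian G r C) {t : ℝ} (ht : t ∈ Icc (0 : ℝ) 1)
    {z ζ : Eucl n × Eucl n} (hz : ‖z.1‖ < r) (hz' : ‖(z + ζ).1‖ < r) :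
    |G t (z + ζ) - G t z - fderiv ℝ (G t) z ζ| ≤
      C * ((1 + 2 * ‖z.2‖ + ‖ζ.2‖) * ‖ζ.1‖ + ‖ζ.2‖) ^ 2 := by
  have hC := hG.C_nonneg
  let f : ℝ → ℝ := fun s => G t (z + s • ζ) - s * fderiv ℝ (G t) z ζ
  have hmem : ∀ s ∈ Icc (0 : ℝ) 1, ‖(z + s • ζ).1‖ < r := by
    intro s hs
    have h1 := convex_ball (0 : Eucl n) r (mem_ball_zero_iff.2 hz) (mem_ball_zero_iff.2 hz')
      (sub_nonneg.2 hs.2) hs.1 (by ring)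
    have h2 : (1 - s) • z.1 + s • (z + ζ).1 = (z + s • ζ).1 := by
      simp only [Prod.fst_add, Prod.smul_fst]
      module
    rw [h2] at h1
    simpa using h1
  have hf : ∀ s ∈ Icc (0 : ℝ) 1, HasDerivWithinAt f
      (fderiv ℝ (G t) (z + s • ζ) ζ - fderiv ℝ (G t) z ζ) (Icc 0 1) s := by
    intro s hs
    have h1 : HasDerivAt (fun s : ℝ => z + s • ζ) ζ s := by
      simpa using ((hasDerivAt_id s).smul_const ζ).const_add z
    have h2 := (hG.differentiableAt t ht _ (hmem s hs)).hasFDerivAt.comp_hasDerivAt s h1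
    have h3 := h2.sub ((hasDerivAt_id s).mul_const (fderiv ℝ (G t) z ζ))
    rw [one_mul] at h3
    exact h3.hasDerivWithinAt
  have h := norm_image_sub_le_of_norm_deriv_le_segment_01' hf
    (C := C * ((1 + 2 * ‖z.2‖ + ‖ζ.2‖) * ‖ζ.1‖ + ‖ζ.2‖) ^ 2) fun s hs => ?_
  · simp only [f, one_smul, one_mul, zero_smul, add_zero, zero_mul, sub_zero,
      Real.norm_eq_abs] at h
    convert h using 2
    ring
  · rw [Real.norm_eq_abs]
    refine (hG.lipschitz t ht _ z (hmem s (Ico_subset_Icc_self hs)) hz ζ).trans ?_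
    have h1 : ‖(z + s • ζ).2‖ ≤ ‖z.2‖ + ‖ζ.2‖ := by
      simp only [Prod.snd_add, Prod.smul_snd]
      refine (norm_add_le _ _).trans ?_
      rw [norm_smul, Real.norm_of_nonneg hs.1]
      gcongr
      exact mul_le_of_le_one_left (norm_nonneg _) hs.2.le
    have h2 : ‖(z + s • ζ).1 - z.1‖ ≤ ‖ζ.1‖ := by
      simp only [Prod.fst_add, Prod.smul_fst, add_sub_cancel_left]
      rw [norm_smul, Real.norm_of_nonneg hs.1]
      exact mul_le_of_le_one_left (norm_nonneg _) hs.2.le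
    have h3 : ‖(z + s • ζ).2 - z.2‖ ≤ ‖ζ.2‖ := by
      simp only [Prod.snd_add, Prod.smul_snd, add_sub_cancel_left]
      rw [norm_smul, Real.norm_of_nonneg hs.1]
      exact mul_le_of_le_one_left (norm_nonneg _) hs.2.le
    have h4 : 1 + ‖(z + s • ζ).2‖ + ‖z.2‖ ≤ 1 + 2 * ‖z.2‖ + ‖ζ.2‖ := by linarith
    rw [pow_two, ← mul_assoc]
    gcongr

theorem hasL2Bound_taylor (x η : H10 n) (hx : ‖x‖ ≤ 1) (hη : ‖η‖ ≤ 2) :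
    HasL2Bound (fun t => (1 + 2 * ‖H10vel x t‖ + ‖H10vel η t‖) * ‖η‖ + ‖H10vel η t‖)
      (6 * ‖η‖) := by
  have h1 := (((HasL2Bound.one.add ((HasL2Bound.vel x).const_mul zero_le_two)).add
    (HasL2Bound.vel η)).mul_const (norm_nonneg η)).add (HasL2Bound.vel η)
  refine h1.mono ?_
  nlinarith [norm_nonneg η]

theorem ae_abs_taylor_le (hG : IsQuadraticLagrangian G r C) {x η : H10 n} (hx : ‖x‖ < r)
    (hxη : ‖x + η‖ < r) :
    ∀ᵐ t ∂vol01, |G t (H10pair (x + η) t) - G t (H10pair x t)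
        - fderiv ℝ (G t) (H10pair x t) (H10pair η t)| ≤
      C * (((1 + 2 * ‖H10vel x t‖ + ‖H10vel η t‖) * ‖η‖ + ‖H10vel η t‖) *
        ((1 + 2 * ‖H10vel x t‖ + ‖H10vel η t‖) * ‖η‖ + ‖H10vel η t‖)) := by
  filter_upwards [ae_mem_Icc, H10pair_add x η, ae_norm_curve_lt hx, ae_norm_curve_lt hxη]
    with t ht h1 h2 h3
  rw [h1] at h3 ⊢
  refine (hG.abs_taylor_le ht h2 h3).trans ?_
  have hC := hG.C_nonneg
  have h4 : ‖(H10pair η t).1‖ ≤ ‖η‖ := norm_H10curve_le η ht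
  rw [pow_two]
  simp only [H10pair] at h4 ⊢
  gcongr

theorem integrable (hG : IsQuadraticLagrangian G r C) {x : H10 n} (hx : ‖x‖ < r)
    (hx1 : ‖x‖ ≤ 1) : Integrable (fun t => G t (H10pair x t)) vol01 := by
  obtain ⟨C₀, hC₀, hb⟩ := hG.exists_bound_fderiv_zero
  have h0 : ‖(0 : H10 n)‖ < r := by simpa using hG.r_pos
  have hw := hasL2Bound_taylor 0 x (by simp) (hx1.trans one_le_two)
  have hd := hG.integrable_fderiv h0 (by simp) x
  refine ((integrable_const C₀).add (hd.norm.add ((hw.integrable_mul hw).const_mul C))).mono'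
    (hG.aestronglyMeasurable (aestronglyMeasurable_H10pair x) (ae_norm_curve_lt hx)) ?_
  have h1 := hG.ae_abs_taylor_le (x := 0) (η := x) h0 (by simpa using hx)
  filter_upwards [ae_mem_Icc, h1, H10pair_zero (n := n)] with t ht h2 h3
  rw [zero_add, h3] at h2
  simp only [Pi.add_apply, Real.norm_eq_abs, h3]
  have h4 := (hb t ht).1
  have h5 := abs_sub_abs_le_abs_sub (G t (H10pair x t) - G t 0) (fderiv ℝ (G t) 0 (H10pair x t))
  have h6 := abs_sub_abs_le_abs_sub (G t (H10pair x t)) (G t 0)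
  linarith

/-- The action is Fréchet differentiable. -/
theorem hasFDerivAt_action (hG : IsQuadraticLagrangian G r C) {ρ : ℝ} (hρr : ρ ≤ r)
    (hρ1 : ρ ≤ 1) {𝒜 : H10 n → ℝ}
    (h𝒜 : ∀ x : H10 n, ‖x‖ < ρ → 𝒜 x = 1 / 2 * ∫ t, G t (H10pair x t) ∂vol01) {x : H10 n}
    (hx : ‖x‖ < ρ) {D : H10 n →L[ℝ] ℝ}
    (hD : ∀ η, D η = 1 / 2 * ∫ t, fderiv ℝ (G t) (H10pair x t) (H10pair η t) ∂vol01) :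
    HasFDerivAt 𝒜 D x := by
  have hC := hG.C_nonneg
  have hbound : ∀ η : H10 n, ‖x + η‖ < ρ → ‖𝒜 (x + η) - 𝒜 x - D η‖ ≤ 36 * C * ‖η‖ ^ 2 := by
    intro η hη
    have hη2 : ‖η‖ ≤ 2 := by
      have : η = (x + η) - x := by abel
      rw [this]
      refine (norm_sub_le _ _).trans ?_
      linarith
    have hxr := hx.trans_le hρr
    have hηr := hη.trans_le hρr
    have hx1 := hx.le.trans hρ1
    have hη1 := hη.le.trans hρ1
    have i1 := hG.integrable hηr hη1
    have i2 := hG.integrable hxr hx1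
    have i3 := hG.integrable_fderiv hxr hx1 η
    have i12 : Integrable (fun t => G t (H10pair (x + η) t) - G t (H10pair x t)) vol01 := i1.sub i2
    rw [h𝒜 _ hη, h𝒜 _ hx, hD, ← mul_sub, ← mul_sub, ← integral_sub i1 i2, ← integral_sub i12 i3,
      norm_mul]
    have : ‖(1 / 2 : ℝ)‖ ≤ 1 := by norm_num
    refine (mul_le_of_le_one_left (norm_nonneg _) this).trans ?_
    have hw := hasL2Bound_taylor x η hx1 hη2
    refine (norm_integral_le_of_norm_le ((hw.integrable_mul hw).const_mul C)
      (hG.ae_abs_taylor_le hxr hηr)).trans ?_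
    rw [integral_const_mul]
    calc _ ≤ C * (6 * ‖η‖ * (6 * ‖η‖)) := by
          gcongr
          exact hw.integral_mul_le hw
      _ = _ := by ring
  rw [hasFDerivAt_iff_isLittleO_nhds_zero]
  have hev : ∀ᶠ η : H10 n in 𝓝 0, ‖x + η‖ < ρ := by
    have hc : Continuous fun η : H10 n => ‖x + η‖ := by fun_prop
    exact hc.continuousAt.eventually (gt_mem_nhds (by simpa using hx))
  refine (Asymptotics.IsBigO.of_bound (36 * C) (hev.mono fun η hη => ?_)).trans_isLittleO
    (Asymptotics.isLittleO_norm_pow_id (E' := H10 n) one_lt_two)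
  simpa using hbound η hη

/-! ### The second variation -/

theorem isOpen_ball_prod_ball (r : ℝ) :
    IsOpen (Metric.ball (0 : Eucl n) r ×ˢ Metric.ball (0 : Eucl n) r) :=
  Metric.isOpen_ball.prod Metric.isOpen_ball

theorem zero_mem_ball_prod_ball (hG : IsQuadraticLagrangian G r C) :
    (0 : Eucl n × Eucl n) ∈ Metric.ball (0 : Eucl n) r ×ˢ Metric.ball (0 : Eucl n) r :=
  ⟨by simpa using hG.r_pos, by simpa using hG.r_pos⟩

/-- Smoothness is known only for small positions and velocities. This suffices at the zero curve,
whose pairs are `0`. -/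
theorem hasFDerivAt_fderiv_zero (hG : IsQuadraticLagrangian G r C) {t : ℝ}
    (ht : t ∈ Icc (0 : ℝ) 1) :
    HasFDerivAt (fderiv ℝ (G t)) (fderiv ℝ (fderiv ℝ (G t)) 0) 0 :=
  (hasFDerivAt_of_contDiffOn_Icc_prod (f := fun t => fderiv ℝ (G t)) (isOpen_ball_prod_ball r)
    (contDiffOn_fderiv_Icc_prod (isOpen_ball_prod_ball r) hG.smooth) ht
      hG.zero_mem_ball_prod_ball).differentiableAt.hasFDerivAt

theorem continuousOn_hessian (hG : IsQuadraticLagrangian G r C) :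
    ContinuousOn (fun t => fderiv ℝ (fderiv ℝ (G t)) 0) (Icc 0 1) := by
  have h1 := contDiffOn_fderiv_Icc_prod (f := fun t => fderiv ℝ (G t)) (isOpen_ball_prod_ball r)
    (contDiffOn_fderiv_Icc_prod (isOpen_ball_prod_ball r) hG.smooth)
  exact h1.continuousOn.comp (f := fun t : ℝ => (t, (0 : Eucl n × Eucl n))) (by fun_prop)
    fun t ht => ⟨ht, hG.zero_mem_ball_prod_ball⟩

theorem hessian_symm (hG : IsQuadraticLagrangian G r C) {t : ℝ} (ht : t ∈ Icc (0 : ℝ) 1)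
    (c c' : Eucl n × Eucl n) :
    fderiv ℝ (fderiv ℝ (G t)) 0 c c' = fderiv ℝ (fderiv ℝ (G t)) 0 c' c := by
  refine second_derivative_symmetric_of_eventually (f := G t) (f' := fderiv ℝ (G t)) ?_
    (hG.hasFDerivAt_fderiv_zero ht) c c'
  filter_upwards [(isOpen_ball_prod_ball r).mem_nhds hG.zero_mem_ball_prod_ball] with z hz
  exact (hG.differentiableAt t ht z (mem_ball_zero_iff.1 hz.1)).hasFDerivAt

theorem aestronglyMeasurable_hessian (hG : IsQuadraticLagrangian G r C) (ξ η : H10 n) :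
    AEStronglyMeasurable
      (fun t => fderiv ℝ (fderiv ℝ (G t)) 0 (H10pair ξ t) (H10pair η t)) vol01 := by
  refine aestronglyMeasurable_comp_of_continuousOn
    (X := ℝ × ((Eucl n × Eucl n) × (Eucl n × Eucl n)))
    (f := fun p => fderiv ℝ (fderiv ℝ (G p.1)) 0 p.2.1 p.2.2)
    (g := fun t => (t, (H10pair ξ t, H10pair η t))) (S := Icc 0 1 ×ˢ univ) ?_ ?_
    (aestronglyMeasurable_id.prodMk
      ((aestronglyMeasurable_H10pair ξ).prodMk (aestronglyMeasurable_H10pair η))) ?_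
  · exact measurableSet_Icc.prod MeasurableSet.univ
  · exact ((hG.continuousOn_hessian.comp continuousOn_fst fun p hp => hp.1).clm_apply
      (by fun_prop)).clm_apply (by fun_prop)
  · filter_upwards [ae_mem_Icc] with t ht
    exact ⟨ht, trivial⟩

theorem exists_bound_hessian (hG : IsQuadraticLagrangian G r C) :
    ∃ K : ℝ, 0 ≤ K ∧ ∀ t ∈ Icc (0 : ℝ) 1, ‖fderiv ℝ (fderiv ℝ (G t)) 0‖ ≤ K :=
  exists_norm_le_of_continuousOn_Icc (V := Eucl n × Eucl n →L[ℝ] Eucl n × Eucl n →L[ℝ] ℝ)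
    (f := fun t => fderiv ℝ (fderiv ℝ (G t)) 0) hG.continuousOn_hessian

theorem ae_abs_hessian_le {K : ℝ}
    (hK : ∀ t ∈ Icc (0 : ℝ) 1, ‖fderiv ℝ (fderiv ℝ (G t)) 0‖ ≤ K) (ξ η : H10 n) :
    ∀ᵐ t ∂vol01, ‖fderiv ℝ (fderiv ℝ (G t)) 0 (H10pair ξ t) (H10pair η t)‖ ≤
      K * ((‖ξ‖ + ‖H10vel ξ t‖) * (‖η‖ + ‖H10vel η t‖)) := by
  filter_upwards [ae_mem_Icc] with t ht
  exact norm_apply_apply_le (hK t ht) (norm_H10pair_le ξ ht) (norm_H10pair_le η ht)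

theorem integrable_hessian (hG : IsQuadraticLagrangian G r C) (ξ η : H10 n) :
    Integrable (fun t => fderiv ℝ (fderiv ℝ (G t)) 0 (H10pair ξ t) (H10pair η t)) vol01 := by
  obtain ⟨K, hK0, hK⟩ := hG.exists_bound_hessian
  exact (((HasL2Bound.pair ξ).integrable_mul (HasL2Bound.pair η)).const_mul K).mono'
    (hG.aestronglyMeasurable_hessian ξ η) (ae_abs_hessian_le hK ξ η)

/-- The second variation of the action at `0`. -/
theorem exists_secondVariation (hG : IsQuadraticLagrangian G r C) :
    ∃ B : H10 n →L[ℝ] H10 n →L[ℝ] ℝ, ∀ ξ η, B ξ η =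
      1 / 2 * ∫ t, fderiv ℝ (fderiv ℝ (G t)) 0 (H10pair ξ t) (H10pair η t) ∂vol01 := by
  obtain ⟨K, hK0, hK⟩ := hG.exists_bound_hessian
  have hi := hG.integrable_hessian
  let B₀ : H10 n →ₗ[ℝ] H10 n →ₗ[ℝ] ℝ := LinearMap.mk₂ ℝ
    (fun ξ η => 1 / 2 * ∫ t, fderiv ℝ (fderiv ℝ (G t)) 0 (H10pair ξ t) (H10pair η t) ∂vol01)
    (fun ξ ξ' η => by
      rw [← mul_add, ← integral_add (hi ξ η) (hi ξ' η)]
      congr 1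
      refine integral_congr_ae ?_
      filter_upwards [H10pair_add ξ ξ'] with t ht
      rw [ht, map_add]
      rfl)
    (fun a ξ η => by
      rw [smul_eq_mul, mul_left_comm, ← integral_const_mul a]
      congr 1
      refine integral_congr_ae ?_
      filter_upwards [H10pair_smul a ξ] with t ht
      rw [ht, map_smul]
      rfl)
    (fun ξ η η' => by
      rw [← mul_add, ← integral_add (hi ξ η) (hi ξ η')]
      congr 1
      refine integral_congr_ae ?_
      filter_upwards [H10pair_add η η'] with t ht
      rw [ht, map_add])
    (fun a ξ η => by
      rw [smul_eq_mul, mul_left_comm, ← integral_const_mul a]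
      congr 1
      refine integral_congr_ae ?_
      filter_upwards [H10pair_smul a η] with t ht
      rw [ht, map_smul, smul_eq_mul])
  refine ⟨B₀.mkContinuous₂ (4 * K) fun ξ η => ?_, fun ξ η => rfl⟩
  change ‖1 / 2 * ∫ t, fderiv ℝ (fderiv ℝ (G t)) 0 (H10pair ξ t) (H10pair η t) ∂vol01‖ ≤ _
  rw [norm_mul]
  have : ‖(1 / 2 : ℝ)‖ ≤ 1 := by norm_num
  refine (mul_le_of_le_one_left (norm_nonneg _) this).trans ?_
  have hw1 := HasL2Bound.pair ξ
  have hw2 := HasL2Bound.pair η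
  refine (norm_integral_le_of_norm_le ((hw1.integrable_mul hw2).const_mul K)
    (ae_abs_hessian_le hK ξ η)).trans ?_
  rw [integral_const_mul]
  calc _ ≤ K * (2 * ‖ξ‖ * (2 * ‖η‖)) := by
        gcongr
        exact hw1.integral_mul_le hw2
    _ = _ := by ring

/-- Dominated differentiation under the integral along the line `s • ξ`: pointwise the pairs tend to
`0`, where `G t` is smooth, and the Lipschitz estimate gives the integrable bound `C * (w₁ t * w₂
t)`. A small `H¹` norm does not bound velocities pointwise, so the argument is made one direction at
a time. -/
theorem hasDerivAt_differential (hG : IsQuadraticLagrangian G r C) {ρ : ℝ} (hρ : 0 < ρ)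
    (hρr : ρ ≤ r) {D : H10 n → H10 n →L[ℝ] ℝ}
    (hD : ∀ x, ‖x‖ < ρ → ∀ η, D x η =
      1 / 2 * ∫ t, fderiv ℝ (G t) (H10pair x t) (H10pair η t) ∂vol01)
    (ξ η : H10 n) :
    HasDerivAt (fun s : ℝ => D (s • ξ) η)
      (1 / 2 * ∫ t, fderiv ℝ (fderiv ℝ (G t)) 0 (H10pair ξ t) (H10pair η t) ∂vol01) 0 := by
  have hC := hG.C_nonneg
  -- `ε ≤ 1` keeps the velocities of `s • ξ` below those of `ξ`, so the dominating function does not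
  -- depend on `s`.
  obtain ⟨ε, hε, hε1, hερ⟩ : ∃ ε : ℝ, 0 < ε ∧ ε ≤ 1 ∧ ε * ‖ξ‖ < ρ := by
    refine ⟨min 1 (ρ / (‖ξ‖ + 1)), by positivity, min_le_left _ _, ?_⟩
    calc _ ≤ ρ / (‖ξ‖ + 1) * ‖ξ‖ := by gcongr; exact min_le_right _ _
      _ < ρ := by
        rw [div_mul_eq_mul_div, div_lt_iff₀ (by positivity)]
        nlinarith
  have hsmall : ∀ s ∈ Metric.ball (0 : ℝ) ε, ‖s • ξ‖ < ρ := fun s hs => by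
    rw [norm_smul]
    refine lt_of_le_of_lt ?_ hερ
    gcongr
    exact (mem_ball_zero_iff.1 hs).le
  let F : ℝ → ℝ → ℝ := fun s t => fderiv ℝ (G t) (s • H10pair ξ t) (H10pair η t)
  have hFD : ∀ s ∈ Metric.ball (0 : ℝ) ε, D (s • ξ) η = 1 / 2 * ∫ t, F s t ∂vol01 := by
    intro s hs
    rw [hD _ (hsmall s hs)]
    congr 1
    refine integral_congr_ae ?_
    filter_upwards [H10pair_smul s ξ] with t ht
    simp only [F, ht]
  have hcurve : ∀ s ∈ Metric.ball (0 : ℝ) ε, ∀ t ∈ Icc (0 : ℝ) 1, ‖(s • H10pair ξ t).1‖ < r := by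
    intro s hs t ht
    have : (s • H10pair ξ t).1 = H10curve (s • ξ) t := by
      rw [H10curve_smul s ξ ht]; rfl
    rw [this]
    exact (norm_H10curve_le _ ht).trans_lt ((hsmall s hs).trans_le hρr)
  let w₁ : ℝ → ℝ := fun t => (1 + ‖H10vel ξ t‖ + ‖H10vel ξ t‖) * ‖ξ‖ + ‖H10vel ξ t‖
  let w₂ : ℝ → ℝ := fun t => (1 + ‖H10vel ξ t‖ + ‖H10vel ξ t‖) * ‖η‖ + ‖H10vel η t‖
  have hv := (HasL2Bound.one.add (HasL2Bound.vel ξ)).add (HasL2Bound.vel ξ)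
  have hw₁ : HasL2Bound w₁ _ := (hv.mul_const (norm_nonneg ξ)).add (HasL2Bound.vel ξ)
  have hw₂ : HasL2Bound w₂ _ := (hv.mul_const (norm_nonneg η)).add (HasL2Bound.vel η)
  have key := hasDerivAt_integral_of_dominated_loc_of_lip (μ := vol01) (F := F)
    (F' := fun t => fderiv ℝ (fderiv ℝ (G t)) 0 (H10pair ξ t) (H10pair η t))
    (bound := fun t => C * (w₁ t * w₂ t)) (x₀ := 0) (Metric.ball_mem_nhds (0 : ℝ) hε) ?_ ?_
    (hG.aestronglyMeasurable_hessian ξ η) ?_ ((hw₁.integrable_mul hw₂).const_mul C) ?_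
  · refine (key.2.const_mul (1 / 2)).congr_of_eventuallyEq ?_
    filter_upwards [Metric.ball_mem_nhds (0 : ℝ) hε] with s hs using hFD s hs
  · filter_upwards [Metric.ball_mem_nhds (0 : ℝ) hε] with s hs
    refine hG.aestronglyMeasurable_fderiv ((aestronglyMeasurable_H10pair ξ).const_smul s)
      (aestronglyMeasurable_H10pair η) ?_
    filter_upwards [ae_mem_Icc] with t ht using hcurve s hs t ht
  · refine (hG.integrable_fderiv (x := 0) (by simpa using hG.r_pos) (by simp) η).congr ?_
    filter_upwards [H10pair_zero (n := n)] with t ht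
    simp [F, ht]
  · filter_upwards [ae_mem_Icc] with t ht
    refine LipschitzOnWith.of_dist_le_mul fun s hs s' hs' => ?_
    have h1 := hG.lipschitz t ht _ _ (hcurve s hs t ht) (hcurve s' hs' t ht) (H10pair η t)
    have hnn : 0 ≤ C * (w₁ t * w₂ t) := by positivity
    rw [Real.dist_eq, Real.dist_eq, Real.coe_nnabs, abs_of_nonneg hnn]
    refine h1.trans ?_
    have hs1 : ∀ s ∈ Metric.ball (0 : ℝ) ε, ‖(s • H10pair ξ t).2‖ ≤ ‖H10vel ξ t‖ := by
      intro s hs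
      rw [Prod.smul_snd, norm_smul]
      exact mul_le_of_le_one_left (norm_nonneg _) ((mem_ball_zero_iff.1 hs).le.trans hε1)
    have h2 : ‖(s • H10pair ξ t).1 - (s' • H10pair ξ t).1‖ ≤ |s - s'| * ‖ξ‖ := by
      rw [Prod.smul_fst, Prod.smul_fst, ← sub_smul, norm_smul, Real.norm_eq_abs]
      gcongr
      exact norm_H10curve_le ξ ht
    have h3 : ‖(s • H10pair ξ t).2 - (s' • H10pair ξ t).2‖ ≤ |s - s'| * ‖H10vel ξ t‖ := by
      rw [Prod.smul_snd, Prod.smul_snd, ← sub_smul, norm_smul, Real.norm_eq_abs]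
      rfl
    have h4 : 1 + ‖(s • H10pair ξ t).2‖ + ‖(s' • H10pair ξ t).2‖
        ≤ 1 + ‖H10vel ξ t‖ + ‖H10vel ξ t‖ := by
      have := hs1 s hs
      have := hs1 s' hs'
      linarith
    have h5 : ‖(H10pair η t).1‖ ≤ ‖η‖ := norm_H10curve_le η ht
    have h6 : ‖(H10pair η t).2‖ = ‖H10vel η t‖ := rfl
    calc _ ≤ C * ((1 + ‖H10vel ξ t‖ + ‖H10vel ξ t‖) * (|s - s'| * ‖ξ‖) + |s - s'| * ‖H10vel ξ t‖) *
          ((1 + ‖H10vel ξ t‖ + ‖H10vel ξ t‖) * ‖η‖ + ‖H10vel η t‖) := by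
          rw [h6]
          gcongr
      _ = _ := by
          simp only [w₁, w₂]
          ring
  · filter_upwards [ae_mem_Icc] with t ht
    exact hasDerivAt_apply_smul (hG.hasFDerivAt_fderiv_zero ht) _ _

end IsQuadraticLagrangian

/-- A quadratic form on pairs that is positive in the second variable. -/
theorem quadratic_form_ge {E : Type*} [NormedAddCommGroup E] [NormedSpace ℝ E]
    {A : E × E →L[ℝ] E × E →L[ℝ] ℝ} (hsymm : ∀ c c', A c c' = A c' c) {K μ : ℝ} (hK : ‖A‖ ≤ K)
    (hμ : 0 < μ) (hpos : ∀ y, μ * ‖y‖ ^ 2 ≤ A (0, y) (0, y)) (z : E × E) :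
    μ / 2 * ‖z.2‖ ^ 2 - (2 * K ^ 2 / μ + K) * ‖z.1‖ ^ 2 ≤ A z z := by
  have hz : z = (z.1, 0) + (0, z.2) := by simp
  have h1 : A z z = A (z.1, 0) (z.1, 0) + 2 * A (z.1, 0) (0, z.2) + A (0, z.2) (0, z.2) := by
    conv_lhs => rw [hz]
    simp only [map_add, _root_.add_apply]
    rw [hsymm (0, z.2) (z.1, 0)]
    ring
  have hn1 : ‖((z.1, 0) : E × E)‖ ≤ ‖z.1‖ := by simp [Prod.norm_def]
  have hn2 : ‖((0, z.2) : E × E)‖ ≤ ‖z.2‖ := by simp [Prod.norm_def]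
  have h2 := neg_le_of_abs_le (norm_apply_apply_le hK hn1 hn1)
  have h3 := neg_le_of_abs_le (norm_apply_apply_le hK hn1 hn2)
  have h4 := hpos z.2
  -- Young's inequality: the mixed term is absorbed by half of the velocity term.
  have h5 : 2 * (K * (‖z.1‖ * ‖z.2‖)) ≤ μ / 2 * ‖z.2‖ ^ 2 + 2 * K ^ 2 / μ * ‖z.1‖ ^ 2 := by
    have h6 : μ / 2 * ‖z.2‖ ^ 2 + 2 * K ^ 2 / μ * ‖z.1‖ ^ 2 - 2 * (K * (‖z.1‖ * ‖z.2‖))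
        = (μ * ‖z.2‖ - 2 * K * ‖z.1‖) ^ 2 / (2 * μ) := by
      field_simp
      ring
    have h7 : 0 ≤ (μ * ‖z.2‖ - 2 * K * ‖z.1‖) ^ 2 / (2 * μ) := by positivity
    linarith
  rw [h1]
  nlinarith

/-! ### Ellipticity and the Gårding inequality -/

namespace IsQuadraticLagrangian

variable {n : ℕ} {G : ℝ → Eucl n × Eucl n → ℝ} {r C : ℝ}

/-- Positivity is uniform on the compact set `[0,1] × sphere`; quadratic scaling does the rest. -/
theorem exists_ellipticity (hG : IsQuadraticLagrangian G r C)
    (hpos : ∀ t ∈ Icc (0 : ℝ) 1, ∀ y : Eucl n, y ≠ 0 →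
      0 < fderiv ℝ (fderiv ℝ (G t)) 0 (0, y) (0, y)) :
    ∃ μ : ℝ, 0 < μ ∧ ∀ t ∈ Icc (0 : ℝ) 1, ∀ y : Eucl n,
      μ * ‖y‖ ^ 2 ≤ fderiv ℝ (fderiv ℝ (G t)) 0 (0, y) (0, y) := by
  have hK : IsCompact (Icc (0 : ℝ) 1 ×ˢ Metric.sphere (0 : Eucl n) 1) :=
    isCompact_Icc.prod (isCompact_sphere 0 1)
  have hc : ContinuousOn (fun p : ℝ × Eucl n => fderiv ℝ (fderiv ℝ (G p.1)) 0 (0, p.2) (0, p.2))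
      (Icc (0 : ℝ) 1 ×ˢ Metric.sphere (0 : Eucl n) 1) :=
    ((hG.continuousOn_hessian.comp continuousOn_fst fun p hp => hp.1).clm_apply
      (by fun_prop)).clm_apply (by fun_prop)
  obtain ⟨μ, hμ, hle⟩ := hK.exists_forall_le' hc (a := 0) fun p hp =>
    hpos p.1 hp.1 p.2 (fun h0 => by simpa [h0] using hp.2)
  refine ⟨μ, hμ, fun t ht y => ?_⟩
  rcases eq_or_ne y 0 with rfl | hy
  · have : ((0, 0) : Eucl n × Eucl n) = 0 := rfl
    simp [this]
  have hyn : 0 < ‖y‖ := norm_pos_iff.2 hy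
  have h1 := hle (t, ‖y‖⁻¹ • y) ⟨ht, by simp [norm_smul, hyn.ne']⟩
  have h2 : ((0, y) : Eucl n × Eucl n) = ‖y‖ • (0, ‖y‖⁻¹ • y) := by
    simp [smul_smul, hyn.ne']
  have h3 : ∀ (A : Eucl n × Eucl n →L[ℝ] Eucl n × Eucl n →L[ℝ] ℝ) (a : ℝ) (z : Eucl n × Eucl n),
      A (a • z) (a • z) = A z z * a ^ 2 := fun A a z => by
    simp only [map_smul, _root_.smul_apply, smul_eq_mul]
    ring
  rw [h2, h3]
  exact mul_le_mul_of_nonneg_right h1 (by positivity)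

/-- The Gårding inequality for the second variation. -/
theorem exists_garding (hG : IsQuadraticLagrangian G r C)
    (hpos : ∀ t ∈ Icc (0 : ℝ) 1, ∀ y : Eucl n, y ≠ 0 →
      0 < fderiv ℝ (fderiv ℝ (G t)) 0 (0, y) (0, y))
    {B : H10 n →L[ℝ] H10 n →L[ℝ] ℝ} (hB : ∀ ξ η, B ξ η =
      1 / 2 * ∫ t, fderiv ℝ (fderiv ℝ (G t)) 0 (H10pair ξ t) (H10pair η t) ∂vol01) :
    ∃ (k : ℕ) (L : H10 n →L[ℝ] (Fin k → Eucl n)) (c : ℝ), 0 < c ∧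
      ∀ x, c * ‖x‖ ^ 2 - ‖L x‖ ^ 2 ≤ B x x := by
  obtain ⟨μ, hμ, hell⟩ := hG.exists_ellipticity hpos
  obtain ⟨K, hK0, hK⟩ := hG.exists_bound_hessian
  set K' := 2 * K ^ 2 / μ + K with hK'
  have hK'0 : 0 ≤ K' := by positivity
  -- The grid is so fine that the sampling error `K' * (2 / k)` takes at most half of the
  -- ellipticity `μ / 2`.
  obtain ⟨k, hk⟩ := exists_nat_gt (max 0 (8 * K' / μ))
  have hk0 : (0 : ℝ) < k := (le_max_left _ _).trans_lt hk
  have hkμ : K' * (2 / k) ≤ μ / 4 := by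
    have h1 := ((le_max_right _ _).trans_lt hk).le
    rw [div_le_iff₀ hμ] at h1
    rw [mul_div_assoc', div_le_iff₀ hk0]
    linarith
  obtain ⟨L, hL⟩ := exists_sampling n (k := k) (by exact_mod_cast hk0)
  -- The factor `1 / 2` in the action turns the remaining `μ / 4` into `μ / 8`, and `2 * K'` into
  -- `K'`, the square of the factor of `L`.
  refine ⟨k, Real.sqrt K' • L, μ / 8, by positivity, fun x => ?_⟩
  have hLn : ‖(Real.sqrt K' • L) x‖ ^ 2 = K' * ‖L x‖ ^ 2 := by
    rw [_root_.smul_apply, norm_smul, mul_pow, Real.norm_of_nonneg (Real.sqrt_nonneg _),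
      Real.sq_sqrt hK'0]
  have hinteg : μ / 2 * ‖x‖ ^ 2 - K' * (2 * ‖L x‖ ^ 2 + 2 / k * ‖x‖ ^ 2) ≤
      ∫ t, fderiv ℝ (fderiv ℝ (G t)) 0 (H10pair x t) (H10pair x t) ∂vol01 := by
    have h1 : ∫ t, (μ / 2 * ‖H10vel x t‖ ^ 2 - K' * (2 * ‖L x‖ ^ 2 + 2 / k * ‖x‖ ^ 2)) ∂vol01
        = μ / 2 * ‖x‖ ^ 2 - K' * (2 * ‖L x‖ ^ 2 + 2 / k * ‖x‖ ^ 2) := by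
      rw [integral_sub ((integrable_norm_sq_H10vel x).const_mul _) (integrable_const _),
        integral_const_mul, integral_norm_sq_H10vel]
      simp
    rw [← h1]
    refine integral_mono_ae (((integrable_norm_sq_H10vel x).const_mul _).sub (integrable_const _))
      (hG.integrable_hessian x x) ?_
    filter_upwards [ae_mem_Icc] with t ht
    have h2 := quadratic_form_ge (fun c c' => hG.hessian_symm ht c c') (hK t ht) hμ (hell t ht)
      (H10pair x t)
    have h3 := mul_le_mul_of_nonneg_left (hL x t ht) hK'0
    rw [← hK'] at h2
    simp only [H10pair] at h2 ⊢
    linarith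
  rw [hLn, hB]
  have h4 := mul_le_mul_of_nonneg_right hkμ (sq_nonneg ‖x‖)
  have h5 : K' * (2 * ‖L x‖ ^ 2 + 2 / k * ‖x‖ ^ 2)
      = 2 * (K' * ‖L x‖ ^ 2) + K' * (2 / k) * ‖x‖ ^ 2 := by ring
  rw [h5] at hinteg
  linarith

end IsQuadraticLagrangian

/-- Integration by parts against a curve in `H¹₀`. -/
theorem integral_parts_H10 {n : ℕ} (η : H10 n) (i : Fin n) {p g : ℝ → ℝ}
    (hp : ContinuousOn p (Icc 0 1)) (hg : ContinuousOn g (Icc 0 1))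
    (hpg : ∀ t ∈ Ioo (0 : ℝ) 1, HasDerivAt p (g t) t) :
    ∫ t, (g t * H10curve η t i + p t * H10vel η t i) ∂vol01 = 0 := by
  have hgi : IntervalIntegrable g volume 0 1 :=
    (hg.mono (by rw [uIcc_of_le zero_le_one])).intervalIntegrable
  -- An absolutely continuous function that equals `p` on `[0,1]`, so that integration by parts
  -- applies. The boundary terms vanish because the curve does at both ends.
  let P : ℝ → ℝ := fun t => p 0 + ∫ s in (0 : ℝ)..t, g s
  have hPp : ∀ t ∈ Icc (0 : ℝ) 1, P t = p t := by
    intro t ht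
    have hsub : Icc 0 t ⊆ Icc (0 : ℝ) 1 := Icc_subset_Icc_right ht.2
    have := intervalIntegral.integral_eq_sub_of_hasDerivAt_of_le ht.1 (hp.mono hsub)
      (fun s hs => hpg s ⟨hs.1, hs.2.trans_le ht.2⟩)
      (hgi.mono_set (by rw [uIcc_of_le ht.1, uIcc_of_le zero_le_one]; exact hsub))
    simp only [P]
    linarith
  have hPac : AbsolutelyContinuousOnInterval P 0 1 := by
    have h1 := hgi.absolutelyContinuousOnInterval_intervalIntegral (c := 0) (by simp)
    have h2 : AbsolutelyContinuousOnInterval (fun _ : ℝ => p 0) 0 1 :=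
      (LipschitzWith.const (p 0)).lipschitzOnWith.absolutelyContinuousOnInterval
    exact h2.add h1
  let pr : Eucl n →L[ℝ] ℝ := EuclideanSpace.proj i
  have hvi : IntervalIntegrable (H10vel η) volume 0 1 := intervalIntegrable_of_memLp (memLp_H10vel η)
  have hvi' : IntervalIntegrable (fun t => H10vel η t i) volume 0 1 := by
    rw [intervalIntegrable_iff_integrableOn_Icc_of_le zero_le_one]
    exact pr.integrable_comp (integrable_H10vel η)
  let Q : ℝ → ℝ := fun t => ∫ s in (0 : ℝ)..t, H10vel η s i
  have hQac : AbsolutelyContinuousOnInterval Q 0 1 :=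
    hvi'.absolutelyContinuousOnInterval_intervalIntegral (c := 0) (by simp)
  have hQη : ∀ t ∈ Icc (0 : ℝ) 1, Q t = H10curve η t i := by
    intro t ht
    have h1 : IntervalIntegrable (H10vel η) volume 0 t := hvi.mono_set (by
      rw [uIcc_of_le ht.1, uIcc_of_le zero_le_one]; exact Icc_subset_Icc_right ht.2)
    exact pr.intervalIntegral_comp_comm h1
  have hmain := hPac.integral_deriv_mul_eq_sub hQac
  rw [hQη 1 (by simp), hQη 0 (by simp), H10curve_start, H10curve_end] at hmain
  simp only [PiLp.zero_apply, mul_zero, sub_zero] at hmain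
  rw [← hmain, intervalIntegral.integral_of_le zero_le_one, ← integral_Icc_eq_integral_Ioc]
  refine integral_congr_ae ?_
  have hQd := (ae_restrict_iff' measurableSet_Icc).2 (by
    have := hvi'.ae_hasDerivAt_integral
    rwa [uIcc_of_le zero_le_one] at this)
  have hIoo : ∀ᵐ t ∂vol01, t ∈ Ioo (0 : ℝ) 1 := by
    have h1 : ∀ᵐ t : ℝ ∂vol01, t ≠ 0 := ae_restrict_of_ae (Measure.ae_ne volume 0)
    have h2 : ∀ᵐ t : ℝ ∂vol01, t ≠ 1 := ae_restrict_of_ae (Measure.ae_ne volume 1)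
    filter_upwards [ae_mem_Icc, h1, h2] with t ht h3 h4
    exact ⟨lt_of_le_of_ne ht.1 h3.symm, lt_of_le_of_ne ht.2 h4⟩
  filter_upwards [hQd, hIoo, ae_mem_Icc] with t h1 h2 ht
  have h3 : deriv P t = g t := by
    have : P =ᶠ[𝓝 t] p := by
      filter_upwards [Ioo_mem_nhds h2.1 h2.2] with s hs using hPp s (Ioo_subset_Icc_self hs)
    rw [this.deriv_eq, (hpg t h2).deriv]
  have h4 : deriv Q t = H10vel η t i := (h1 0 (by simp)).deriv
  rw [h3, h4, hPp t ht, hQη t ht]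

/-- By the Euler–Lagrange equation the position derivatives are the time derivatives of the velocity
derivatives; integration by parts in each coordinate shows that `0` is a critical point. -/
theorem IsQuadraticLagrangian.integral_fderiv_zero {n : ℕ} {G : ℝ → Eucl n × Eucl n → ℝ} {r C : ℝ}
    (hG : IsQuadraticLagrangian G r C)
    (hEL : ∀ t ∈ Ioo (0 : ℝ) 1, ∀ a : Eucl n, HasDerivAt (fun t => fderiv ℝ (G t) 0 (0, a))
      (fderiv ℝ (G t) 0 (a, 0)) t) (η : H10 n) :
    ∫ t, fderiv ℝ (G t) 0 (H10pair η t) ∂vol01 = 0 := by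
  let e := EuclideanSpace.basisFun (Fin n) ℝ
  have hcont : ContinuousOn (fun t => fderiv ℝ (G t) 0) (Icc 0 1) :=
    hG.continuousOn_fderiv.comp (f := fun t : ℝ => (t, (0 : Eucl n × Eucl n))) (by fun_prop)
      fun t ht => ⟨ht, by simpa using hG.r_pos, trivial⟩
  have hc : ∀ c : Eucl n × Eucl n, ContinuousOn (fun t => fderiv ℝ (G t) 0 c) (Icc 0 1) := fun c =>
    hcont.clm_apply continuousOn_const
  have hexp : ∀ t, fderiv ℝ (G t) 0 (H10pair η t) =
      ∑ i, (fderiv ℝ (G t) 0 (e i, 0) * H10curve η t i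
        + fderiv ℝ (G t) 0 (0, e i) * H10vel η t i) := by
    intro t
    have h1 : H10pair η t = ∑ i, (H10curve η t i • (e i, (0 : Eucl n))
        + H10vel η t i • ((0 : Eucl n), e i)) := by
      have h2 := e.sum_repr (H10curve η t)
      have h3 := e.sum_repr (H10vel η t)
      refine Prod.ext ?_ ?_
      · simp only [H10pair, Prod.fst_sum, Prod.fst_add, Prod.smul_fst, smul_zero, add_zero]
        exact h2.symm
      · simp only [H10pair, Prod.snd_sum, Prod.snd_add, Prod.smul_snd, smul_zero, zero_add]
        exact h3.symm
    rw [h1, map_sum]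
    refine Finset.sum_congr rfl fun i _ => ?_
    rw [map_add, map_smul, map_smul, smul_eq_mul, smul_eq_mul, mul_comm, mul_comm (H10vel η t i)]
  simp only [hexp]
  rw [integral_finsetSum]
  · exact Finset.sum_eq_zero fun i _ => integral_parts_H10 η i (hc (0, e i)) (hc (e i, 0))
      fun t ht => hEL t ht (e i)
  · intro i _
    obtain ⟨K₁, -, hK₁⟩ := exists_norm_le_of_continuousOn_Icc (hc (e i, 0))
    obtain ⟨K₂, -, hK₂⟩ := exists_norm_le_of_continuousOn_Icc (hc (0, e i))
    have hpr : ∀ v : Eucl n, ‖v i‖ ≤ ‖v‖ := fun v => PiLp.norm_apply_le v i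
    have m1 := (hc (e i, 0)).aestronglyMeasurable (μ := volume) measurableSet_Icc
    have m2 := (hc (0, e i)).aestronglyMeasurable (μ := volume) measurableSet_Icc
    refine Integrable.add ?_ ?_
    · refine Integrable.bdd_mul (c := K₁) ?_ m1 ?_
      · have : ContinuousOn (fun t => H10curve η t i) (Icc 0 1) :=
          (EuclideanSpace.proj (𝕜 := ℝ) i).continuous.comp_continuousOn (continuousOn_H10curve η)
        exact this.integrableOn_Icc
      · filter_upwards [ae_mem_Icc] with t ht using hK₁ t ht
    · refine Integrable.bdd_mul (c := K₂) ?_ m2 ?_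
      · exact (EuclideanSpace.proj (𝕜 := ℝ) i).integrable_comp (integrable_H10vel η)
      · filter_upwards [ae_mem_Icc] with t ht using hK₂ t ht

/-- The flow near an elliptic critical point of the action of a Lagrangian of quadratic growth. -/
theorem IsQuadraticLagrangian.exists_flow_neighbourhood {n : ℕ} {G : ℝ → Eucl n × Eucl n → ℝ}
    {r C : ℝ} (hG : IsQuadraticLagrangian G r C)
    (hpos : ∀ t ∈ Icc (0 : ℝ) 1, ∀ y : Eucl n, y ≠ 0 →
      0 < fderiv ℝ (fderiv ℝ (G t)) 0 (0, y) (0, y))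
    (hEL : ∀ t ∈ Ioo (0 : ℝ) 1, ∀ a : Eucl n, HasDerivAt (fun t => fderiv ℝ (G t) 0 (0, a))
      (fderiv ℝ (G t) 0 (a, 0)) t)
    {𝒜 : H10 n → ℝ} {ρ : ℝ} (hρ : 0 < ρ)
    (h𝒜 : ∀ x : H10 n, ‖x‖ < ρ → 𝒜 x = 1 / 2 * ∫ t, G t (H10pair x t) ∂vol01)
    {b : H10 n →L[ℝ] H10 n →L[ℝ] ℝ} (hb_symm : ∀ x y, b x y = b y x) (hb : IsCoercive b)
    {𝓤 : Set (H10 n)} (h𝓤 : IsOpen 𝓤) {η₀ : H10 n → ℝ} (hη₀ : ∀ x ∈ 𝓤, η₀ x = 1)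
    {𝓥 : Set (H10 n)} (h𝓥nhds : 𝓥 ∈ 𝓝 (0 : H10 n)) (h𝓥 : 𝓥 ⊆ 𝓤) :
    ∃ ε : ℝ, 0 < ε ∧ ∃ O' : Set (H10 n), IsOpen O' ∧ (0 : H10 n) ∈ O' ∧ O' ⊆ 𝓥 ∧
      ∀ x ∈ O',
        (∃ (ωminus ωplus : EReal) (ψ : ℝ → H10 n),
          IsMaximalSolution (fieldY b 𝒜 η₀) x ωminus ωplus ψ) ∧
        ∀ (ωminus ωplus : EReal) (ψ : ℝ → H10 n),
          IsMaximalSolution (fieldY b 𝒜 η₀) x ωminus ωplus ψ →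
            (ωplus = ⊤ ∧ ∀ t : ℝ, 0 ≤ t → ψ t ∈ 𝓥) ∨
            (∃ T : ℝ, 0 ≤ T ∧ (T : EReal) < ωplus ∧ 𝒜 (ψ T) < 𝒜 0 - ε ∧
              ∀ t ∈ Icc (0 : ℝ) T, ψ t ∈ 𝓥) := by
  -- `ρ` makes `𝒜` the action of `G`, `r` keeps the curves in the domain of `G`, and `1` serves the
  -- `L²` weights.
  let σ := min ρ (min r 1)
  have hσ : 0 < σ := lt_min hρ (lt_min hG.r_pos one_pos)
  have hσr : σ ≤ r := (min_le_right _ _).trans (min_le_left _ _)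
  have hσ1 : σ ≤ 1 := (min_le_right _ _).trans (min_le_right _ _)
  have hex : ∀ x : H10 n, ∃ D : H10 n →L[ℝ] ℝ, ‖x‖ < σ → ∀ η,
      D η = 1 / 2 * ∫ t, fderiv ℝ (G t) (H10pair x t) (H10pair η t) ∂vol01 := by
    intro x
    by_cases hx : ‖x‖ < σ
    · obtain ⟨D, hD⟩ := hG.exists_differential x (hx.trans_le hσr) (hx.le.trans hσ1)
      exact ⟨D, fun _ => hD⟩
    · exact ⟨0, fun h => absurd h hx⟩
  choose D hD using hex
  obtain ⟨B, hB⟩ := hG.exists_secondVariation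
  obtain ⟨k, L, c, hc, hL⟩ := hG.exists_garding hpos hB
  have hB_symm : ∀ x y, B x y = B y x := by
    intro x y
    rw [hB, hB]
    congr 1
    refine integral_congr_ae ?_
    filter_upwards [ae_mem_Icc] with t ht using hG.hessian_symm ht _ _
  refine FinslerFlow.exists_flow_neighbourhood hb_symm hb hB_symm L hc hL (D := D) (ρ := σ)
    (C := 16 * C) hσ (by have := hG.C_nonneg; positivity) ?_ ?_ ?_ ?_ h𝓤 hη₀ h𝓥nhds h𝓥
  · intro x hx
    have hx' := mem_ball_zero_iff.1 hx
    exact hG.hasFDerivAt_action hσr hσ1 (fun y hy => h𝒜 y (hy.trans_le (min_le_left _ _))) hx'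
      (hD x hx')
  · intro x hx y hy
    have hx' := mem_ball_zero_iff.1 hx
    have hy' := mem_ball_zero_iff.1 hy
    exact hG.norm_differential_sub_le (hx'.trans_le hσr) (hx'.le.trans hσ1) (hy'.trans_le hσr)
      (hy'.le.trans hσ1) (hD x hx') (hD y hy')
  · ext η
    rw [hD 0 (by simpa using hσ) η, _root_.zero_apply]
    have h1 : ∫ t, fderiv ℝ (G t) (H10pair 0 t) (H10pair η t) ∂vol01
        = ∫ t, fderiv ℝ (G t) 0 (H10pair η t) ∂vol01 := by
      refine integral_congr_ae ?_
      filter_upwards [H10pair_zero (n := n)] with t ht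
      rw [ht]
    rw [h1, hG.integral_fderiv_zero hEL, mul_zero]
  · intro ξ η
    rw [hB]
    exact hG.hasDerivAt_differential hσ hσr hD ξ η

/-! ### Lagrangians in charts -/

section Chart

theorem contMDiff_tangentBundle_mk {E : Type*} [NormedAddCommGroup E] [NormedSpace ℝ E] :
    ContMDiff 𝓘(ℝ, E × E) 𝓘(ℝ, E).tangent ∞
      (fun z : E × E => (⟨z.1, z.2⟩ : TangentBundle 𝓘(ℝ, E) E)) := by
  intro z
  rw [contMDiffAt_totalSpace]
  refine ⟨contDiff_fst.contMDiff z, ?_⟩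
  convert! (contDiff_snd (𝕜 := ℝ) (E := E) (F := E) (n := ∞)).contMDiff z
  simp
  rfl

variable {n : ℕ} {M : Type*} [TopologicalSpace M] [ChartedSpace (Eucl n) M]

/-- All tangent spaces are by definition the model space, so vectors over equal base points can be
compared without transport. -/
theorem tangentBundle_congr {L : TangentBundle (𝓡 n) M → ℝ} {p p' : M} (hp : p = p')
    {v v' : Eucl n} (hv : v = v') :
    L (⟨p, v⟩ : TangentBundle (𝓡 n) M) = L (⟨p', v'⟩ : TangentBundle (𝓡 n) M) := by
  subst hp hv
  rfl

variable [IsManifold (𝓡 n) ∞ M]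

/-- This is the tangent map of the inverse chart, after identification of `E × E` with the tangent
bundle of `E`. -/
theorem contMDiffOn_chartSymmLift (p : M) :
    ContMDiffOn 𝓘(ℝ, Eucl n × Eucl n) (𝓡 n).tangent ∞
      (fun z : Eucl n × Eucl n => (⟨(extChartAt (𝓡 n) p).symm z.1,
        mfderiv 𝓘(ℝ, Eucl n) (𝓡 n) (extChartAt (𝓡 n) p).symm z.1 z.2⟩ : TangentBundle (𝓡 n) M))
      ((extChartAt (𝓡 n) p).target ×ˢ univ) := by
  have ho : IsOpen (extChartAt (𝓡 n) p).target := isOpen_extChartAt_target p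
  have h1 := (contMDiffOn_extChartAt_symm (I := 𝓡 n) (n := ∞) p).contMDiffOn_tangentMapWithin
    (m := ∞) (by simp) ho.uniqueMDiffOn
  have h2 := h1.comp (contMDiff_tangentBundle_mk (E := Eucl n)).contMDiffOn
    (s := (extChartAt (𝓡 n) p).target ×ˢ univ) (fun z hz => hz.1)
  refine h2.congr fun z hz => ?_
  simp only [Function.comp, tangentMapWithin]
  rw [mfderivWithin_of_isOpen ho hz.1]

theorem isManifold_one : IsManifold (𝓡 n) 1 M := IsManifold.of_le (n := ∞) (by simp)

theorem mfderiv_extChartAt_comp_symm {p : M} {y : Eucl n} (hy : y ∈ (extChartAt (𝓡 n) p).target)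
    (v : Eucl n) :
    (mfderiv (𝓡 n) 𝓘(ℝ, Eucl n) (extChartAt (𝓡 n) p) ((extChartAt (𝓡 n) p).symm y) :
      Eucl n →L[ℝ] Eucl n)
      (mfderiv 𝓘(ℝ, Eucl n) (𝓡 n) (extChartAt (𝓡 n) p).symm y v) = v := by
  have := isManifold_one (n := n) (M := M)
  have h1 := mfderiv_extChartAt_comp_mfderivWithin_extChartAt_symm (I := 𝓡 n) hy
  have hr : range (𝓡 n) = univ := ModelWithCorners.Boundaryless.range_eq_univ
  rw [hr, mfderivWithin_univ] at h1
  exact DFunLike.congr_fun h1 v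

theorem mfderiv_extChartAt_symm_comp {p x : M} (hx : x ∈ (chartAt (Eucl n) p).source)
    (v : TangentSpace (𝓡 n) x) :
    (mfderiv 𝓘(ℝ, Eucl n) (𝓡 n) (extChartAt (𝓡 n) p).symm (extChartAt (𝓡 n) p x) :
      Eucl n →L[ℝ] Eucl n)
      (mfderiv (𝓡 n) 𝓘(ℝ, Eucl n) (extChartAt (𝓡 n) p) x v) = v := by
  have := isManifold_one (n := n) (M := M)
  have h1 := mfderivWithin_extChartAt_symm_comp_mfderiv_extChartAt' (I := 𝓡 n) (x := p) (y := x)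
    (by rwa [extChartAt_source])
  have hr : range (𝓡 n) = univ := ModelWithCorners.Boundaryless.range_eq_univ
  rw [hr, mfderivWithin_univ] at h1
  exact DFunLike.congr_fun h1 v

/-- The differential of the inverse chart is injective, so nonzero velocities stay off the zero
section. -/
theorem contDiffOn_localLagrangian {L : TangentBundle (𝓡 n) M → ℝ}
    (hL : ContMDiffOn (𝓡 n).tangent 𝓘(ℝ, ℝ) ∞ L {v | v.snd ≠ 0}) (p : M) :
    ContDiffOn ℝ ∞ (localLagrangian L p) ((extChartAt (𝓡 n) p).target ×ˢ {0}ᶜ) := by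
  rw [← contMDiffOn_iff_contDiffOn]
  refine hL.comp ((contMDiffOn_chartSymmLift p).mono (prod_mono_right (subset_univ _))) ?_
  intro z hz h0
  have h1 := mfderiv_extChartAt_comp_symm hz.1 z.2
  simp only at h0
  erw [h0] at h1
  exact hz.2 (h1.symm.trans (map_zero _))

theorem contDiffOn_localLagrangian_of_contMDiff {L : TangentBundle (𝓡 n) M → ℝ}
    (hL : ContMDiff (𝓡 n).tangent 𝓘(ℝ, ℝ) ∞ L) (p : M) :
    ContDiffOn ℝ ∞ (localLagrangian L p) ((extChartAt (𝓡 n) p).target ×ˢ univ) := by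
  rw [← contMDiffOn_iff_contDiffOn]
  exact hL.comp_contMDiffOn (contMDiffOn_chartSymmLift p)

theorem FinslerMetric.contMDiffOn_sq (F : FinslerMetric n M) :
    ContMDiffOn (𝓡 n).tangent 𝓘(ℝ, ℝ) ∞ F.sq {v | v.snd ≠ 0} := F.smooth.pow 2

theorem contMDiff_metricSq (h : RMetric n M) :
    ContMDiff (𝓡 n).tangent 𝓘(ℝ, ℝ) ∞ (metricSq h) := by
  let _ : RiemannianBundle (fun p : M => TangentSpace (𝓡 n) p) := ⟨h.toRiemannianMetric⟩
  have h1 : ContMDiff (𝓡 n).tangent (𝓡 n).tangent ∞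
    (fun v : TangentBundle (𝓡 n) M => (⟨v.proj, v.snd⟩ : TangentBundle (𝓡 n) M)) := contMDiff_id
  exact h1.inner_bundle h1

variable {X : Type*} [NormedAddCommGroup X] [NormedSpace ℝ X] {f : X → M} {s : Set X} {z : X}

theorem contDiffWithinAt_chart (hf : ContMDiffWithinAt 𝓘(ℝ, X) (𝓡 n) ∞ f s z) {p : M}
    (hz : f z ∈ (chartAt (Eucl n) p).source) :
    ContDiffWithinAt ℝ ∞ (fun x => extChartAt (𝓡 n) p (f x)) s z := by
  rw [← contMDiffWithinAt_iff_contDiffWithinAt]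
  exact (contMDiffAt_extChartAt' (n := ∞) hz).comp_contMDiffWithinAt z hf

theorem fderivWithin_chart (hs : UniqueDiffWithinAt ℝ s z)
    (hf : MDifferentiableWithinAt 𝓘(ℝ, X) (𝓡 n) f s z) {p : M}
    (hz : f z ∈ (chartAt (Eucl n) p).source) (c : X) :
    fderivWithin ℝ (fun x => extChartAt (𝓡 n) p (f x)) s z c =
      (mfderiv (𝓡 n) 𝓘(ℝ, Eucl n) (extChartAt (𝓡 n) p) (f z) : Eucl n →L[ℝ] Eucl n)
        (mfderivWithin 𝓘(ℝ, X) (𝓡 n) f s z c) := by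
  have := isManifold_one (n := n) (M := M)
  rw [← mfderivWithin_eq_fderivWithin]
  have h1 := mfderiv_comp_mfderivWithin z (mdifferentiableAt_extChartAt (I := 𝓡 n) hz) hf
    hs.uniqueMDiffWithinAt
  exact DFunLike.congr_fun h1 c

theorem localLagrangian_chart (L : TangentBundle (𝓡 n) M → ℝ) (hs : UniqueDiffWithinAt ℝ s z)
    (hf : MDifferentiableWithinAt 𝓘(ℝ, X) (𝓡 n) f s z) {p : M}
    (hz : f z ∈ (chartAt (Eucl n) p).source) (c : X) :
    L ⟨f z, mfderivWithin 𝓘(ℝ, X) (𝓡 n) f s z c⟩ = localLagrangian L p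
      (extChartAt (𝓡 n) p (f z), fderivWithin ℝ (fun x => extChartAt (𝓡 n) p (f x)) s z c) := by
  rw [localLagrangian]
  refine (tangentBundle_congr ((extChartAt (𝓡 n) p).left_inv (by rwa [extChartAt_source])) ?_).symm
  simp only
  rw [fderivWithin_chart hs hf hz]
  exact mfderiv_extChartAt_symm_comp hz _

end Chart
/-! ### The exponential map at the zero section -/

section ExpZero

variable {n : ℕ} {M : Type*} [TopologicalSpace M] [ChartedSpace (Eucl n) M]

theorem eventually_mem_chart_source {γ : ℝ → M} (hγ : ContinuousOn γ (Icc 0 1)) {t : ℝ}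
    (ht : t ∈ Icc (0 : ℝ) 1) (p : M) (hp : γ t ∈ (chartAt (Eucl n) p).source) :
    ∀ᶠ s in 𝓝[Icc 0 1] t, γ s ∈ (chartAt (Eucl n) p).source :=
  (hγ t ht).eventually ((chartAt (Eucl n) p).open_source.mem_nhds hp)

variable [IsManifold (𝓡 n) ∞ M]

theorem localLagrangian_metricSq_smul (h : RMetric n M) (p : M) (x y : Eucl n) (a : ℝ) :
    localLagrangian (metricSq h) p (x, a • y) = a ^ 2 * localLagrangian (metricSq h) p (x, y) := by
  let A : Eucl n →L[ℝ] Eucl n →L[ℝ] ℝ := h.inner ((extChartAt (𝓡 n) p).symm x)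
  let D : Eucl n →L[ℝ] Eucl n := mfderiv 𝓘(ℝ, Eucl n) (𝓡 n) (extChartAt (𝓡 n) p).symm x
  change A (D (a • y)) (D (a • y)) = a ^ 2 * A (D y) (D y)
  simp only [map_smul, _root_.smul_apply, smul_eq_mul]
  ring

/-- Euler's identity for a function homogeneous of degree two in the velocity. -/
theorem momentum_metricSq_apply (h : RMetric n M) (p : M) {z : Eucl n × Eucl n}
    (hz : z.1 ∈ (extChartAt (𝓡 n) p).target) :
    momentum (metricSq h) p z z.2 = 2 * localLagrangian (metricSq h) p z := by
  have hd : HasFDerivAt (localLagrangian (metricSq h) p)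
      (fderiv ℝ (localLagrangian (metricSq h) p) z) (z.1, (1 : ℝ) • z.2) := by
    rw [one_smul]
    exact (((contDiffOn_localLagrangian_of_contMDiff (contMDiff_metricSq h) p).contDiffAt
      (((isOpen_extChartAt_target p).prod isOpen_univ).mem_nhds ⟨hz, mem_univ _⟩)).differentiableAt
        (by simp)).hasFDerivAt
  have h1 : HasDerivAt (fun a : ℝ => ((z.1, a • z.2) : Eucl n × Eucl n)) (0, (1 : ℝ) • z.2) 1 :=
    (hasDerivAt_const _ _).prodMk ((hasDerivAt_id _).smul_const _)
  have h2 := hd.comp_hasDerivAt (1 : ℝ) h1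
  have h3 : HasDerivAt (fun a : ℝ => a ^ 2 * localLagrangian (metricSq h) p z)
      (2 * localLagrangian (metricSq h) p z) 1 := by
    simpa using (hasDerivAt_pow 2 (1 : ℝ)).mul_const (localLagrangian (metricSq h) p z)
  have h4 : (localLagrangian (metricSq h) p ∘ fun a : ℝ => ((z.1, a • z.2) : Eucl n × Eucl n))
      = fun a : ℝ => a ^ 2 * localLagrangian (metricSq h) p z := by
    funext a
    exact localLagrangian_metricSq_smul h p z.1 z.2 a
  rw [h4, one_smul] at h2
  exact h2.unique h3

theorem lagrangian_velocity_eq (L : TangentBundle (𝓡 n) M → ℝ) {γ : ℝ → M}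
    (hγ : ContMDiffOn 𝓘(ℝ, ℝ) (𝓡 n) ∞ γ (Icc 0 1)) {t : ℝ} (ht : t ∈ Icc (0 : ℝ) 1) {p : M}
    (hp : γ t ∈ (chartAt (Eucl n) p).source) :
    L ⟨γ t, velocity γ t⟩ = localLagrangian L p (chartLift p γ t) :=
  localLagrangian_chart L (uniqueDiffOn_Icc_zero_one t ht)
    ((hγ t ht).mdifferentiableWithinAt (by simp)) hp 1

/-- Conservation of energy. -/
theorem IsGeodesic.hasDerivWithinAt_energy {h : RMetric n M} {σ : ℝ → M}
    (hσ : IsGeodesic (metricSq h) σ) {t : ℝ} (ht : t ∈ Icc (0 : ℝ) 1) :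
    HasDerivWithinAt (fun t => metricSq h ⟨σ t, velocity σ t⟩) 0 (Icc 0 1) t := by
  set p := σ t with hp
  have hpt : σ t ∈ (chartAt (Eucl n) p).source := mem_chart_source _ _
  set ℓ := localLagrangian (metricSq h) p with hℓ
  have hu := contDiffWithinAt_chart (hσ.smooth t ht) hpt
  have hud := (hu.differentiableWithinAt (by simp)).hasDerivWithinAt
  have hu' : DifferentiableWithinAt ℝ
      (derivWithin (fun s => extChartAt (𝓡 n) p (σ s)) (Icc (0 : ℝ) 1)) (Icc 0 1) t :=
    ((hu.fderivWithin_right (m := ∞) uniqueDiffOn_Icc_zero_one (by simp) ht).differentiableWithinAt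
      (by simp)).clm_apply (differentiableWithinAt_const (1 : ℝ))
  have hud' := hu'.hasDerivWithinAt
  have hz : (chartLift p σ t).1 ∈ (extChartAt (𝓡 n) p).target := mem_extChartAt_target _
  have hℓd : HasFDerivAt ℓ (fderiv ℝ ℓ (chartLift p σ t)) (chartLift p σ t) :=
    (((contDiffOn_localLagrangian_of_contMDiff (contMDiff_metricSq h) p).contDiffAt
      (((isOpen_extChartAt_target p).prod isOpen_univ).mem_nhds ⟨hz, mem_univ _⟩)).differentiableAt
        (by simp)).hasFDerivAt
  have he1 := hℓd.comp_hasDerivWithinAt t (hud.prodMk hud')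
  have he2 := (hσ.euler_lagrange p t ht hpt).clm_apply hud'
  have hev := eventually_mem_chart_source hσ.smooth.continuousOn ht p hpt
  have he3 : HasDerivWithinAt (fun s => 2 * ℓ (chartLift p σ s))
      (force (metricSq h) p (chartLift p σ t)
          (derivWithin (fun s => extChartAt (𝓡 n) p (σ s)) (Icc (0 : ℝ) 1) t)
        + momentum (metricSq h) p (chartLift p σ t) (derivWithin
          (derivWithin (fun s => extChartAt (𝓡 n) p (σ s)) (Icc (0 : ℝ) 1)) (Icc 0 1) t))
      (Icc 0 1) t := by
    refine he2.congr_of_eventuallyEq ?_ (momentum_metricSq_apply h p hz).symm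
    filter_upwards [hev] with s hs
    exact (momentum_metricSq_apply h p (z := chartLift p σ s)
      ((extChartAt (𝓡 n) p).map_source (by rwa [extChartAt_source]))).symm
  have he4 := he1.const_mul 2
  have hU := uniqueDiffOn_Icc_zero_one t ht
  -- By Euler's identity twice the energy is momentum times velocity; by the Euler–Lagrange equation
  -- the derivative of that product is the derivative of the energy itself. Hence it is `0`.
  have h5 := hU.eq_deriv _ he4 he3
  have h6 : force (metricSq h) p (chartLift p σ t)
          (derivWithin (fun s => extChartAt (𝓡 n) p (σ s)) (Icc (0 : ℝ) 1) t)
        + momentum (metricSq h) p (chartLift p σ t) (derivWithin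
          (derivWithin (fun s => extChartAt (𝓡 n) p (σ s)) (Icc (0 : ℝ) 1)) (Icc 0 1) t)
      = fderiv ℝ ℓ (chartLift p σ t)
        (derivWithin (fun s => extChartAt (𝓡 n) p (σ s)) (Icc (0 : ℝ) 1) t,
          derivWithin (derivWithin (fun s => extChartAt (𝓡 n) p (σ s)) (Icc (0 : ℝ) 1))
            (Icc 0 1) t) := by
    simp only [force, momentum, ContinuousLinearMap.comp_apply, ContinuousLinearMap.inl_apply,
      ContinuousLinearMap.inr_apply]
    rw [← map_add, Prod.mk_add_mk, add_zero, zero_add]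
  have h7 : fderiv ℝ ℓ (chartLift p σ t)
        (derivWithin (fun s => extChartAt (𝓡 n) p (σ s)) (Icc (0 : ℝ) 1) t,
          derivWithin (derivWithin (fun s => extChartAt (𝓡 n) p (σ s)) (Icc (0 : ℝ) 1))
            (Icc 0 1) t) = 0 := by
    rw [h6] at h5
    linarith
  rw [h7] at he1
  refine he1.congr_of_eventuallyEq ?_ (lagrangian_velocity_eq _ hσ.smooth ht hpt)
  filter_upwards [hev, self_mem_nhdsWithin] with s hs hsI
  exact lagrangian_velocity_eq _ hσ.smooth hsI hs

/-- The curve is locally constant in charts, and `[0,1]` is connected. -/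
theorem eq_of_velocity_eq_zero {γ : ℝ → M} (hγ : ContMDiffOn 𝓘(ℝ, ℝ) (𝓡 n) ∞ γ (Icc 0 1))
    (h0 : ∀ t ∈ Icc (0 : ℝ) 1, velocity (n := n) γ t = 0) : γ 1 = γ 0 := by
  have hlc : IsLocallyConstant (fun t : Icc (0 : ℝ) 1 => γ t) := by
    rw [IsLocallyConstant.iff_eventually_eq]
    rintro ⟨t, ht⟩
    set p := γ t with hp
    have hev := eventually_mem_chart_source hγ.continuousOn ht p (mem_chart_source (Eucl n) p)
    obtain ⟨ε, hε, hball⟩ := Metric.mem_nhdsWithin_iff.1 hev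
    have hconv : Convex ℝ (Metric.ball t ε ∩ Icc 0 1) := (convex_ball _ _).inter (convex_Icc _ _)
    have hd : ∀ s ∈ Metric.ball t ε ∩ Icc 0 1, HasFDerivWithinAt
        (fun s => extChartAt (𝓡 n) p (γ s)) (0 : ℝ →L[ℝ] Eucl n) (Metric.ball t ε ∩ Icc 0 1) s := by
      intro s hs
      have hmd := (hγ s hs.2).mdifferentiableWithinAt (by simp)
      have hU := uniqueDiffOn_Icc_zero_one s hs.2
      have h1 := fderivWithin_chart hU hmd (hball hs) (1 : ℝ)
      have h2 := h0 s hs.2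
      rw [velocity] at h2
      erw [h2, map_zero] at h1
      have h3 := ((contDiffWithinAt_chart (hγ s hs.2) (hball hs)).differentiableWithinAt
        (by simp)).hasFDerivWithinAt
      have h4 : fderivWithin ℝ (fun s => extChartAt (𝓡 n) p (γ s)) (Icc 0 1) s = 0 := by
        ext1
        exact h1
      rw [h4] at h3
      exact h3.mono inter_subset_right
    have hmem : Metric.ball t ε ∩ Icc 0 1 ∈ 𝓝[Icc 0 1] t :=
      inter_mem (mem_nhdsWithin_of_mem_nhds (Metric.ball_mem_nhds t hε)) self_mem_nhdsWithin
    rw [nhdsWithin_eq_map_subtype_coe ht, mem_map] at hmem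
    filter_upwards [hmem] with s hs
    have htm : t ∈ Metric.ball t ε ∩ Icc 0 1 := ⟨Metric.mem_ball_self hε, ht⟩
    have h5 := hconv.is_const_of_fderivWithin_eq_zero (𝕜 := ℝ)
      (fun s hs => (hd s hs).differentiableWithinAt) (fun s hs => (hd s hs).fderivWithin
        (inter_comm (Metric.ball t ε) (Icc 0 1) ▸
          UniqueDiffOn.inter uniqueDiffOn_Icc_zero_one Metric.isOpen_ball s hs.symm)) hs htm
    exact (extChartAt (𝓡 n) p).injOn (by rw [extChartAt_source]; exact hball hs)
      (by rw [extChartAt_source]; exact hball htm) h5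
  exact hlc.apply_eq_of_isPreconnected isPreconnected_univ
    (x := (⟨1, by simp⟩ : Icc (0 : ℝ) 1)) (y := ⟨0, by simp⟩) (mem_univ _) (mem_univ _)

/-- Conserved energy that is zero initially forces the velocity to vanish, so the geodesic is
constant. Hence the choice in `expMap` is harmless at zero vectors. -/
theorem IsExp.eq_of_zero {h : RMetric n M} {p x : M}
    (hx : IsExp h (⟨p, (0 : Eucl n)⟩ : TangentBundle (𝓡 n) M) x) : x = p := by
  obtain ⟨σ, hσ, hv, rfl⟩ := hx
  have hE : ∀ t ∈ Icc (0 : ℝ) 1, metricSq h ⟨σ t, velocity σ t⟩ = 0 := by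
    intro t ht
    have h1 := constant_of_derivWithin_zero (f := fun t => metricSq h ⟨σ t, velocity σ t⟩)
      (fun t ht => (hσ.hasDerivWithinAt_energy ht).differentiableWithinAt)
      (fun t ht => (hσ.hasDerivWithinAt_energy ⟨ht.1, ht.2.le⟩).derivWithin
        (uniqueDiffOn_Icc_zero_one t ⟨ht.1, ht.2.le⟩)) t ht
    rw [h1, hv]
    exact map_zero _
  have h0 : ∀ t ∈ Icc (0 : ℝ) 1, velocity (n := n) σ t = 0 := by
    intro t ht
    by_contra hne
    exact (h.pos (σ t) _ hne).ne' (hE t ht)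
  rw [eq_of_velocity_eq_zero hσ.smooth h0]
  exact congrArg TotalSpace.proj hv

theorem expMap_zero (h : RMetric n M) (p : M) :
    expMap h (⟨p, (0 : Eucl n)⟩ : TangentBundle (𝓡 n) M) = p := by
  rw [expMap]
  split_ifs with hv
  · exact hv.choose_spec.eq_of_zero
  · rfl

end ExpZero
/-! ### The map `φ(t,q)` -/

section NormalMap

variable {n : ℕ} {M : Type*} [TopologicalSpace M] [ChartedSpace (Eucl n) M]
  {γ : ℝ → M} {e : Fin n → ∀ t : ℝ, TangentSpace (𝓡 n) (γ t)}

/-- The linear map given by the frame. -/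
noncomputable def frameMap (e : Fin n → ∀ t : ℝ, TangentSpace (𝓡 n) (γ t)) (t : ℝ) : Eucl n →L[ℝ] Eucl n :=
  ∑ i, (EuclideanSpace.proj i : Eucl n →L[ℝ] ℝ).smulRight (e i t : Eucl n)

theorem frameMap_apply (t : ℝ) (q : Eucl n) :
    frameMap e t q = (∑ i, q i • e i t : TangentSpace (𝓡 n) (γ t)) := by
  rw [frameMap, _root_.sum_apply]
  rfl

variable [IsManifold (𝓡 n) ∞ M] {h : RMetric n M}

theorem isOpen_ballU (h : RMetric n M) (γ : ℝ → M) : IsOpen (ballU h γ) :=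
  isOpen_lt continuous_enorm continuous_const

theorem exists_isNormalRadius_of_mem_ballU {q : Eucl n} (hq : q ∈ ballU h γ) {t : ℝ}
    (ht : t ∈ Icc (0 : ℝ) 1) : ∃ r : ℝ≥0, IsNormalRadius h (γ t) r ∧ ‖q‖ < r := by
  have h1 : ‖q‖ₑ < injRadius h (γ t) :=
    lt_of_lt_of_le hq (ENNReal.half_le_self.trans (iInf₂_le t ht))
  rw [injRadius, lt_iSup_iff] at h1
  obtain ⟨r, hr⟩ := h1
  rw [lt_iSup_iff] at hr
  obtain ⟨hr, hlt⟩ := hr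
  refine ⟨r, hr, ?_⟩
  rw [← ofReal_norm, ENNReal.ofReal_lt_coe_iff (norm_nonneg q)] at hlt
  exact hlt

theorem IsOrthonormalFrame.inner_frameMap (he : IsOrthonormalFrame h γ e) {t : ℝ}
    (ht : t ∈ Icc (0 : ℝ) 1) (q : Eucl n) :
    (h.inner (γ t) : Eucl n →L[ℝ] Eucl n →L[ℝ] ℝ) (frameMap e t q) (frameMap e t q) =
      ‖q‖ ^ 2 := by
  have h1 : frameMap e t q = ∑ i, q i • (e i t : Eucl n) := frameMap_apply t q
  have h2 : ∀ i j, (h.inner (γ t) : Eucl n →L[ℝ] Eucl n →L[ℝ] ℝ) (e i t) (e j t)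
      = if i = j then 1 else 0 := he.orthonormal t ht
  rw [h1]
  simp only [map_sum, map_smul, _root_.sum_apply, _root_.smul_apply, smul_eq_mul, h2]
  rw [EuclideanSpace.norm_sq_eq]
  simp [sq]

theorem IsOrthonormalFrame.frameMap_injective (he : IsOrthonormalFrame h γ e) {t : ℝ}
    (ht : t ∈ Icc (0 : ℝ) 1) {q : Eucl n} (hq : frameMap e t q = 0) : q = 0 := by
  have h1 := he.inner_frameMap ht q
  have h2 : (h.inner (γ t) : Eucl n →L[ℝ] Eucl n →L[ℝ] ℝ) 0 0 = 0 := map_zero _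
  rw [hq] at h1
  replace h1 := h2.symm.trans h1
  simpa using h1.symm

theorem IsOrthonormalFrame.contMDiffOn_frame (he : IsOrthonormalFrame h γ e)
    (hγ : ContMDiffOn 𝓘(ℝ, ℝ) (𝓡 n) ∞ γ (Icc 0 1)) :
    ContMDiffOn 𝓘(ℝ, ℝ × Eucl n) (𝓡 n).tangent ∞
      (fun z : ℝ × Eucl n => (⟨γ z.1, ∑ i, z.2 i • e i z.1⟩ : TangentBundle (𝓡 n) M))
      (Icc 0 1 ×ˢ univ) := by
  intro z hz
  have hfst : ContMDiffWithinAt 𝓘(ℝ, ℝ × Eucl n) 𝓘(ℝ, ℝ) ∞ (Prod.fst : ℝ × Eucl n → ℝ)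
      (Icc 0 1 ×ˢ univ) z := (contDiff_fst.contMDiff z).contMDiffWithinAt
  have hmaps : MapsTo (Prod.fst : ℝ × Eucl n → ℝ) (Icc 0 1 ×ˢ univ) (Icc 0 1) := fun y hy => hy.1
  have hbase := (hγ z.1 hz.1).comp z hfst hmaps
  rw [contMDiffWithinAt_totalSpace]
  refine ⟨hbase, ?_⟩
  set T := trivializationAt (Eucl n) (TangentSpace (𝓡 n)) (γ z.1) with hT
  have hco : ∀ i, ContMDiffWithinAt 𝓘(ℝ, ℝ × Eucl n) 𝓘(ℝ, Eucl n) ∞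
      (fun y : ℝ × Eucl n => y.2 i • (T ⟨γ y.1, e i y.1⟩).2) (Icc 0 1 ×ˢ univ) z := by
    intro i
    have h1 := (contMDiffWithinAt_totalSpace.1 (he.smooth i z.1 hz.1)).2
    have h2 : ContMDiffWithinAt 𝓘(ℝ, ℝ × Eucl n) 𝓘(ℝ, Eucl n) ∞
      (fun y : ℝ × Eucl n => (T ⟨γ y.1, e i y.1⟩).2) (Icc 0 1 ×ˢ univ) z := h1.comp z hfst hmaps
    rw [contMDiffWithinAt_iff_contDiffWithinAt] at h2 ⊢
    exact ContDiffWithinAt.smul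
      ((EuclideanSpace.proj (𝕜 := ℝ) i).contDiff.comp contDiff_snd).contDiffWithinAt h2
  have hsum : ContMDiffWithinAt 𝓘(ℝ, ℝ × Eucl n) 𝓘(ℝ, Eucl n) ∞
      (fun y : ℝ × Eucl n => ∑ i, y.2 i • (T ⟨γ y.1, e i y.1⟩).2) (Icc 0 1 ×ˢ univ) z := by
    simp only [contMDiffWithinAt_iff_contDiffWithinAt] at hco ⊢
    exact ContDiffWithinAt.sum fun i _ => hco i
  have hlin : ∀ y : ℝ × Eucl n, γ y.1 ∈ T.baseSet →
      (T ⟨γ y.1, ∑ i, y.2 i • e i y.1⟩).2 = ∑ i, y.2 i • (T ⟨γ y.1, e i y.1⟩).2 := by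
    intro y hy
    have h1 : ∀ v : TangentSpace (𝓡 n) (γ y.1), (T ⟨γ y.1, v⟩).2 = T.linearMapAt ℝ (γ y.1) v := by
      intro v
      rw [Trivialization.linearMapAt_apply, if_pos hy]
    simp only [h1, map_sum, map_smul]
  refine hsum.congr_of_eventuallyEq ?_ (hlin z (FiberBundle.mem_baseSet_trivializationAt' _))
  have hev : ∀ᶠ y in 𝓝[Icc 0 1 ×ˢ univ] z, γ y.1 ∈ T.baseSet :=
    hbase.continuousWithinAt.eventually
      (T.open_baseSet.mem_nhds (FiberBundle.mem_baseSet_trivializationAt' _))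
  filter_upwards [hev] with y hy using hlin y hy

theorem contMDiffOn_normalMap (hγ : ContMDiffOn 𝓘(ℝ, ℝ) (𝓡 n) ∞ γ (Icc 0 1))
    (he : IsOrthonormalFrame h γ e) :
    ContMDiffOn 𝓘(ℝ, ℝ × Eucl n) (𝓡 n) ∞ (normalMap h γ e) (Icc 0 1 ×ˢ ballU h γ) := by
  intro z hz
  obtain ⟨r, hr, hlt⟩ := exists_isNormalRadius_of_mem_ballU hz.2 hz.1
  obtain ⟨W, hWo, -, hW, hsm⟩ := hr.1
  have hmem : (⟨γ z.1, ∑ i, z.2 i • e i z.1⟩ : TangentBundle (𝓡 n) M) ∈ W := by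
    refine hW _ ?_
    have h1 := he.inner_frameMap hz.1 z.2
    rw [frameMap_apply] at h1
    refine lt_of_eq_of_lt h1 ?_
    gcongr
  exact (hsm.contMDiffAt (hWo.mem_nhds hmem)).comp_contMDiffWithinAt z
    ((he.contMDiffOn_frame hγ z ⟨hz.1, mem_univ _⟩).mono (prod_mono_right (subset_univ _)))

theorem normalMap_zero (t : ℝ) : normalMap h γ e (t, 0) = γ t := by
  have h1 : (∑ i, (0 : Eucl n) i • e i t : TangentSpace (𝓡 n) (γ t)) = (0 : Eucl n) := by
    rw [← frameMap_apply, map_zero]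
  change expMap h ⟨γ t, ∑ i, (0 : Eucl n) i • e i t⟩ = γ t
  rw [h1]
  exact expMap_zero h (γ t)

theorem uniqueDiffOn_Icc_prod_ballU :
    UniqueDiffOn ℝ (Icc (0 : ℝ) 1 ×ˢ ballU h γ) :=
  UniqueDiffOn.prod uniqueDiffOn_Icc_zero_one (isOpen_ballU h γ).uniqueDiffOn

/-- For fixed `t` the map `φ` is the exponential at `γ t` after the injective frame map, and points
of `ballU` go inside the injectivity radius. -/
theorem mfderivWithin_normalMap_injective (hγ : ContMDiffOn 𝓘(ℝ, ℝ) (𝓡 n) ∞ γ (Icc 0 1))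
    (he : IsOrthonormalFrame h γ e) {t : ℝ} (ht : t ∈ Icc (0 : ℝ) 1) {q : Eucl n}
    (hq : q ∈ ballU h γ) {v : Eucl n}
    (hv : (mfderivWithin 𝓘(ℝ, ℝ × Eucl n) (𝓡 n) (normalMap h γ e) (Icc 0 1 ×ˢ ballU h γ) (t, q) :
      ℝ × Eucl n →L[ℝ] Eucl n) (0, v) = 0) : v = 0 := by
  obtain ⟨r, hr, hlt⟩ := exists_isNormalRadius_of_mem_ballU hq ht
  have hlt' : h.inner (γ t) (frameMap e t q) (frameMap e t q) < (r : ℝ) ^ 2 := by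
    refine lt_of_eq_of_lt (he.inner_frameMap ht q) ?_
    gcongr
  have hinj := hr.2.2 (frameMap e t q) hlt'
  by_contra hv0
  -- At a point of non-differentiability `mfderiv` would be `0` by default, and its injectivity
  -- would give `v = 0`.
  have hmd : MDifferentiableAt 𝓘(ℝ, Eucl n) (𝓡 n)
      (fun w : Eucl n => expMap h (⟨γ t, w⟩ : TangentBundle (𝓡 n) M)) (frameMap e t q) := by
    by_contra hnd
    rw [mfderiv_zero_of_not_mdifferentiableAt hnd] at hinj
    exact hv0 (hinj (a₁ := v) (a₂ := (0 : Eucl n)) rfl)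
  have hL : HasMFDerivAt 𝓘(ℝ, Eucl n) 𝓘(ℝ, Eucl n) (frameMap e t) q (frameMap e t) :=
    (frameMap e t).hasFDerivAt.hasMFDerivAt
  have h1 := (hmd.hasMFDerivAt.comp q hL)
  have hslice : HasMFDerivAt 𝓘(ℝ, Eucl n) 𝓘(ℝ, ℝ × Eucl n) (fun q : Eucl n => (t, q)) q
      (ContinuousLinearMap.inr ℝ ℝ (Eucl n)) := (hasFDerivAt_prodMk_right t q).hasMFDerivAt
  have hφ := ((contMDiffOn_normalMap hγ he (t, q) ⟨ht, hq⟩).mdifferentiableWithinAt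
    (by simp)).hasMFDerivWithinAt
  have h2 := hφ.comp q (s := ballU h γ) hslice.hasMFDerivWithinAt (fun y hy => ⟨ht, hy⟩)
  have h3 := (h2.hasMFDerivAt ((isOpen_ballU h γ).mem_nhds hq))
  have h4 : (normalMap h γ e ∘ fun q : Eucl n => (t, q)) =
      (fun w : Eucl n => expMap h (⟨γ t, w⟩ : TangentBundle (𝓡 n) M)) ∘ frameMap e t := by
    funext y
    simp only [Function.comp, normalMap]
    rw [frameMap_apply]
  rw [h4] at h3
  have h5 := hasMFDerivAt_unique h1 h3
  have h6 := DFunLike.congr_fun h5 v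
  have h7 := h6.trans hv
  exact hv0 (he.frameMap_injective ht (hinj (h7.trans (map_zero _).symm)))

theorem mfderivWithin_normalMap_one (hγ : ContMDiffOn 𝓘(ℝ, ℝ) (𝓡 n) ∞ γ (Icc 0 1))
    (he : IsOrthonormalFrame h γ e) (h0 : 0 ∈ ballU h γ) {t : ℝ} (ht : t ∈ Icc (0 : ℝ) 1) :
    (mfderivWithin 𝓘(ℝ, ℝ × Eucl n) (𝓡 n) (normalMap h γ e) (Icc 0 1 ×ˢ ballU h γ) (t, 0) :
      ℝ × Eucl n →L[ℝ] Eucl n) (1, 0) = velocity γ t := by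
  have hslice : HasMFDerivAt 𝓘(ℝ, ℝ) 𝓘(ℝ, ℝ × Eucl n) (fun s : ℝ => (s, (0 : Eucl n))) t
      (ContinuousLinearMap.inl ℝ ℝ (Eucl n)) := (hasFDerivAt_prodMk_left t 0).hasMFDerivAt
  have hφ := ((contMDiffOn_normalMap hγ he (t, 0) ⟨ht, h0⟩).mdifferentiableWithinAt
    (by simp)).hasMFDerivWithinAt
  have h2 := hφ.comp t (s := Icc 0 1) hslice.hasMFDerivWithinAt (fun y hy => mk_mem_prod hy h0)
  have h4 : (normalMap h γ e ∘ fun s : ℝ => (s, (0 : Eucl n))) = γ := by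
    funext y
    exact normalMap_zero y
  rw [h4] at h2
  have h5 := h2.mfderivWithin (uniqueDiffOn_Icc_zero_one t ht).uniqueMDiffWithinAt
  exact (DFunLike.congr_fun h5 (1 : ℝ)).symm

end NormalMap
/-! ### The Lagrangian `G̃` -/

theorem isInvertible_of_injective {E : Type*} [NormedAddCommGroup E] [NormedSpace ℝ E]
    [FiniteDimensional ℝ E] {A : E →L[ℝ] E} (hA : ∀ v, A v = 0 → v = 0) : A.IsInvertible := by
  have hinj : Function.Injective A := (injective_iff_map_eq_zero A).2 hA
  exact ⟨(LinearEquiv.ofInjectiveEndo (A : E →ₗ[ℝ] E) hinj).toContinuousLinearEquiv, by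
    ext v
    rfl⟩

/-- The Euler–Lagrange equation is invariant under time dependent changes of coordinates. -/
theorem hasDerivAt_fderiv_of_eulerLagrange {E : Type*} [NormedAddCommGroup E] [NormedSpace ℝ E]
    {f : ℝ × E → E} {ℓ : E × E → ℝ} {G : ℝ → E × E → ℝ} {t₀ : ℝ}
    (hf : ContDiffAt ℝ ∞ f (t₀, 0))
    (hℓ : ∀ᶠ t in 𝓝 t₀, DifferentiableAt ℝ ℓ (f (t, 0), fderiv ℝ f (t, 0) (1, 0)))
    (hG : ∀ᶠ z in 𝓝 (t₀, (0 : E)), ∀ y, G z.1 (z.2, y) = ℓ (f z, fderiv ℝ f z (1, y)))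
    (hEL : HasDerivAt (fun t => (fderiv ℝ ℓ (f (t, 0), fderiv ℝ f (t, 0) (1, 0))).comp
        (ContinuousLinearMap.inr ℝ E E))
      ((fderiv ℝ ℓ (f (t₀, 0), fderiv ℝ f (t₀, 0) (1, 0))).comp
        (ContinuousLinearMap.inl ℝ E E)) t₀) (a : E) :
    HasDerivAt (fun t => fderiv ℝ (G t) 0 (0, a)) (fderiv ℝ (G t₀) 0 (a, 0)) t₀ := by
  have hslice : Tendsto (fun t : ℝ => (t, (0 : E))) (𝓝 t₀) (𝓝 (t₀, 0)) :=
    (Continuous.prodMk_left (0 : E)).tendsto t₀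
  have hf' : ContDiffAt ℝ ∞ (fderiv ℝ f) (t₀, 0) := hf.fderiv_right (by simp)
  have hfd : ∀ᶠ t in 𝓝 t₀, DifferentiableAt ℝ f (t, 0) := by
    have h1 : ∀ᶠ z in 𝓝 (t₀, (0 : E)), ContDiffAt ℝ 1 f z :=
      (hf.of_le (by simp)).eventually (by simp)
    filter_upwards [hslice.eventually h1] with t ht using ht.differentiableAt (by simp)
  have hfd' : ∀ᶠ t in 𝓝 t₀, DifferentiableAt ℝ (fderiv ℝ f) (t, 0) := by
    have h1 : ∀ᶠ z in 𝓝 (t₀, (0 : E)), ContDiffAt ℝ 1 (fderiv ℝ f) z :=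
      (hf'.of_le (by simp)).eventually (by simp)
    filter_upwards [hslice.eventually h1] with t ht using ht.differentiableAt (by simp)
  -- Chain rule at `q = y = 0`: a variation of the position also changes the velocity, through a
  -- mixed second derivative of `f`.
  have key : ∀ᶠ t in 𝓝 t₀, ∀ c : E × E, fderiv ℝ (G t) 0 c =
      fderiv ℝ ℓ (f (t, 0), fderiv ℝ f (t, 0) (1, 0)) (fderiv ℝ f (t, 0) (0, c.1),
        fderiv ℝ f (t, 0) (0, c.2) + fderiv ℝ (fderiv ℝ f) (t, 0) (0, c.1) (1, 0)) := by
    filter_upwards [hfd, hfd', hℓ, hslice.eventually hG.eventually_nhds] with t h1 h2 h3 h4 c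
    have hpos : HasFDerivAt (fun z : E × E => (t, z.1))
        ((ContinuousLinearMap.inr ℝ ℝ E).comp (ContinuousLinearMap.fst ℝ E E)) 0 :=
      (hasFDerivAt_prodMk_right t (0 : E)).comp (0 : E × E) hasFDerivAt_fst
    have hvel : HasFDerivAt (fun z : E × E => ((1 : ℝ), z.2))
        ((ContinuousLinearMap.inr ℝ ℝ E).comp (ContinuousLinearMap.snd ℝ E E)) 0 :=
      (hasFDerivAt_prodMk_right (1 : ℝ) (0 : E)).comp (0 : E × E) hasFDerivAt_snd
    have h5 := (HasFDerivAt.comp (x := (0 : E × E)) (g := f) h1.hasFDerivAt hpos)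
    have h6 := (HasFDerivAt.comp (x := (0 : E × E)) (g := fderiv ℝ f) h2.hasFDerivAt hpos).clm_apply
      hvel
    have h7 := HasFDerivAt.comp (x := (0 : E × E)) (g := ℓ) h3.hasFDerivAt (h5.prodMk h6)
    have h8 : G t =ᶠ[𝓝 0] fun z : E × E => ℓ (f (t, z.1), fderiv ℝ f (t, z.1) (1, z.2)) := by
      have h9 : Tendsto (fun z : E × E => (t, z.1)) (𝓝 0) (𝓝 (t, 0)) :=
        (continuous_const.prodMk continuous_fst).tendsto _
      filter_upwards [h9.eventually h4] with z hz using hz z.2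
    rw [(h7.congr_of_eventuallyEq h8).fderiv]
    simp
  have hDf : HasDerivAt (fun t => fderiv ℝ f (t, 0) (0, a))
      (fderiv ℝ (fderiv ℝ f) (t₀, 0) (1, 0) (0, a)) t₀ := by
    have h1 := (hf'.differentiableAt (by simp)).hasFDerivAt.comp_hasDerivAt t₀
      ((hasFDerivAt_prodMk_left t₀ (0 : E)).hasDerivAt)
    simpa using h1.clm_apply (hasDerivAt_const t₀ ((0, a) : ℝ × E))
  have h1 := hEL.clm_apply hDf
  -- Symmetry of second derivatives identifies the time derivative of the transported vector with
  -- the mixed term in `key`.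
  have hsymm : fderiv ℝ (fderiv ℝ f) (t₀, 0) (1, 0) (0, a)
      = fderiv ℝ (fderiv ℝ f) (t₀, 0) (0, a) (1, 0) :=
    hf.isSymmSndFDerivAt
      (by rw [minSmoothness_of_isRCLikeNormedField]; exact ENat.LEInfty.out) _ _
  have hev : (fun t => fderiv ℝ (G t) 0 (0, a)) =ᶠ[𝓝 t₀] fun t =>
      (fderiv ℝ ℓ (f (t, 0), fderiv ℝ f (t, 0) (1, 0))).comp (ContinuousLinearMap.inr ℝ E E)
        (fderiv ℝ f (t, 0) (0, a)) := by
    filter_upwards [key] with t ht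
    rw [ht]
    have : ((0, 0) : ℝ × E) = 0 := rfl
    simp [this]
  have h2 := h1.congr_of_eventuallyEq hev
  convert! h2 using 1
  rw [key.self_of_nhds, hsymm]
  have : ((0, 0) : ℝ × E) = 0 := rfl
  simp only [this, map_zero, zero_add, ContinuousLinearMap.comp_apply,
    ContinuousLinearMap.inl_apply, ContinuousLinearMap.inr_apply]
  rw [← map_add, Prod.mk_add_mk, add_zero, zero_add]

/-! ### `G̃` as a fibrewise homogeneous Lagrangian shifted by a drift -/

section TildeG

variable {n : ℕ} {M : Type*} [TopologicalSpace M] [ChartedSpace (Eucl n) M]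
  [IsManifold (𝓡 n) ∞ M] {F : FinslerMetric n M} {h : RMetric n M} {γ : ℝ → M}
  {e : Fin n → ∀ t : ℝ, TangentSpace (𝓡 n) (γ t)}

variable (h γ e) in
/-- The differential of `φ` on `[0,1] × U`. -/
noncomputable def dNormalMap (z : ℝ × Eucl n) : ℝ × Eucl n →L[ℝ] Eucl n :=
  mfderivWithin 𝓘(ℝ, ℝ × Eucl n) (𝓡 n) (normalMap h γ e) (Icc 0 1 ×ˢ ballU h γ) z

variable (F h γ e) in
/-- The square of the Finsler metric on the vectors `dφ(t,q)[(0,v)]`. -/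
noncomputable def fibreLagrangian (t : ℝ) (z : Eucl n × Eucl n) : ℝ :=
  F.sq ⟨normalMap h γ e (t, z.1), dNormalMap h γ e (t, z.1) (0, z.2)⟩

variable (h γ e) in
/-- The vector `w` with `dφ(t,q)[(1,0)] = dφ(t,q)[(0,w)]`. -/
noncomputable def drift (t : ℝ) (q : Eucl n) : Eucl n :=
  ((dNormalMap h γ e (t, q)).comp (ContinuousLinearMap.inr ℝ ℝ (Eucl n))).inverse
    (dNormalMap h γ e (t, q) (1, 0))

theorem isInvertible_dNormalMap_inr (hγ : ContMDiffOn 𝓘(ℝ, ℝ) (𝓡 n) ∞ γ (Icc 0 1))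
    (he : IsOrthonormalFrame h γ e) {t : ℝ}
    (ht : t ∈ Icc (0 : ℝ) 1) {q : Eucl n} (hq : q ∈ ballU h γ) :
    ((dNormalMap h γ e (t, q)).comp (ContinuousLinearMap.inr ℝ ℝ (Eucl n))).IsInvertible :=
  isInvertible_of_injective fun _ hv => mfderivWithin_normalMap_injective hγ he ht hq hv

theorem dNormalMap_drift (hγ : ContMDiffOn 𝓘(ℝ, ℝ) (𝓡 n) ∞ γ (Icc 0 1))
    (he : IsOrthonormalFrame h γ e) {t : ℝ}
    (ht : t ∈ Icc (0 : ℝ) 1) {q : Eucl n} (hq : q ∈ ballU h γ) :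
    dNormalMap h γ e (t, q) (0, drift h γ e t q) = dNormalMap h γ e (t, q) (1, 0) :=
  (isInvertible_dNormalMap_inr hγ he ht hq).self_apply_inverse _

/-- Writing `dφ(1,y)` as `dφ(0, y + w)` makes homogeneity available, although `G̃` itself need not
be homogeneous in `y`. -/
theorem tildeG_eq_fibreLagrangian (hγ : ContMDiffOn 𝓘(ℝ, ℝ) (𝓡 n) ∞ γ (Icc 0 1))
    (he : IsOrthonormalFrame h γ e) {t : ℝ}
    (ht : t ∈ Icc (0 : ℝ) 1) {z : Eucl n × Eucl n} (hz : z.1 ∈ ballU h γ) :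
    tildeG F h γ e t z.1 z.2 = fibreLagrangian F h γ e t (z.1, z.2 + drift h γ e t z.1) := by
  refine tangentBundle_congr rfl ?_
  change dNormalMap h γ e (t, z.1) (1, z.2) =
    dNormalMap h γ e (t, z.1) (0, z.2 + drift h γ e t z.1)
  have h1 : ((1, z.2) : ℝ × Eucl n) = (0, z.2) + (1, 0) := by simp
  have h2 : ((0, z.2 + drift h γ e t z.1) : ℝ × Eucl n) = (0, z.2) + (0, drift h γ e t z.1) := by
    simp
  rw [h1, h2, map_add, map_add, dNormalMap_drift hγ he ht hz]

/-- The map `φ` read in the chart at `p`. -/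
noncomputable def chartNormalMap (h : RMetric n M) (γ : ℝ → M)
    (e : Fin n → ∀ t : ℝ, TangentSpace (𝓡 n) (γ t)) (p : M) (z : ℝ × Eucl n) : Eucl n :=
  extChartAt (𝓡 n) p (normalMap h γ e z)

theorem contDiffWithinAt_chartNormalMap (hγ : ContMDiffOn 𝓘(ℝ, ℝ) (𝓡 n) ∞ γ (Icc 0 1))
    (he : IsOrthonormalFrame h γ e) {z : ℝ × Eucl n}
    (hz : z ∈ Icc (0 : ℝ) 1 ×ˢ ballU h γ) {p : M}
    (hp : normalMap h γ e z ∈ (chartAt (Eucl n) p).source) :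
    ContDiffWithinAt ℝ ∞ (chartNormalMap h γ e p) (Icc 0 1 ×ˢ ballU h γ) z :=
  contDiffWithinAt_chart (contMDiffOn_normalMap hγ he z hz) hp

theorem contDiffWithinAt_fderivWithin_chartNormalMap (hγ : ContMDiffOn 𝓘(ℝ, ℝ) (𝓡 n) ∞ γ (Icc 0 1))
    (he : IsOrthonormalFrame h γ e) {z : ℝ × Eucl n}
    (hz : z ∈ Icc (0 : ℝ) 1 ×ˢ ballU h γ) {p : M}
    (hp : normalMap h γ e z ∈ (chartAt (Eucl n) p).source) :
    ContDiffWithinAt ℝ ∞ (fderivWithin ℝ (chartNormalMap h γ e p) (Icc 0 1 ×ˢ ballU h γ))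
      (Icc 0 1 ×ˢ ballU h γ) z :=
  (contDiffWithinAt_chartNormalMap hγ he hz hp).fderivWithin_right uniqueDiffOn_Icc_prod_ballU
    (by simp) hz

theorem fderivWithin_chartNormalMap (hγ : ContMDiffOn 𝓘(ℝ, ℝ) (𝓡 n) ∞ γ (Icc 0 1))
    (he : IsOrthonormalFrame h γ e) {z : ℝ × Eucl n}
    (hz : z ∈ Icc (0 : ℝ) 1 ×ˢ ballU h γ) {p : M}
    (hp : normalMap h γ e z ∈ (chartAt (Eucl n) p).source) (c : ℝ × Eucl n) :
    fderivWithin ℝ (chartNormalMap h γ e p) (Icc 0 1 ×ˢ ballU h γ) z c =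
      (mfderiv (𝓡 n) 𝓘(ℝ, Eucl n) (extChartAt (𝓡 n) p) (normalMap h γ e z) :
        Eucl n →L[ℝ] Eucl n) (dNormalMap h γ e z c) :=
  fderivWithin_chart (uniqueDiffOn_Icc_prod_ballU z hz)
    ((contMDiffOn_normalMap hγ he z hz).mdifferentiableWithinAt (by simp)) hp c

theorem fderivWithin_chartNormalMap_eq_zero (hγ : ContMDiffOn 𝓘(ℝ, ℝ) (𝓡 n) ∞ γ (Icc 0 1))
    (he : IsOrthonormalFrame h γ e) {z : ℝ × Eucl n}
    (hz : z ∈ Icc (0 : ℝ) 1 ×ˢ ballU h γ) {p : M}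
    (hp : normalMap h γ e z ∈ (chartAt (Eucl n) p).source) {c : ℝ × Eucl n}
    (hc : fderivWithin ℝ (chartNormalMap h γ e p) (Icc 0 1 ×ˢ ballU h γ) z c = 0) :
    dNormalMap h γ e z c = 0 := by
  rw [fderivWithin_chartNormalMap hγ he hz hp] at hc
  have h1 := mfderiv_extChartAt_symm_comp hp (dNormalMap h γ e z c)
  erw [hc] at h1
  exact h1.symm.trans (map_zero _)

theorem isInvertible_fderivWithin_chartNormalMap_inr (hγ : ContMDiffOn 𝓘(ℝ, ℝ) (𝓡 n) ∞ γ (Icc 0 1))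
    (he : IsOrthonormalFrame h γ e) {z : ℝ × Eucl n}
    (hz : z ∈ Icc (0 : ℝ) 1 ×ˢ ballU h γ) {p : M}
    (hp : normalMap h γ e z ∈ (chartAt (Eucl n) p).source) :
    ((fderivWithin ℝ (chartNormalMap h γ e p) (Icc 0 1 ×ˢ ballU h γ) z).comp
      (ContinuousLinearMap.inr ℝ ℝ (Eucl n))).IsInvertible :=
  isInvertible_of_injective fun _ hv => mfderivWithin_normalMap_injective hγ he hz.1 hz.2
    (fderivWithin_chartNormalMap_eq_zero hγ he hz hp hv)

theorem sq_normalMap_eq (hγ : ContMDiffOn 𝓘(ℝ, ℝ) (𝓡 n) ∞ γ (Icc 0 1))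
    (he : IsOrthonormalFrame h γ e) (L : TangentBundle (𝓡 n) M → ℝ) {z : ℝ × Eucl n}
    (hz : z ∈ Icc (0 : ℝ) 1 ×ˢ ballU h γ) {p : M}
    (hp : normalMap h γ e z ∈ (chartAt (Eucl n) p).source) (c : ℝ × Eucl n) :
    L ⟨normalMap h γ e z, dNormalMap h γ e z c⟩ = localLagrangian L p
      (chartNormalMap h γ e p z,
        fderivWithin ℝ (chartNormalMap h γ e p) (Icc 0 1 ×ˢ ballU h γ) z c) :=
  localLagrangian_chart L (uniqueDiffOn_Icc_prod_ballU z hz)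
    ((contMDiffOn_normalMap hγ he z hz).mdifferentiableWithinAt (by simp)) hp c

theorem eventually_normalMap_mem_chart_source (hγ : ContMDiffOn 𝓘(ℝ, ℝ) (𝓡 n) ∞ γ (Icc 0 1))
    (he : IsOrthonormalFrame h γ e) {z : ℝ × Eucl n}
    (hz : z ∈ Icc (0 : ℝ) 1 ×ˢ ballU h γ) {p : M}
    (hp : normalMap h γ e z ∈ (chartAt (Eucl n) p).source) :
    ∀ᶠ z' in 𝓝[Icc (0 : ℝ) 1 ×ˢ ballU h γ] z, normalMap h γ e z' ∈ (chartAt (Eucl n) p).source :=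
  ((contMDiffOn_normalMap hγ he).continuousOn z hz).eventually
    ((chartAt (Eucl n) p).open_source.mem_nhds hp)

/-- Smoothness is read in a chart at the image point; since `dφ(0,·)` is injective, `v ≠ 0` keeps
the vector where `F²` is smooth. -/
theorem isHomogeneousLagrangian_fibreLagrangian (hγ : ContMDiffOn 𝓘(ℝ, ℝ) (𝓡 n) ∞ γ (Icc 0 1))
    (he : IsOrthonormalFrame h γ e) :
    IsHomogeneousLagrangian (fibreLagrangian F h γ e) (ballU h γ) where
  smooth := by
    rintro ⟨t, q, v⟩ ⟨ht, hq, hv⟩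
    simp only at ht hq hv
    set p := normalMap h γ e (t, q) with hp
    have hz : (t, q) ∈ Icc (0 : ℝ) 1 ×ˢ ballU h γ := ⟨ht, hq⟩
    have hps : normalMap h γ e (t, q) ∈ (chartAt (Eucl n) p).source := mem_chart_source _ _
    have hproj : ContDiff ℝ ∞ (fun x : ℝ × (Eucl n × Eucl n) => (x.1, x.2.1)) := by fun_prop
    have hmaps : MapsTo (fun x : ℝ × (Eucl n × Eucl n) => (x.1, x.2.1))
        (Icc 0 1 ×ˢ (ballU h γ ×ˢ {0}ᶜ)) (Icc 0 1 ×ˢ ballU h γ) := fun x hx => ⟨hx.1, hx.2.1⟩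
    have h1 := (contDiffWithinAt_chartNormalMap hγ he hz hps).comp (t, q, v)
      hproj.contDiffWithinAt hmaps
    have h2 := (contDiffWithinAt_fderivWithin_chartNormalMap hγ he hz hps).comp (t, q, v)
      hproj.contDiffWithinAt hmaps
    have h3 : ContDiffWithinAt ℝ ∞ (fun x : ℝ × (Eucl n × Eucl n) => ((0 : ℝ), x.2.2))
        (Icc 0 1 ×ˢ (ballU h γ ×ˢ {0}ᶜ)) (t, q, v) := by fun_prop
    have h4 := h1.prodMk (h2.clm_apply h3)
    have hne : fderivWithin ℝ (chartNormalMap h γ e p) (Icc 0 1 ×ˢ ballU h γ) (t, q) (0, v) ≠ 0 :=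
      fun h0 => hv (mfderivWithin_normalMap_injective hγ he ht hq
        (fderivWithin_chartNormalMap_eq_zero hγ he hz hps h0))
    have hℓ : ContDiffAt ℝ ∞ (localLagrangian F.sq p) (chartNormalMap h γ e p (t, q),
        fderivWithin ℝ (chartNormalMap h γ e p) (Icc 0 1 ×ˢ ballU h γ) (t, q) (0, v)) :=
      (contDiffOn_localLagrangian F.contMDiffOn_sq p).contDiffAt
        (((isOpen_extChartAt_target p).prod isOpen_compl_singleton).mem_nhds
          ⟨mem_extChartAt_target _, hne⟩)
    have h5 := ContDiffAt.comp_contDiffWithinAt (t, q, v) hℓ h4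
    refine h5.congr_of_eventuallyEq ?_ (sq_normalMap_eq hγ he F.sq hz hps _)
    have htend : Tendsto (fun x : ℝ × (Eucl n × Eucl n) => (x.1, x.2.1))
        (𝓝[Icc 0 1 ×ˢ (ballU h γ ×ˢ {0}ᶜ)] (t, q, v)) (𝓝[Icc 0 1 ×ˢ ballU h γ] (t, q)) :=
      hproj.continuous.continuousWithinAt.tendsto_nhdsWithin hmaps
    filter_upwards [htend.eventually (eventually_normalMap_mem_chart_source hγ he hz hps),
      self_mem_nhdsWithin] with x hx hxS
    exact sq_normalMap_eq hγ he F.sq (z := (x.1, x.2.1)) (hmaps hxS) hx _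
  homogeneous := by
    intro t ht q hq v a ha
    have h1 : ((0, a • v) : ℝ × Eucl n) = a • (0, v) := by simp
    simp only [fibreLagrangian, FinslerMetric.sq]
    rw [h1, map_smul, ← mul_pow]
    congr 1
    exact F.homogeneous _ _ a ha

/-- The linear equation that defines the drift can be read in any chart, and the inverse of an
operator depends smoothly on it. -/
theorem contDiffOn_drift (hγ : ContMDiffOn 𝓘(ℝ, ℝ) (𝓡 n) ∞ γ (Icc 0 1))
    (he : IsOrthonormalFrame h γ e) :
    ContDiffOn ℝ ∞ (fun z : ℝ × Eucl n => drift h γ e z.1 z.2) (Icc 0 1 ×ˢ ballU h γ) := by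
  intro z hz
  set p := normalMap h γ e z with hp
  have hps : normalMap h γ e z ∈ (chartAt (Eucl n) p).source := mem_chart_source _ _
  have h1 := contDiffWithinAt_fderivWithin_chartNormalMap hγ he hz hps
  have h2 : ContDiffWithinAt ℝ ∞ (fun z => (fderivWithin ℝ (chartNormalMap h γ e p)
      (Icc 0 1 ×ˢ ballU h γ) z).comp (ContinuousLinearMap.inr ℝ ℝ (Eucl n)))
      (Icc 0 1 ×ˢ ballU h γ) z := h1.clm_comp contDiffWithinAt_const
  have h3 := ContDiffAt.comp_contDiffWithinAt z
    ((isInvertible_fderivWithin_chartNormalMap_inr hγ he hz hps).contDiffAt_map_inverse (n := ∞)) h2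
  have h4 := h3.clm_apply (h1.clm_apply (contDiffWithinAt_const (c := ((1, 0) : ℝ × Eucl n))))
  have key : ∀ z' ∈ Icc (0 : ℝ) 1 ×ˢ ballU h γ,
      normalMap h γ e z' ∈ (chartAt (Eucl n) p).source → drift h γ e z'.1 z'.2 =
        ((fderivWithin ℝ (chartNormalMap h γ e p) (Icc 0 1 ×ˢ ballU h γ) z').comp
          (ContinuousLinearMap.inr ℝ ℝ (Eucl n))).inverse
          (fderivWithin ℝ (chartNormalMap h γ e p) (Icc 0 1 ×ˢ ballU h γ) z' (1, 0)) := by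
    intro z' hz' hp'
    refine ((isInvertible_fderivWithin_chartNormalMap_inr hγ he hz' hp').inverse_apply_eq.2
      ?_).symm
    rw [ContinuousLinearMap.comp_apply, ContinuousLinearMap.inr_apply,
      fderivWithin_chartNormalMap hγ he hz' hp', fderivWithin_chartNormalMap hγ he hz' hp',
      dNormalMap_drift hγ he hz'.1 hz'.2]
  refine h4.congr_of_eventuallyEq ?_ (key z hz hps)
  filter_upwards [eventually_normalMap_mem_chart_source hγ he hz hps, self_mem_nhdsWithin]
    with z' hz' hzS using key z' hzS hz'

/-- At `q = 0` the drift is mapped by `dφ(0,·)` to the velocity of the geodesic. -/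
theorem drift_zero_ne_zero (hγ : ContMDiffOn 𝓘(ℝ, ℝ) (𝓡 n) ∞ γ (Icc 0 1))
    (he : IsOrthonormalFrame h γ e)
    (hreg : ∀ t ∈ Icc (0 : ℝ) 1, velocity (n := n) γ t ≠ 0) (h0 : 0 ∈ ballU h γ) {t : ℝ}
    (ht : t ∈ Icc (0 : ℝ) 1) : drift h γ e t 0 ≠ 0 := by
  intro hd
  have h1 := dNormalMap_drift hγ he ht h0
  have h2 : ((0, 0) : ℝ × Eucl n) = 0 := rfl
  rw [hd, h2, map_zero] at h1
  exact hreg t ht ((mfderivWithin_normalMap_one hγ he h0 ht).symm.trans h1.symm)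

theorem exists_isQuadraticLagrangian_tildeG (hγ : ContMDiffOn 𝓘(ℝ, ℝ) (𝓡 n) ∞ γ (Icc 0 1))
    (he : IsOrthonormalFrame h γ e)
    (hreg : ∀ t ∈ Icc (0 : ℝ) 1, velocity (n := n) γ t ≠ 0) (h0 : 0 ∈ ballU h γ) :
    ∃ r C, IsQuadraticLagrangian (fun t (z : Eucl n × Eucl n) => tildeG F h γ e t z.1 z.2) r C := by
  obtain ⟨r, C, -, hG⟩ := (isHomogeneousLagrangian_fibreLagrangian (F := F) hγ
    he).exists_isQuadraticLagrangian (isOpen_ballU h γ) h0 (contDiffOn_drift hγ he)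
      (fun t ht => drift_zero_ne_zero hγ he hreg h0 ht)
      (G := fun t (z : Eucl n × Eucl n) => tildeG F h γ e t z.1 z.2)
      (fun t ht z hz => tildeG_eq_fibreLagrangian hγ he ht hz)
  exact ⟨r, C, hG⟩

theorem tildeG_zero_left (hγ : ContMDiffOn 𝓘(ℝ, ℝ) (𝓡 n) ∞ γ (Icc 0 1))
    (he : IsOrthonormalFrame h γ e) (h0 : 0 ∈ ballU h γ) {t : ℝ}
    (ht : t ∈ Icc (0 : ℝ) 1) {y : Eucl n} {W : TangentSpace (𝓡 n) (γ t)}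
    (hW : W = dNormalMap h γ e (t, 0) (0, y)) :
    tildeG F h γ e t 0 y = F.sq ⟨γ t, velocity γ t + W⟩ := by
  refine tangentBundle_congr (normalMap_zero t) ?_
  change dNormalMap h γ e (t, 0) (1, y) = _
  have h1 : ((1, y) : ℝ × Eucl n) = (1, 0) + (0, y) := by simp
  rw [h1, map_add, hW]
  exact congrArg (· + _) (mfderivWithin_normalMap_one hγ he h0 ht)

/-- On `q = 0` the Lagrangian is `F²` at the velocity of the geodesic plus a vector linear and
injective in `y`; so this is strong convexity at a nonzero vector. -/
theorem fderiv_fderiv_tildeG_pos (hγ : ContMDiffOn 𝓘(ℝ, ℝ) (𝓡 n) ∞ γ (Icc 0 1))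
    (he : IsOrthonormalFrame h γ e)
    (hreg : ∀ t ∈ Icc (0 : ℝ) 1, velocity (n := n) γ t ≠ 0) (h0 : 0 ∈ ballU h γ) {r C : ℝ}
    (hG : IsQuadraticLagrangian (fun t (z : Eucl n × Eucl n) => tildeG F h γ e t z.1 z.2) r C)
    {t : ℝ} (ht : t ∈ Icc (0 : ℝ) 1) {y : Eucl n} (hy : y ≠ 0) :
    0 < fderiv ℝ (fderiv ℝ (fun z : Eucl n × Eucl n => tildeG F h γ e t z.1 z.2)) 0
      (0, y) (0, y) := by
  set G : Eucl n × Eucl n → ℝ := fun z => tildeG F h γ e t z.1 z.2 with hGdef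
  obtain ⟨W, hW⟩ : ∃ W : TangentSpace (𝓡 n) (γ t), W = dNormalMap h γ e (t, 0) (0, y) := ⟨_, rfl⟩
  have hW0 : W ≠ 0 := fun hz => hy (mfderivWithin_normalMap_injective hγ he ht h0 (hW.symm.trans hz))
  have h1 := F.convex (γ t) (velocity γ t) W (hreg t ht) hW0
  have h2 : (fun s : ℝ => F.toFun ⟨γ t, velocity γ t + s • W⟩ ^ 2)
      = fun s : ℝ => G (s • (0, y)) := by
    funext s
    have h3 : G (s • (0, y)) = tildeG F h γ e t 0 (s • y) := by simp [hGdef]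
    have h4 : ((0, s • y) : ℝ × Eucl n) = s • (0, y) := by simp
    rw [h3]
    refine (tildeG_zero_left hγ he h0 ht ?_).symm
    rw [h4, map_smul, hW]
    rfl
  have h3 : deriv (fun s : ℝ => G (s • (0, y))) = fun s => fderiv ℝ G (s • (0, y)) (0, y) := by
    funext s
    have h4 : HasDerivAt (fun s : ℝ => s • ((0, y) : Eucl n × Eucl n)) (0, y) s := by
      simpa using (hasDerivAt_id s).smul_const ((0, y) : Eucl n × Eucl n)
    have h5 := (hG.differentiableAt t ht (s • (0, y)) (by simpa using hG.r_pos)).hasFDerivAt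
    exact (h5.comp_hasDerivAt s h4).deriv
  have h4 := (hasDerivAt_apply_smul (hG.hasFDerivAt_fderiv_zero ht) (0, y) (0, y)).deriv
  have h5 : iteratedDeriv 2 (fun s : ℝ => G (s • (0, y))) 0 =
      fderiv ℝ (fderiv ℝ G) 0 (0, y) (0, y) := by
    rw [iteratedDeriv_succ, iteratedDeriv_one, h3]
    exact h4
  rw [← h5, ← h2]
  exact h1

/-- In the moving coordinates `φ` the geodesic is the curve `q = 0` and `G̃` is `F²`; the equation
in a fixed chart is carried over by `hasDerivAt_fderiv_of_eulerLagrange`. -/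
theorem eulerLagrange_tildeG (hγ₀ : IsGeodesic F.sq γ) (he : IsOrthonormalFrame h γ e)
    (hreg : ∀ t ∈ Icc (0 : ℝ) 1, velocity (n := n) γ t ≠ 0) (h0 : 0 ∈ ballU h γ) {t₀ : ℝ}
    (ht₀ : t₀ ∈ Ioo (0 : ℝ) 1) (a : Eucl n) :
    HasDerivAt (fun t => fderiv ℝ (fun z : Eucl n × Eucl n => tildeG F h γ e t z.1 z.2) 0 (0, a))
      (fderiv ℝ (fun z : Eucl n × Eucl n => tildeG F h γ e t₀ z.1 z.2) 0 (a, 0)) t₀ := by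
  have hγ := hγ₀.smooth
  have ht₀' : t₀ ∈ Icc (0 : ℝ) 1 := Ioo_subset_Icc_self ht₀
  set p := γ t₀ with hp
  set f := chartNormalMap h γ e p with hf
  have hz₀ : (t₀, (0 : Eucl n)) ∈ Icc (0 : ℝ) 1 ×ˢ ballU h γ := ⟨ht₀', h0⟩
  have hps : normalMap h γ e (t₀, 0) ∈ (chartAt (Eucl n) p).source := by
    rw [normalMap_zero]
    exact mem_chart_source _ _
  have hinterior : Ioo (0 : ℝ) 1 ×ˢ ballU h γ ∈ 𝓝 (t₀, (0 : Eucl n)) :=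
    (isOpen_Ioo.prod (isOpen_ballU h γ)).mem_nhds ⟨ht₀, h0⟩
  have hnhds : ∀ z ∈ Ioo (0 : ℝ) 1 ×ˢ ballU h γ, Icc (0 : ℝ) 1 ×ˢ ballU h γ ∈ 𝓝 z := fun z hz =>
    mem_of_superset ((isOpen_Ioo.prod (isOpen_ballU h γ)).mem_nhds hz)
      (prod_mono_left Ioo_subset_Icc_self)
  have hS : Icc (0 : ℝ) 1 ×ˢ ballU h γ ∈ 𝓝 (t₀, (0 : Eucl n)) := hnhds (t₀, 0) ⟨ht₀, h0⟩
  have hev : ∀ᶠ z in 𝓝 (t₀, (0 : Eucl n)), normalMap h γ e z ∈ (chartAt (Eucl n) p).source := by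
    have := eventually_normalMap_mem_chart_source hγ he hz₀ hps
    rwa [nhdsWithin_eq_nhds.2 hS] at this
  have hfd : ContDiffAt ℝ ∞ f (t₀, 0) :=
    (contDiffWithinAt_chartNormalMap hγ he hz₀ hps).contDiffAt hS
  have hslice : Tendsto (fun t : ℝ => (t, (0 : Eucl n))) (𝓝 t₀) (𝓝 (t₀, 0)) :=
    (Continuous.prodMk_left (0 : Eucl n)).tendsto t₀
  have hlift : ∀ᶠ t in 𝓝 t₀, chartLift p γ t = (f (t, 0), fderiv ℝ f (t, 0) (1, 0)) := by
    have h1 : ∀ᶠ z in 𝓝 (t₀, (0 : Eucl n)), ContDiffAt ℝ 1 f z :=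
      (hfd.of_le (by simp)).eventually (by simp)
    filter_upwards [hslice.eventually h1, isOpen_Ioo.mem_nhds ht₀] with t ht htI
    have h2 : (fun s => extChartAt (𝓡 n) p (γ s)) = fun s => f (s, 0) := by
      funext s
      rw [hf, chartNormalMap, normalMap_zero]
    have h3 := (ht.differentiableAt (by simp)).hasFDerivAt.comp_hasDerivAt t
      (hasFDerivAt_prodMk_left t (0 : Eucl n)).hasDerivAt
    rw [chartLift, h2, derivWithin_of_mem_nhds (Icc_mem_nhds htI.1 htI.2)]
    refine Prod.ext (congrFun h2 t) ?_
    exact h3.deriv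
  have hne : fderiv ℝ f (t₀, 0) (1, 0) ≠ 0 := by
    intro hz
    rw [← fderivWithin_of_mem_nhds hS] at hz
    have h1 := fderivWithin_chartNormalMap_eq_zero hγ he hz₀ hps hz
    exact hreg t₀ ht₀' ((mfderivWithin_normalMap_one hγ he h0 ht₀').symm.trans h1)
  refine hasDerivAt_fderiv_of_eulerLagrange (f := f) (ℓ := localLagrangian F.sq p)
    (G := fun t (z : Eucl n × Eucl n) => tildeG F h γ e t z.1 z.2) hfd ?_ ?_ ?_ a
  · have hopen := (isOpen_extChartAt_target (I := 𝓡 n) p).prod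
      (isOpen_compl_singleton (x := (0 : Eucl n)))
    have hcont : ContinuousAt (fun t : ℝ => (f (t, 0), fderiv ℝ f (t, 0) (1, 0))) t₀ := by
      have h1 : ContinuousAt (fun z => (f z, fderiv ℝ f z (1, 0))) (t₀, (0 : Eucl n)) :=
        hfd.continuousAt.prodMk
          ((hfd.fderiv_right (m := ∞) (by simp)).continuousAt.clm_apply continuousAt_const)
      exact ContinuousAt.comp (f := fun t : ℝ => (t, (0 : Eucl n))) h1 hslice
    have hmem : (f (t₀, 0), fderiv ℝ f (t₀, 0) (1, 0)) ∈
        (extChartAt (𝓡 n) p).target ×ˢ ({0}ᶜ : Set (Eucl n)) := by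
      refine ⟨(extChartAt (𝓡 n) p).map_source ?_, hne⟩
      rwa [extChartAt_source]
    filter_upwards [hcont.eventually (hopen.mem_nhds hmem)] with t ht
    exact ((contDiffOn_localLagrangian F.contMDiffOn_sq p).contDiffAt
      (hopen.mem_nhds ht)).differentiableAt (by simp)
  · filter_upwards [hev, hinterior] with z hz hzI y
    have h1 := sq_normalMap_eq hγ he F.sq (z := z) ⟨Ioo_subset_Icc_self hzI.1, hzI.2⟩ hz (1, y)
    rw [fderivWithin_of_mem_nhds (hnhds z hzI)] at h1
    exact h1
  · have h1 := (hγ₀.euler_lagrange p t₀ ht₀' (mem_chart_source _ _)).hasDerivAt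
      (Icc_mem_nhds ht₀.1 ht₀.2)
    rw [hlift.self_of_nhds] at h1
    refine h1.congr_of_eventuallyEq ?_
    filter_upwards [hlift] with t ht
    rw [ht]
    rfl

end TildeG
end FinslerFlow

/-! ### The lemma for the action of the Finsler Lagrangian -/

open FinslerFlow in
theorem mainTheorem3 {n : ℕ} {M : Type*} [TopologicalSpace M] [T2Space M]
    [ChartedSpace (Eucl n) M] [IsManifold (𝓡 n) ∞ M]
    (F : FinslerMetric n M) (h : RMetric n M)
    -- a nonconstant geodesic of the Finsler metric with non-conjugate end points
    (γ₀ : ℝ → M) (hγ₀ : IsGeodesic F.sq γ₀)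
    (hreg : ∀ t ∈ Icc (0 : ℝ) 1, velocity (n := n) γ₀ t ≠ 0)
    (hconj : ¬ ConjugateEndpoints F.sq γ₀)
    -- an orthonormal frame along the geodesic
    (e : Fin n → ∀ t : ℝ, TangentSpace (𝓡 n) (γ₀ t)) (he : IsOrthonormalFrame h γ₀ e)
    -- the cut-off function of the Lagrangian
    (U' : Set (Eucl n)) (hU'open : IsOpen U') (hU'zero : (0 : Eucl n) ∈ U')
    (hU' : closure U' ⊆ ballU h γ₀)
    (α : Eucl n → ℝ) (hα : ContDiff ℝ ∞ α) (hα_one : ∀ q ∈ U', α q = 1)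
    (hα_zero : ∀ q, q ∉ ballU h γ₀ → α q = 0)
    -- the action functional
    (𝒜 : H10 n → ℝ) (h𝒜 : 𝒜 = action (lagr F h γ₀ e α))
    -- a scalar product that induces the topology of the Hilbert space
    (b : H10 n →L[ℝ] H10 n →L[ℝ] ℝ) (hb_symm : ∀ x y, b x y = b y x) (hb : IsCoercive b)
    -- the neighbourhood and the bump function that define the vector field
    (𝓤 : Set (H10 n)) (h𝓤open : IsOpen 𝓤) (h𝓤zero : (0 : H10 n) ∈ 𝓤)
    (η₀ : H10 n → ℝ) (hη₀ : ContDiff ℝ ∞ η₀) (hη₀_range : ∀ x, η₀ x ∈ Icc (0 : ℝ) 1)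
    (hη₀_one : ∀ x ∈ 𝓤, η₀ x = 1)
    (𝓥 : Set (H10 n)) (h𝓥closed : IsClosed 𝓥) (h𝓥nhds : 𝓥 ∈ 𝓝 (0 : H10 n)) (h𝓥 : 𝓥 ⊆ 𝓤) :
    ∃ ε : ℝ, 0 < ε ∧ ∃ O' : Set (H10 n), IsOpen O' ∧ (0 : H10 n) ∈ O' ∧ O' ⊆ 𝓥 ∧
      ∀ x ∈ O',
        (∃ (ωminus ωplus : EReal) (ψ : ℝ → H10 n),
          IsMaximalSolution (fieldY b 𝒜 η₀) x ωminus ωplus ψ) ∧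
        ∀ (ωminus ωplus : EReal) (ψ : ℝ → H10 n),
          IsMaximalSolution (fieldY b 𝒜 η₀) x ωminus ωplus ψ →
            (ωplus = ⊤ ∧ ∀ t : ℝ, 0 ≤ t → ψ t ∈ 𝓥) ∨
            (∃ T : ℝ, 0 ≤ T ∧ (T : EReal) < ωplus ∧ 𝒜 (ψ T) < 𝒜 0 - ε ∧
              ∀ t ∈ Icc (0 : ℝ) T, ψ t ∈ 𝓥) := by
  have h0 : (0 : Eucl n) ∈ ballU h γ₀ := hU' (subset_closure hU'zero)
  obtain ⟨r, C, hG⟩ := exists_isQuadraticLagrangian_tildeG (F := F) hγ₀.smooth he hreg h0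
  -- The supremum norm is at most the `H¹₀` norm, so curves of norm below `ρ` stay in `U'`, where `α
  -- = 1` and the Lagrangian is `G̃`.
  obtain ⟨ρ, hρ, hball⟩ := Metric.isOpen_iff.1 hU'open 0 hU'zero
  refine hG.exists_flow_neighbourhood
    (fun t ht y hy => fderiv_fderiv_tildeG_pos hγ₀.smooth he hreg h0 hG ht hy)
    (fun t ht a => eulerLagrange_tildeG hγ₀ he hreg h0 ht a) hρ ?_ hb_symm hb h𝓤open hη₀_one
    h𝓥nhds h𝓥
  intro x hx
  rw [h𝒜, action]
  congr 1
  refine integral_congr_ae ?_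
  filter_upwards [ae_mem_Icc] with t ht
  have hmem : H10curve x t ∈ U' :=
    hball (mem_ball_zero_iff.2 ((norm_H10curve_le x ht).trans_lt hx))
  simp [lagr, hα_one _ hmem, H10pair]
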